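/- **Setting.** Let $g,n\ge 0$ with $2g-2+n>0$. A *graph* is a finite graph with vertex genera $h(v)\in\mathbb N$ and $n$ numbered legs, of genus $b_1+\sum_v h(v)$; a *morphism* of graphs is a weighted edge contraction followed by an isomorphism. A connected graph of genus $g$ is *stable* if $2h(v)-2+\mathrm{val}(v)>0$ for every vertex $v$, and *quasi-stable* if every vertex of genus $0$ has valence at least $2$, every vertex of genus $0$ and valence $2$ (called *exceptional*) has two distinct edges and no leg at it, and no two exceptional vertices are adjacent. The *stabilization* $G^{\mathrm{st}}$ of a quasi-stable graph $G$ is obtained by removing every exceptional vertex and merging the two edges at it into one edge, called an exceptional edge of $G^{\mathrm{st}}$; stabilization is a functor. A divisor on $G$ is *admissible* if it has value $1$ at every exceptional vertex. Let $\mathrm{QD}_{g,n}$ be the category of pairs $(G,D)$ with $G$ quasi-stable of type $(g,n)$ and $D$ admissible, with the morphisms $\pi$ of graphs such that $\pi_*D=D'$. For a stable graph $\overline G$ let $\mathrm{QD}_{\overline G}$ be the category of triples $(G,D,\rho)$ with $(G,D)\in\mathrm{QD}_{g,n}$ and $\rho\colon\overline G\cong G^{\mathrm{st}}$, with the morphisms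 $\pi$ of $\mathrm{QD}_{g,n}$ such that $\pi^{\mathrm{st}}\circ\rho=\rho'$. Let $\mathrm{RPC}$ be the category of rational polyhedral cones $\sigma$ (strictly convex and full-dimensional in $N_{\mathbb R}$ for a lattice $N$), and $S_\sigma=\mathrm{Hom}(\sigma\cap N,\mathbb N)$. A *(quasi-)stable tropical curve* over $\sigma$ is a (quasi-)stable graph with a metric $d\colon E(G)\to S_\sigma\setminus\{0\}$. A morphism $\Gamma/\sigma\to\Gamma'/\sigma'$ is a morphism $f\colon\sigma\to\sigma'$ of cones with a morphism of graphs $\pi\colon G'\to G$ such that $\pi$ contracts $e'$ if and only if $f^*d'(e')=0$, and $d(\pi(e'))=f^*d'(e')$ otherwise. This gives the categories fibered in groupoids over $\mathrm{RPC}$: $\mathcal M^{\mathrm{trop}}_{g,n}$ of stable tropical curves, and $\mathcal J^{\mathrm{trop}}_{g,n}$ of quasi-stable tropical curves with an admissible divisor (with $\pi$ a morphism of $\mathrm{QD}_{g,n}$). The functor $\Phi^{\mathrm{trop}}\colon\mathcal J^{\mathrm{trop}}_{g,n}\to\mathcal M^{\mathrm{trop}}_{g,n}$ forgets the divisor and stabilizes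 the curve, where the length of an exceptional edge of $G^{\mathrm{st}}$ is the sum of the two lengths in $G$. A stable tropical curve $\overline\Gamma/\sigma$ has a *modular morphism* $\overline\Gamma\colon\sigma\to\mathcal M^{\mathrm{trop}}_{g,n}$, $(u\colon\tau\to\sigma)\mapsto u^*\overline\Gamma$, where $\sigma$ is regarded as the category $\mathrm{RPC}/\sigma$. **The Jacobian cone space.** Let $\overline\Gamma$ be a stable tropical curve over $\sigma$, with graph $\overline G$ and metric $d_{\overline\Gamma}$. For $(G,D,\rho)\in\mathrm{QD}_{\overline G}$ let $$C_\sigma(G,D,\rho)=\prod_{e\in E_{\mathrm{exc}}(G^{\mathrm{st}})}\bigl(\sigma\times_{\mathbb R_{\ge0}}\mathbb R_{\ge0}^2\bigr)_e\qquad\text{(fiber product over }\sigma),$$ where $\mathbb R_{\ge0}^2\to\mathbb R_{\ge0}$ is addition and $\sigma\to\mathbb R_{\ge0}$ is the length in $\overline\Gamma$ of the edge $\rho^{-1}(e)$; the two coordinates are indexed by the two half-edges at the exceptional vertex $v$ of $G$ on $e$. A morphism $\pi\colon(G,D,\rho)\to(G',D',\rho')$ induces $C(\pi)\colon C_\sigma(G',D',\rho')\to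 C_\sigma(G,D,\rho)$ over $\sigma$: if $\pi(v)$ is exceptional, the coordinates at corresponding half-edges agree; if not, then the coordinate at a half-edge at $v$ is $0$ if this half-edge is contracted, and otherwise it is the whole length of $e$. For a face $\tau\le\sigma$ let $\overline\Gamma|_\tau$ be the restriction of $\overline\Gamma$ (the edges whose length vanishes on $\tau$ are contracted). The cones of the *Jacobian cone space* $\mathrm{Jac}_{\overline\Gamma/\sigma}$ are the cones $C_\tau(G,D,\rho)$ for the faces $\tau\le\sigma$ and the triples $(G,D,\rho)$ over the graph of $\overline\Gamma|_\tau$; they are glued along the maps over inclusions of faces $\tau\le\tau'$ that are induced, by the same formulas, by the morphisms $\pi\colon(G,D)\to(G',D')$ in $\mathrm{QD}_{g,n}$ from the datum over $\tau'$ to the datum over $\tau$ that are compatible with $\rho,\rho'$ and the contraction of $\overline\Gamma|_{\tau'}$ to $\overline\Gamma|_\tau$. As a category over $\mathrm{RPC}$, the objects of $\mathrm{Jac}_{\overline\Gamma/\sigma}$ over a cone $\kappa$ are such an index together with a morphism from $\kappa$ to its cone whose image is not contained in a proper face; the morphisms are those of the indices and cones compatible with these. It has a structure morphism to $\sigma$,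 and a morphism to $\mathcal J^{\mathrm{trop}}_{g,n}$ that sends a point of $C_\tau(G,D,\rho)$ to $(G,D)$, where the coordinates are the lengths of the edges at the exceptional vertices and the other edges have the lengths of $\overline\Gamma$. **Theorem.** For every stable tropical curve $\overline\Gamma$ of type $(g,n)$ over a rational polyhedral cone $\sigma$ the modular morphism exists, and the square $$\begin{array}{ccc}\mathrm{Jac}_{\overline\Gamma/\sigma}&\longrightarrow&\mathcal J^{\mathrm{trop}}_{g,n}\\ \downarrow&&\downarrow{\scriptstyle\Phi^{\mathrm{trop}}}\\ \sigma&\xrightarrow{\ \overline\Gamma\ }&\mathcal M^{\mathrm{trop}}_{g,n}\end{array}$$ is $2$-cartesian: it commutes up to an isomorphism over $\mathrm{RPC}$, given by the isomorphisms $\rho$, and the induced functor from $\mathrm{Jac}_{\overline\Gamma/\sigma}$ to the $2$-fiber product $\sigma\times_{\mathcal M^{\mathrm{trop}}_{g,n}}\mathcal J^{\mathrm{trop}}_{g,n}$ is an equivalence of categories. Moreover, the objects of $\mathrm{Jac}_{\overline\Gamma/\sigma}$ that come from the cones $C_\sigma(G,D,\rho)$ indexed by $\mathrm{QD}_{\overline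 G}^{\mathrm{opp}}$ alone, with the morphisms of $\mathrm{QD}_{\overline G}$, form up to isomorphism exactly the full subcategory of the objects whose structure map $\kappa\to\sigma$ has image not contained in a proper face of $\sigma$. The same holds for the versions of $\mathcal J^{\mathrm{trop}}_{g,n}$ and $\mathrm{Jac}_{\overline\Gamma/\sigma}$ in which $(G,D)$ is restricted to: divisors of a fixed degree $d$; simple quasi-stable graphs (those that stay connected after removing the exceptional vertices); divisors of degree $d$ on simple quasi-stable graphs; or $\phi$-semistable divisors for a universal stability condition $\phi$. Here a universal stability condition assigns to every stable graph $G$ of type $(g,n)$ a function $\phi_G\colon V(G)\to\mathbb R$ with integral sum $|\phi|$, compatibly with all morphisms (by summation over fibers); it is extended to quasi-stable graphs by $\phi_{G^{\mathrm{st}}}$ on non-exceptional and $0$ on exceptional vertices; and an admissible $D$ is $\phi$-semistable if $\deg D=|\phi|$ and $|D(S)-\phi_G(S)|\le\tfrac12|E(S,S^c)|$ for all $S\subseteq V(G)$. -/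

import Mathlib

open CategoryTheory

namespace TropJac

/-- A vertex-weighted graph with `n` marked legs. `X` is the finite set of vertices and flags, `r` the
idempotent root map, whose image is the set of vertices; the other elements are the flags. `i` is
an involution that fixes the vertices; the flags fixed by `i` are the legs, the other flags are the
half-edges, and the edges are the pairs `{x, i x}` of half-edges. `h` is the genus function on the
vertices (put to zero on the flags), and `m` numbers the legs. -/
structure MGraph (n : ℕ) : Type 1 where
  X : Type
  [fin : Finite X]
  r : X → X
  i : X → X
  r_r : ∀ x, r (r x) = r x
  i_i : ∀ x, i (i x) = x
  i_r : ∀ x, i (r x) = r x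
  h : X → ℕ
  h_flag : ∀ x, r x ≠ x → h x = 0
  m : Fin n → X
  m_inj : Function.Injective m
  m_range : ∀ x, (∃ k, m k = x) ↔ (r x ≠ x ∧ i x = x)

attribute [instance] MGraph.fin

namespace MGraph

variable {n : ℕ}

open Classical in
/-- `2 h(v) - 2` at a vertex, `1` at a half-edge and `0` at a leg. -/
noncomputable def weight (G : MGraph n) (x : G.X) : ℤ :=
  if G.r x = x then 2 * (G.h x : ℤ) - 2 else if G.i x = x then 0 else 1

/-- A subgraph `Y` (a subset of vertices and flags) has a vertex, and any two vertices of `Y` are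
connected by a path along the half-edges in `Y`. -/
def Connected (G : MGraph n) (Y : Set G.X) : Prop :=
  (∃ a ∈ Y, G.r a = a) ∧
    ∀ a ∈ Y, ∀ b ∈ Y, G.r a = a → G.r b = b →
      Relation.ReflTransGen (fun a b => ∃ x ∈ Y, G.r x = a ∧ G.r (G.i x) = b) a b

/-- `Y` has genus `g`: for a connected subgraph `Y` with set of vertices `V`, the number
`g = b₁ + ∑ h(v)` is determined by `2 g - 2 = ∑ (2 h(v) - 2) + #(half-edges of Y)`. -/
def HasGenus (G : MGraph n) (Y : Set G.X) (g : ℕ) : Prop :=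
  2 * (g : ℤ) - 2 = ∑ᶠ x ∈ Y, G.weight x

/-- Morphisms of graphs: they commute with the root maps, the involutions and the markings, every
flag of the target has exactly one preimage, and the preimage of a vertex `v` is a connected
subgraph of genus `h(v)`. -/
@[ext]
structure Hom (G G' : MGraph n) where
  map : G.X → G'.X
  map_r : ∀ x, map (G.r x) = G'.r (map x)
  map_i : ∀ x, map (G.i x) = G'.i (map x)
  map_flag : ∀ y, G'.r y ≠ y → ∃! x, map x = y
  map_m : ∀ k, map (G.m k) = G'.m k
  conn : ∀ v, G'.r v = v → G.Connected (map ⁻¹' {v})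
  genus : ∀ v, G'.r v = v → G.HasGenus (map ⁻¹' {v}) (G'.h v)

theorem finsum_fiber {A B M : Type} [Finite A] [Finite B] [AddCommMonoid M] (f : A → B)
    (c : A → M) (S : Set B) :
    ∑ᶠ x ∈ f ⁻¹' S, c x = ∑ᶠ y ∈ S, ∑ᶠ x ∈ f ⁻¹' {y}, c x := by
  have e : f ⁻¹' S = ⋃ y ∈ S, f ⁻¹' {y} := by ext x; simp
  rw [e, finsum_mem_biUnion _ S.toFinite (fun _ _ => Set.toFinite _)]
  · intro a _ b _ hab
    refine Set.disjoint_left.2 fun x hx hx' => hab ?_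
    simp only [Set.mem_preimage, Set.mem_singleton_iff] at hx hx'
    rw [← hx, hx']

namespace Hom

variable {G G' G'' : MGraph n}

theorem r_of_map_flag (f : Hom G G') {x : G.X} (hx : G'.r (f.map x) ≠ f.map x) :
    G.r x ≠ x := fun h => hx (by rw [← f.map_r, h])

theorem surj (f : Hom G G') (y : G'.X) : ∃ x, f.map x = y := by
  by_cases hy : G'.r y = y
  · obtain ⟨a, ha, _⟩ := (f.conn y hy).1
    exact ⟨a, ha⟩
  · exact (f.map_flag y hy).exists

theorem fiber_flag (f : Hom G G') {x : G.X} (hx : G'.r (f.map x) ≠ f.map x) :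
    f.map ⁻¹' {f.map x} = {x} := by
  ext z
  simp only [Set.mem_preimage, Set.mem_singleton_iff]
  exact ⟨fun h => (f.map_flag _ hx).unique h rfl, fun h => by rw [h]⟩

theorem i_iff (f : Hom G G') {x : G.X} (hx : G'.r (f.map x) ≠ f.map x) :
    G'.i (f.map x) = f.map x ↔ G.i x = x := by
  rw [← f.map_i]
  exact ⟨fun h => (f.map_flag _ hx).unique h rfl, fun h => by rw [h]⟩

theorem push_weight (f : Hom G G') (y : G'.X) :
    ∑ᶠ x ∈ f.map ⁻¹' {y}, G.weight x = G'.weight y := by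
  by_cases hy : G'.r y = y
  · have := f.genus y hy
    rw [HasGenus] at this
    rw [← this, weight, if_pos hy]
  · obtain ⟨x, rfl⟩ := f.surj y
    rw [f.fiber_flag hy, finsum_mem_singleton, weight, weight, if_neg hy,
      if_neg (f.r_of_map_flag hy)]
    have := f.i_iff hy
    by_cases h : G.i x = x
    · rw [if_pos h, if_pos (this.2 h)]
    · rw [if_neg h, if_neg fun h' => h (this.1 h')]

theorem hasGenus_preimage (f : Hom G G') (Y : Set G'.X) (g : ℕ) :
    G.HasGenus (f.map ⁻¹' Y) g ↔ G'.HasGenus Y g := by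
  unfold HasGenus
  rw [finsum_fiber f.map, finsum_mem_congr rfl fun y _ => f.push_weight y]

theorem connected_preimage (f : Hom G G') {Y : Set G'.X} (hr : ∀ x ∈ Y, G'.r x ∈ Y)
    (hY : G'.Connected Y) :
    G.Connected (f.map ⁻¹' Y) := by
  obtain ⟨⟨v, hv, hv'⟩, hp⟩ := hY
  refine ⟨?_, ?_⟩
  · obtain ⟨a, ha, ha'⟩ := (f.conn v hv').1
    refine ⟨a, ?_, ha'⟩
    rw [Set.mem_preimage, show f.map a = v from ha]
    exact hv
  · have fib : ∀ a b : G.X, f.map a ∈ Y → f.map a = f.map b → G.r a = a → G.r b = b →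
        Relation.ReflTransGen
          (fun a b => ∃ x ∈ f.map ⁻¹' Y, G.r x = a ∧ G.r (G.i x) = b) a b := by
      intro a b haY hab ha hb
      refine Relation.ReflTransGen.mono ?_ _ _
        ((f.conn (f.map a) (by rw [← f.map_r, ha])).2 a rfl b hab.symm ha hb)
      rintro c d ⟨x, hx, h⟩
      refine ⟨x, ?_, h⟩
      rw [Set.mem_preimage, show f.map x = f.map a from hx]
      exact haY
    intro a ha b hb ha' hb'
    have key : ∀ c, Relation.ReflTransGen
        (fun a b => ∃ x ∈ Y, G'.r x = a ∧ G'.r (G'.i x) = b) (f.map a) c → c ∈ Y →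
        ∀ z, G.r z = z → f.map z = c → Relation.ReflTransGen
          (fun a b => ∃ x ∈ f.map ⁻¹' Y, G.r x = a ∧ G.r (G.i x) = b) a z := by
      intro c hc
      induction hc with
      | refl => intro hc z hz hz'; exact fib a z hc hz'.symm ha' hz
      | tail hc1 hstep ih =>
        rename_i c d
        intro hd z hz hz'
        obtain ⟨x', hx'Y, hx'c, hx'd⟩ := hstep
        by_cases hx' : G'.r x' = x'
        · have e1 : c = x' := by rw [← hx'c, hx']
          have e2 : d = x' := by
            rw [← hx'd, ← hx', G'.i_r, G'.r_r]
          exact ih (e1 ▸ hx'Y) z hz (by rw [hz', e1, e2])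
        · obtain ⟨x, rfl⟩ := f.surj x'
          have hrx : f.map (G.r x) = c := by rw [f.map_r, hx'c]
          have hrix : f.map (G.r (G.i x)) = d := by rw [f.map_r, f.map_i, hx'd]
          have p1 := ih (hx'c ▸ hr _ hx'Y) (G.r x) (G.r_r x) hrx
          have p2 := fib (G.r (G.i x)) z (by rw [hrix]; exact hd) (by rw [hrix, hz'])
            (G.r_r _) hz
          exact (p1.tail ⟨x, hx'Y, rfl, rfl⟩).trans p2
    exact key _ (hp _ ha _ hb (by rw [← f.map_r, ha']) (by rw [← f.map_r, hb'])) hb b hb' rfl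

end Hom

variable {G G' G'' : MGraph n}

def Hom.id (G : MGraph n) : Hom G G where
  map := _root_.id
  map_r _ := rfl
  map_i _ := rfl
  map_flag y _ := ⟨y, rfl, fun _ h => h⟩
  map_m _ := rfl
  conn v hv := by
    refine ⟨⟨v, rfl, hv⟩, ?_⟩
    intro a ha b hb _ _
    rw [show a = v from ha, show b = v from hb]
  genus v hv := by
    rw [HasGenus, Set.preimage_id, finsum_mem_singleton, weight, if_pos hv]

def Hom.comp (f : Hom G G') (f' : Hom G' G'') : Hom G G'' where
  map := f'.map ∘ f.map
  map_r x := by simp [f.map_r, f'.map_r]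
  map_i x := by simp [f.map_i, f'.map_i]
  map_flag y hy := by
    obtain ⟨x', rfl, hx'⟩ := f'.map_flag y hy
    obtain ⟨x, rfl, hx⟩ := f.map_flag x' (f'.r_of_map_flag hy)
    exact ⟨x, rfl, fun z hz => hx z (hx' _ hz)⟩
  map_m k := by simp [f.map_m, f'.map_m]
  conn v hv := f.connected_preimage
    (fun x hx => by rw [Set.mem_preimage, f'.map_r, show f'.map x = v from hx]; exact hv)
    (f'.conn v hv)
  genus v hv := (f.hasGenus_preimage _ _).2 (f'.genus v hv)

/-- A map on vertices and flags through which a morphism factors, after another morphism, is a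
morphism. -/
def Hom.desc (q : Hom G G') (f : Hom G G'') (p : G'.X → G''.X) (hp : ∀ x, p (q.map x) = f.map x) :
    Hom G' G'' where
  map := p
  map_r x := by obtain ⟨x, rfl⟩ := q.surj x; rw [← q.map_r, hp, hp, f.map_r]
  map_i x := by obtain ⟨x, rfl⟩ := q.surj x; rw [← q.map_i, hp, hp, f.map_i]
  map_flag y hy := by
    obtain ⟨x, rfl, hx⟩ := f.map_flag y hy
    refine ⟨q.map x, hp x, fun z hz => ?_⟩
    obtain ⟨z, rfl⟩ := q.surj z
    rw [hx z (by simpa [hp] using hz)]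
  map_m k := by rw [← q.map_m, hp, f.map_m]
  conn v hv := by
    obtain ⟨⟨a, ha, ha'⟩, hc⟩ := f.conn v hv
    refine ⟨⟨q.map a, ?_, by rw [← q.map_r, ha']⟩, ?_⟩
    · rw [Set.mem_preimage, hp]; exact ha
    · intro b hb c hc' hbr hcr
      obtain ⟨b, rfl⟩ := q.surj b
      obtain ⟨c, rfl⟩ := q.surj c
      have e : ∀ x, q.map x ∈ p ⁻¹' {v} → f.map (G.r x) = v := by
        intro x hx
        rw [f.map_r, ← hp, show p (q.map x) = v from hx, hv]
      have := hc (G.r b) (e b hb) (G.r c) (e c hc') (G.r_r _) (G.r_r _)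
      have := Relation.ReflTransGen.lift (p := fun a b => ∃ x ∈ p ⁻¹' {v}, G'.r x = a ∧
        G'.r (G'.i x) = b) q.map (by
          rintro s t ⟨x, hx, rfl, rfl⟩
          refine ⟨q.map x, ?_, (q.map_r _).symm, ?_⟩
          · rw [Set.mem_preimage, hp]; exact hx
          · rw [q.map_r, q.map_i]) _ _ this
      rw [Function.onFun, q.map_r, q.map_r, hbr, hcr] at this
      exact this
  genus v hv := by
    rw [← q.hasGenus_preimage]
    have : q.map ⁻¹' (p ⁻¹' {v}) = f.map ⁻¹' {v} := by ext x; simp [hp]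
    rw [this]
    exact f.genus v hv

end MGraph

instance (n : ℕ) : Category (MGraph n) where
  Hom := MGraph.Hom
  id := MGraph.Hom.id
  comp := MGraph.Hom.comp
  id_comp _ := rfl
  comp_id _ := rfl
  assoc _ _ _ := rfl

@[ext]
theorem MGraph.hom_ext {n : ℕ} {G G' : MGraph n} {f f' : G ⟶ G'}
    (h : ∀ x, MGraph.Hom.map f x = MGraph.Hom.map f' x) : f = f' :=
  MGraph.Hom.ext (funext h)

@[simp] theorem MGraph.id_map {n : ℕ} (G : MGraph n) (x : G.X) : MGraph.Hom.map (𝟙 G) x = x := rfl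

@[simp] theorem MGraph.comp_map {n : ℕ} {G G' G'' : MGraph n} (f : G ⟶ G') (f' : G' ⟶ G'')
    (x : G.X) : MGraph.Hom.map (f ≫ f') x = MGraph.Hom.map f' (MGraph.Hom.map f x) := rfl

namespace MGraph

variable {n : ℕ}

/-- The valence of a vertex: the number of flags rooted at it. -/
noncomputable def val (G : MGraph n) (v : G.X) : ℕ :=
  {x | G.r x = v ∧ x ≠ v}.ncard

/-- An exceptional vertex: genus zero and valence two. -/
def IsExc (G : MGraph n) (v : G.X) : Prop :=
  G.r v = v ∧ G.h v = 0 ∧ G.val v = 2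

/-- Stable graphs of type `(g, n)`. -/
structure IsStable (g : ℕ) (G : MGraph n) : Prop where
  conn : G.Connected Set.univ
  genus : G.HasGenus Set.univ g
  pos : ∀ v, G.r v = v → 0 < 2 * (G.h v : ℤ) - 2 + G.val v

/-- Quasi-stable graphs of type `(g, n)`: connected, of genus `g`, vertices of genus zero have valence
at least two, at every exceptional vertex there are two edges (no leg and no loop), and distinct
exceptional vertices are not adjacent. -/
structure IsQuasiStable (g : ℕ) (G : MGraph n) : Prop where
  conn : G.Connected Set.univ
  genus : G.HasGenus Set.univ g
  two_le : ∀ v, G.r v = v → G.h v = 0 → 2 ≤ G.val v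
  exc_edges : ∀ x, G.IsExc (G.r x) → G.r x ≠ x → G.i x ≠ x ∧ G.r (G.i x) ≠ G.r x
  exc_adj : ∀ x, G.IsExc (G.r x) → G.IsExc (G.r (G.i x)) → G.r (G.i x) = G.r x

/-- For a flag `x` rooted at an exceptional vertex, the other flag rooted at that vertex. -/
noncomputable def sw (G : MGraph n) (x : G.X) : G.X :=
  @Classical.epsilon _ ⟨x⟩ fun y => G.r y = G.r x ∧ y ≠ G.r x ∧ y ≠ x

variable {G G' G'' : MGraph n}

theorem sw_aux {x : G.X} (h : G.IsExc (G.r x)) (hx : G.r x ≠ x) :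
    (G.r (G.sw x) = G.r x ∧ G.sw x ≠ G.r x ∧ G.sw x ≠ x) ∧
      ∀ y, G.r y = G.r x → y ≠ G.r x → y = x ∨ y = G.sw x := by
  obtain ⟨a, b, hab, e⟩ := Set.ncard_eq_two.1 h.2.2
  have mem : ∀ y, (G.r y = G.r x ∧ y ≠ G.r x) ↔ y = a ∨ y = b := by
    intro y
    have : y ∈ {y | G.r y = G.r x ∧ y ≠ G.r x} ↔ y ∈ ({a, b} : Set G.X) := by rw [e]
    simpa using this
  have ex : ∃ y, G.r y = G.r x ∧ y ≠ G.r x ∧ y ≠ x := by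
    rcases (mem x).1 ⟨rfl, hx.symm⟩ with h | h
    · exact ⟨b, ((mem b).2 (Or.inr rfl)).1, ((mem b).2 (Or.inr rfl)).2, by rw [h]; exact hab.symm⟩
    · exact ⟨a, ((mem a).2 (Or.inl rfl)).1, ((mem a).2 (Or.inl rfl)).2, by rw [h]; exact hab⟩
  have hs : G.r (G.sw x) = G.r x ∧ G.sw x ≠ G.r x ∧ G.sw x ≠ x := Classical.epsilon_spec ex
  refine ⟨hs, fun y h1 h2 => ?_⟩
  have hy := (mem y).1 ⟨h1, h2⟩
  have hsx := (mem _).1 ⟨hs.1, hs.2.1⟩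
  have hx' := (mem x).1 ⟨rfl, hx.symm⟩
  have := hs.2.2
  grind


theorem r_sw {x : G.X} (h : G.IsExc (G.r x)) (hx : G.r x ≠ x) : G.r (G.sw x) = G.r x :=
  (sw_aux h hx).1.1

theorem sw_flag {x : G.X} (h : G.IsExc (G.r x)) (hx : G.r x ≠ x) : G.r (G.sw x) ≠ G.sw x := by
  rw [r_sw h hx]; exact (sw_aux h hx).1.2.1.symm

theorem sw_ne {x : G.X} (h : G.IsExc (G.r x)) (hx : G.r x ≠ x) : G.sw x ≠ x :=
  (sw_aux h hx).1.2.2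

theorem eq_sw {x : G.X} (h : G.IsExc (G.r x)) (hx : G.r x ≠ x) {y : G.X} (hr : G.r y = G.r x)
    (hy : G.r y ≠ y) (hyx : y ≠ x) : y = G.sw x :=
  ((sw_aux h hx).2 y hr (by rw [← hr]; exact hy.symm)).resolve_left hyx

theorem sw_sw {x : G.X} (h : G.IsExc (G.r x)) (hx : G.r x ≠ x) : G.sw (G.sw x) = x :=
  (eq_sw (by rw [r_sw h hx]; exact h) (sw_flag h hx) (r_sw h hx).symm hx (sw_ne h hx).symm).symm

theorem r_i_flag {x : G.X} (hx : G.r x ≠ x) : G.r (G.i x) ≠ G.i x := by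
  intro h
  apply hx
  have : x = G.r (G.i x) := by rw [← G.i_r, h, G.i_i]
  rw [this, G.r_r]

open Classical in
/-- Auxiliary count, used to see how exceptional vertices behave under morphisms. -/
noncomputable def charge (G : MGraph n) (x : G.X) : ℤ :=
  if G.r x = x then 2 * (G.h x : ℤ) - 2 else 1

theorem sum_charge (G : MGraph n) {v : G.X} (hv : G.r v = v) :
    ∑ᶠ x ∈ {x | G.r x = v}, G.charge x = 2 * (G.h v : ℤ) - 2 + G.val v := by
  have e : {x | G.r x = v} = insert v {x | G.r x = v ∧ x ≠ v} := by
    ext x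
    simp only [Set.mem_ofPred_eq, Set.mem_insert_iff]
    constructor
    · intro h
      by_cases hx : x = v
      · exact Or.inl hx
      · exact Or.inr ⟨h, hx⟩
    · rintro (rfl | h)
      · exact hv
      · exact h.1
  rw [e, finsum_mem_insert _ (by simp) (Set.toFinite _)]
  congr 1
  · rw [charge, if_pos hv]
  · rw [finsum_mem_congr (g := fun _ => (1 : ℤ)) rfl]
    · rw [val, finsum_mem_eq_finite_toFinset_sum _ (Set.toFinite _),
        Set.ncard_eq_toFinset_card _ (Set.toFinite _)]
      simp
    · rintro x ⟨h1, h2⟩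
      rw [charge, if_neg]
      rw [h1]; exact h2.symm

theorem Hom.push_charge (f : Hom G G') (y : G'.X) :
    ∑ᶠ x ∈ f.map ⁻¹' {y}, G.charge x = G'.charge y := by
  by_cases hy : G'.r y = y
  · have h1 : G'.charge y = G'.weight y := by rw [charge, weight, if_pos hy, if_pos hy]
    rw [h1, ← f.push_weight]
    refine finsum_mem_congr rfl fun x hx => ?_
    rw [charge, weight]
    by_cases hx' : G.r x = x
    · rw [if_pos hx', if_pos hx']
    · rw [if_neg hx', if_neg hx', if_neg]
      intro hi
      obtain ⟨k, rfl⟩ := (G.m_range x).2 ⟨hx', hi⟩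
      have := ((G'.m_range (G'.m k)).1 ⟨k, rfl⟩).1
      rw [← f.map_m, show f.map (G.m k) = y from hx] at this
      exact this hy
  · obtain ⟨x, rfl⟩ := f.surj y
    rw [f.fiber_flag hy, finsum_mem_singleton, charge, charge, if_neg hy,
      if_neg (f.r_of_map_flag hy)]

/-- The number `2 h(v) - 2 + val(v)` at a vertex `v`. -/
noncomputable def defect (G : MGraph n) (v : G.X) : ℤ := ∑ᶠ x ∈ {x | G.r x = v}, G.charge x

theorem Hom.push_defect (f : Hom G G') (w : G'.X) :
    ∑ᶠ u ∈ f.map ⁻¹' {w}, G.defect u = G'.defect w := by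
  have h1 := finsum_fiber G.r G.charge (f.map ⁻¹' {w})
  have h2 := finsum_fiber f.map G.charge {y | G'.r y = w}
  have e : G.r ⁻¹' (f.map ⁻¹' {w}) = f.map ⁻¹' {y | G'.r y = w} := by
    ext x; simp [f.map_r]
  rw [e, h2, finsum_mem_congr rfl fun y _ => f.push_charge y] at h1
  exact h1.symm

theorem defect_flag {v : G.X} (hv : G.r v ≠ v) : G.defect v = 0 := by
  have : {x | G.r x = v} = ∅ := by
    ext x
    simp only [Set.mem_ofPred_eq, Set.mem_empty_iff_false, iff_false]
    rintro rfl
    exact hv (G.r_r x)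
  rw [defect, this, finsum_mem_empty]

theorem defect_vertex {v : G.X} (hv : G.r v = v) :
    G.defect v = 2 * (G.h v : ℤ) - 2 + G.val v := sum_charge G hv

theorem IsQuasiStable.defect_nonneg {g : ℕ} (hG : G.IsQuasiStable g) (v : G.X) : 0 ≤ G.defect v := by
  by_cases hv : G.r v = v
  · rw [defect_vertex hv]
    rcases Nat.eq_zero_or_pos (G.h v) with h | h
    · have := hG.two_le v hv h
      omega
    · omega
  · rw [defect_flag hv]

theorem Hom.fiber_single (f : Hom G G') {a : G.X} (ha : G.r a = a)
    (h : ∀ x, f.map x = f.map a → G.r x = a → x = a) : f.map ⁻¹' {f.map a} = {a} := by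
  have hv : G'.r (f.map a) = f.map a := by rw [← f.map_r, ha]
  have key : ∀ b, G.r b = b → f.map b = f.map a → b = a := by
    intro b hb hba
    have := (f.conn _ hv).2 a rfl b hba ha hb
    clear hb hba
    induction this with
    | refl => rfl
    | tail _ hs ih =>
      obtain ⟨x, hx, h1, h2⟩ := hs
      have := h x hx (h1.trans ih)
      subst this
      rw [← h2, ← ha, G.i_r, G.r_r]
  ext x
  constructor
  · intro hx
    have hx' : f.map x = f.map a := hx
    have := key (G.r x) (G.r_r x) (by rw [f.map_r, hx', hv])
    exact h x hx' this
  · rintro rfl; rfl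

theorem val_pos_of_flag {x : G.X} (hx : G.r x ≠ x) : 0 < G.val (G.r x) := by
  rw [val, Set.ncard_pos (Set.toFinite _)]
  exact ⟨x, rfl, hx.symm⟩

theorem Hom.exc_fiber (f : Hom G G') {g : ℕ} (hG : G.IsQuasiStable g) {w : G'.X}
    (hw : G'.IsExc w) : ∃ v, G.IsExc v ∧ f.map ⁻¹' {w} = {v} := by
  have hzero : ∀ u, f.map u = w → G.defect u = 0 := by
    have h := f.push_defect w
    rw [defect_vertex hw.1, hw.2.1, hw.2.2, finsum_mem_eq_finite_toFinset_sum _ (Set.toFinite _)] at h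
    have h' := (Finset.sum_eq_zero_iff_of_nonneg fun u _ => hG.defect_nonneg u).1 (h.trans (by simp))
    intro u hu
    exact h' u (by simpa using hu)
  have hexc : ∀ x, G.r x ≠ x → f.map (G.r x) = w → G.IsExc (G.r x) := by
    intro x hx hxw
    have h1 := hzero _ hxw
    have h2 := val_pos_of_flag hx
    rw [defect_vertex (G.r_r x)] at h1
    refine ⟨G.r_r x, ?_, ?_⟩ <;> omega
  obtain ⟨⟨a, ha, ha'⟩, _⟩ := f.conn w hw.1
  have haw : f.map a = w := ha
  have hfib : f.map ⁻¹' {f.map a} = {a} := by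
    refine f.fiber_single ha' fun x hx hxa => ?_
    by_contra hne
    have hxf : G.r x ≠ x := by rw [hxa]; exact fun h => hne h.symm
    have e1 := hexc x hxf (by rw [hxa, haw])
    have e2 := hexc (G.i x) (r_i_flag hxf) (by rw [f.map_r, f.map_i, hx, haw, ← hw.1, G'.i_r, G'.r_r])
    exact (hG.exc_edges x e1 hxf).2 (hG.exc_adj x e1 e2)
  rw [haw] at hfib
  refine ⟨a, ?_, hfib⟩
  have h1 := f.push_weight w
  rw [hfib, finsum_mem_singleton, weight, weight, if_pos ha', if_pos hw.1, hw.2.1] at h1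
  have h2 := hzero a haw
  rw [defect_vertex ha'] at h2
  refine ⟨ha', ?_, ?_⟩ <;> omega

theorem Hom.exc_of_exc (f : Hom G G') {g : ℕ} (hG : G.IsQuasiStable g)
    {v : G.X} (hw : G'.IsExc (f.map v)) : G.IsExc v := by
  obtain ⟨u, hu, e⟩ := f.exc_fiber hG hw
  have : v ∈ f.map ⁻¹' {f.map v} := rfl
  rw [e] at this
  rwa [show v = u from this]

theorem Hom.exc_of_exc_r (f : Hom G G') {g : ℕ} (hG : G.IsQuasiStable g)
    {x : G.X} (hw : G'.IsExc (G'.r (f.map x))) : G.IsExc (G.r x) :=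
  f.exc_of_exc hG (by rwa [f.map_r])

theorem Hom.flag_of_exc (f : Hom G G') {g : ℕ} (hG : G.IsQuasiStable g)
    {x : G.X} (hw : G'.IsExc (G'.r (f.map x))) (hx : G.r x ≠ x) :
    G'.r (f.map x) ≠ f.map x := by
  intro h
  obtain ⟨u, hu, e⟩ := f.exc_fiber hG hw
  have h1 : x ∈ f.map ⁻¹' {G'.r (f.map x)} := h.symm
  have h2 : G.r x ∈ f.map ⁻¹' {G'.r (f.map x)} := f.map_r x
  rw [e] at h1 h2
  exact hx (h2.trans h1.symm)

theorem Hom.map_sw (f : Hom G G') {g : ℕ} (hG : G.IsQuasiStable g)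
    {x : G.X} (hw : G'.IsExc (G'.r (f.map x))) (hx : G.r x ≠ x) :
    f.map (G.sw x) = G'.sw (f.map x) := by
  have hv := f.exc_of_exc_r hG hw
  have e : G'.r (f.map (G.sw x)) = G'.r (f.map x) := by rw [← f.map_r, r_sw hv hx, f.map_r]
  have h1 : G'.r (f.map (G.sw x)) ≠ f.map (G.sw x) :=
    f.flag_of_exc hG (by rwa [e]) (sw_flag hv hx)
  refine eq_sw hw (f.flag_of_exc hG hw hx) e h1 fun h => ?_
  exact sw_ne hv hx ((f.map_flag _ h1).unique rfl h.symm)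

theorem Hom.contract_or (f : Hom G G') {x : G.X} (hv : G.IsExc (G.r x)) (hx : G.r x ≠ x)
    (hw : ¬ G'.IsExc (G'.r (f.map x))) (hfx : G'.r (f.map x) ≠ f.map x) :
    G'.r (f.map (G.sw x)) = f.map (G.sw x) := by
  by_contra hs
  apply hw
  have hfib := f.fiber_single (G.r_r x) (fun y hy hyr => by
    by_contra hne
    have hyv : G'.r (f.map y) = f.map y := by rw [hy, ← f.map_r, G.r_r]
    by_cases hyx : y = x
    · exact hfx (hyx ▸ hyv)
    · have := eq_sw hv hx hyr (by rw [hyr]; exact fun h => hne h.symm) hyx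
      exact hs (this ▸ hyv))
  rw [← f.map_r]
  have hwv : G'.r (f.map (G.r x)) = f.map (G.r x) := by rw [← f.map_r, G.r_r]
  have h1 := f.push_weight (f.map (G.r x))
  have h2 := f.push_defect (f.map (G.r x))
  rw [hfib, finsum_mem_singleton] at h1 h2
  rw [weight, weight, if_pos hv.1, if_pos hwv, hv.2.1] at h1
  rw [defect_vertex hv.1, defect_vertex hwv, hv.2.1, hv.2.2] at h2
  refine ⟨hwv, ?_, ?_⟩ <;> omega

end MGraph

namespace MGraph

variable {n g : ℕ} {G G' G'' : MGraph n}

theorem i_flag_of_exc {x : G.X} (hx : ¬ G.IsExc (G.r x)) (h : G.IsExc (G.r (G.i x))) :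
    G.r (G.i x) ≠ G.i x := by
  intro e
  have : x = G.i x := by
    conv_lhs => rw [← G.i_i x, ← e, G.i_r, e]
  rw [← this] at h
  exact hx h

theorem IsQuasiStable.not_exc_i (hG : G.IsQuasiStable g) {x : G.X} (h : G.IsExc (G.r x))
    (hx : G.r x ≠ x) : ¬ G.IsExc (G.r (G.i x)) := fun h' =>
  (hG.exc_edges x h hx).2 (hG.exc_adj x h h')

theorem IsQuasiStable.not_exc_i_sw (hG : G.IsQuasiStable g) {x : G.X} (h : G.IsExc (G.r x))
    (hx : G.r x ≠ x) : ¬ G.IsExc (G.r (G.i (G.sw x))) :=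
  hG.not_exc_i (by rw [r_sw h hx]; exact h) (sw_flag h hx)

open Classical in
/-- The involution of the stabilization: an element that is conjugate to a half-edge `x` at an
exceptional vertex becomes conjugate to the conjugate of the other half-edge at that vertex. -/
noncomputable def stI (G : MGraph n) (x : G.X) : G.X :=
  if G.IsExc (G.r (G.i x)) then G.i (G.sw (G.i x)) else G.i x

/-- The stabilization of a quasi-stable graph: its vertices, half-edges and legs are those of `G`
except the exceptional vertices and the half-edges rooted at them. -/
noncomputable def st (G : MGraph n) (hG : G.IsQuasiStable g) : MGraph n where
  X := {x : G.X // ¬ G.IsExc (G.r x)}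
  r x := ⟨G.r x, by rw [G.r_r]; exact x.2⟩
  i x := ⟨G.stI x, by
    unfold stI
    split_ifs with h
    · exact hG.not_exc_i_sw h (i_flag_of_exc x.2 h)
    · exact h⟩
  r_r x := Subtype.ext (G.r_r x)
  i_i x := Subtype.ext (by
    change G.stI (G.stI x) = x
    by_cases h : G.IsExc (G.r (G.i x))
    · have hf := i_flag_of_exc x.2 h
      rw [stI, stI, if_pos h, G.i_i, if_pos (by rw [r_sw h hf]; exact h), sw_sw h hf, G.i_i]
    · rw [stI, stI, if_neg h, G.i_i, if_neg x.2])
  i_r x := Subtype.ext (by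
    change G.stI (G.r x) = G.r x
    rw [stI, G.i_r, G.r_r, if_neg x.2])
  h x := G.h x
  h_flag x hx := G.h_flag x fun h => hx (Subtype.ext h)
  m k := ⟨G.m k, fun h =>
    (hG.exc_edges _ h ((G.m_range _).1 ⟨k, rfl⟩).1).1 ((G.m_range _).1 ⟨k, rfl⟩).2⟩
  m_inj a b h := G.m_inj (congrArg Subtype.val h)
  m_range x := by
    simp only [Subtype.ext_iff, ne_eq]
    rw [G.m_range]
    refine and_congr_right fun hx => ?_
    by_cases h : G.IsExc (G.r (G.i x))
    · have hf := i_flag_of_exc x.2 h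
      rw [stI, if_pos h]
      constructor
      · intro e; rw [e] at h; exact (x.2 h).elim
      · intro e
        refine (sw_ne h hf ?_).elim
        rw [← G.i_i (G.sw _), e]
    · rw [stI, if_neg h]

section collapse

open Classical in
/-- The map that contracts the edge of the half-edge `t v`, for every exceptional vertex `v`. -/
noncomputable def colFun (t : G.X → G.X) (x : G.X) : G.X :=
  if G.IsExc (G.r x) then
    if x = G.r x ∨ x = t (G.r x) then G.r (G.i (t (G.r x))) else G.i (t (G.r x))
  else if G.IsExc (G.r (G.i x)) ∧ G.i x = t (G.r (G.i x)) then G.r x else x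

variable {t : G.X → G.X}

theorem exc_t {t : G.X → G.X} (ht : ∀ v, G.IsExc v → G.r (t v) = v ∧ t v ≠ v)
    {v : G.X} (h : G.IsExc v) : G.IsExc (G.r (t v)) ∧ G.r (t v) ≠ t v := by
  rw [(ht v h).1]; exact ⟨h, (ht v h).2.symm⟩

theorem colFun_mem (hG : G.IsQuasiStable g) {t : G.X → G.X}
    (ht : ∀ v, G.IsExc v → G.r (t v) = v ∧ t v ≠ v) (x : G.X) : ¬ G.IsExc (G.r (colFun t x)) := by
  unfold colFun
  split_ifs with h1 h2 h3
  · rw [G.r_r]; exact hG.not_exc_i (exc_t ht h1).1 (exc_t ht h1).2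
  · exact hG.not_exc_i (exc_t ht h1).1 (exc_t ht h1).2
  · rw [G.r_r]; exact h1
  · exact h1

theorem colFun_nex {x : G.X} (h : ¬ G.IsExc (G.r x))
    (h' : ¬ (G.IsExc (G.r (G.i x)) ∧ G.i x = t (G.r (G.i x)))) : colFun t x = x := by
  rw [colFun, if_neg h, if_neg h']

theorem colFun_nex' {x : G.X} (h : ¬ G.IsExc (G.r x))
    (h' : G.IsExc (G.r (G.i x)) ∧ G.i x = t (G.r (G.i x))) : colFun t x = G.r x := by
  rw [colFun, if_neg h, if_pos h']

theorem colFun_exc {x : G.X} (h : G.IsExc (G.r x)) (h' : x = G.r x ∨ x = t (G.r x)) :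
    colFun t x = G.r (G.i (t (G.r x))) := by
  rw [colFun, if_pos h, if_pos h']

theorem colFun_exc' {x : G.X} (h : G.IsExc (G.r x)) (h' : ¬ (x = G.r x ∨ x = t (G.r x))) :
    colFun t x = G.i (t (G.r x)) := by
  rw [colFun, if_pos h, if_neg h']

theorem vertex_nex {x : G.X} (h : ¬ G.IsExc (G.r x)) (hx : G.r x = x) : colFun t x = x := by
  refine colFun_nex h fun h' => h ?_
  rw [← hx, G.i_r, G.r_r] at h'
  exact h'.1

theorem col_fiber {t : G.X → G.X} (ht : ∀ v, G.IsExc v → G.r (t v) = v ∧ t v ≠ v) (w : G.X) (hw : G.r w = w) (hw' : ¬ G.IsExc w) (x : G.X) :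
    colFun t x = w ↔ x = w ∨
      (∃ y, (G.IsExc (G.r y) ∧ y = t (G.r y) ∧ G.r (G.i y) = w) ∧ (x = G.i y ∨ x = y ∨ x = G.r y)) := by
  constructor
  · intro h
    by_cases h1 : G.IsExc (G.r x)
    · by_cases h2 : x = G.r x ∨ x = t (G.r x)
      · rw [colFun_exc h1 h2] at h
        refine Or.inr ⟨t (G.r x), ⟨(exc_t ht h1).1, by rw [(ht _ h1).1], h⟩, ?_⟩
        rw [(ht _ h1).1]
        tauto
      · rw [colFun_exc' h1 h2] at h
        exfalso
        apply r_i_flag (exc_t ht h1).2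
        rw [h, hw]
    · by_cases h2 : G.IsExc (G.r (G.i x)) ∧ G.i x = t (G.r (G.i x))
      · rw [colFun_nex' h1 h2] at h
        exact Or.inr ⟨G.i x, ⟨h2.1, h2.2, by rw [G.i_i]; exact h⟩, Or.inl (G.i_i x).symm⟩
      · rw [colFun_nex h1 h2] at h
        exact Or.inl h
  · rintro (rfl | ⟨y, ⟨h1, h2, h3⟩, h⟩)
    · exact vertex_nex (by rwa [hw]) hw
    · rcases h with rfl | rfl | rfl
      · rw [colFun_nex' (by rwa [h3]) (by rw [G.i_i]; exact ⟨h1, h2⟩), h3]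
      · rw [colFun_exc h1 (Or.inr h2), ← h2, h3]
      · rw [colFun_exc (by rwa [G.r_r]) (Or.inl (G.r_r _).symm), G.r_r, ← h2, h3]

/-- Contracting one edge at every exceptional vertex is a morphism to the stabilization. -/
noncomputable def col (hG : G.IsQuasiStable g) (ht : ∀ v, G.IsExc v → G.r (t v) = v ∧ t v ≠ v) : Hom G (G.st hG) where
  map x := ⟨colFun t x, colFun_mem hG ht x⟩
  map_r x := Subtype.ext (by
    change colFun t (G.r x) = G.r (colFun t x)
    by_cases h : G.IsExc (G.r x)
    · rw [colFun_exc (by rwa [G.r_r]) (Or.inl (G.r_r _).symm), G.r_r]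
      by_cases h' : x = G.r x ∨ x = t (G.r x)
      · rw [colFun_exc h h', G.r_r]
      · rw [colFun_exc' h h']
    · rw [vertex_nex (by rwa [G.r_r]) (G.r_r x)]
      by_cases h' : G.IsExc (G.r (G.i x)) ∧ G.i x = t (G.r (G.i x))
      · rw [colFun_nex' h h', G.r_r]
      · rw [colFun_nex h h'])
  map_i x := Subtype.ext (by
    change colFun t (G.i x) = G.stI (colFun t x)
    have vst : ∀ z, ¬ G.IsExc (G.r z) → G.stI (G.r z) = G.r z := by
      intro z hz
      rw [stI, G.i_r, G.r_r, if_neg hz]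
    by_cases h : G.IsExc (G.r x)
    · have hT := exc_t ht h
      have hTr := (ht _ h).1
      have hTn := hG.not_exc_i hT.1 hT.2
      by_cases h' : x = G.r x ∨ x = t (G.r x)
      · rw [colFun_exc h h', vst _ hTn]
        rcases h' with h' | h'
        · conv_lhs => rw [h', G.i_r, ← h']
          rw [colFun_exc h (Or.inl h')]
        · conv_lhs => rw [h']
          rw [colFun_nex' hTn]
          rw [G.i_i, hTr]
          exact ⟨h, rfl⟩
      · have hxf : G.r x ≠ x := fun e => h' (Or.inl e.symm)
        have hx : x = G.sw (t (G.r x)) :=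
          eq_sw hT.1 hT.2 hTr.symm hxf fun e => h' (Or.inr e)
        rw [colFun_exc' h h', stI, G.i_i, if_pos hT.1, ← hx, colFun_nex (hG.not_exc_i h hxf)]
        rw [G.i_i]
        exact fun e => h' (Or.inr e.2)
    · by_cases h' : G.IsExc (G.r (G.i x)) ∧ G.i x = t (G.r (G.i x))
      · rw [colFun_nex' h h', vst _ h, colFun_exc h'.1 (Or.inr h'.2), ← h'.2, G.i_i]
      · rw [colFun_nex h h']
        by_cases h1 : G.IsExc (G.r (G.i x))
        · have hf := i_flag_of_exc h h1
          have h2 : G.i x ≠ t (G.r (G.i x)) := fun e => h' ⟨h1, e⟩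
          have hT := exc_t ht h1
          have e : G.sw (G.i x) = t (G.r (G.i x)) :=
            (eq_sw h1 hf (ht _ h1).1 hT.2 h2.symm).symm
          rw [stI, if_pos h1, e, colFun_exc' h1]
          rintro (e' | e')
          · exact hf e'.symm
          · exact h2 e'
        · rw [stI, if_neg h1, colFun_nex h1]
          rw [G.i_i]
          exact fun e => h e.1)
  map_flag y hy := by
    have hy' : G.r y.1 ≠ y.1 := fun e => hy (Subtype.ext e)
    have uniq : ∀ z, colFun t z = y.1 → (G.IsExc (G.r z) ∧ z = G.sw (t (G.r z)) ∧
        G.i (t (G.r z)) = y.1) ∨ (z = y.1 ∧ ¬ (G.IsExc (G.r (G.i z)) ∧ G.i z = t (G.r (G.i z)))) := by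
      intro z hz
      by_cases h1 : G.IsExc (G.r z)
      · by_cases h2 : z = G.r z ∨ z = t (G.r z)
        · rw [colFun_exc h1 h2] at hz
          exact (hy' (by rw [← hz, G.r_r])).elim
        · rw [colFun_exc' h1 h2] at hz
          have hT := exc_t ht h1
          exact Or.inl ⟨h1, eq_sw hT.1 hT.2 (ht _ h1).1.symm
            (fun e => h2 (Or.inl e.symm)) (fun e => h2 (Or.inr e)), hz⟩
      · by_cases h2 : G.IsExc (G.r (G.i z)) ∧ G.i z = t (G.r (G.i z))
        · rw [colFun_nex' h1 h2] at hz
          exact (hy' (by rw [← hz, G.r_r])).elim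
        · rw [colFun_nex h1 h2] at hz
          exact Or.inr ⟨hz, h2⟩
    by_cases h : G.IsExc (G.r (G.i y.1)) ∧ G.i y.1 = t (G.r (G.i y.1))
    · have hT := exc_t ht h.1
      have hrs : G.r (G.sw (t (G.r (G.i y.1)))) = G.r (G.i y.1) := by
        rw [r_sw hT.1 hT.2, (ht _ h.1).1]
      refine ⟨G.sw (t (G.r (G.i y.1))), Subtype.ext ?_, fun z hz => ?_⟩
      · change colFun t _ = y.1
        rw [colFun_exc', hrs, ← h.2, G.i_i]
        · rw [hrs]; exact h.1
        · rw [hrs]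
          rintro (e | e)
          · exact sw_flag hT.1 hT.2 (by rw [hrs, e])
          · exact sw_ne hT.1 hT.2 e
      · rcases uniq z (congrArg Subtype.val hz) with ⟨h1, h2, h3⟩ | ⟨h1, h2⟩
        · have : G.r z = G.r (G.i y.1) := by
            rw [← h3, G.i_i, (ht _ h1).1]
          rw [h2, this]
        · rw [h1] at h2; exact (h2 h).elim
    · refine ⟨y.1, Subtype.ext (colFun_nex y.2 h), fun z hz => ?_⟩
      rcases uniq z (congrArg Subtype.val hz) with ⟨h1, h2, h3⟩ | ⟨h1, h2⟩
      · exfalso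
        apply h
        rw [← h3, G.i_i, (ht _ h1).1]
        exact ⟨h1, rfl⟩
      · exact h1
  map_m k := Subtype.ext (by
    change colFun t (G.m k) = G.m k
    have hl := (G.m_range _).1 ⟨k, rfl⟩
    have h : ¬ G.IsExc (G.r (G.m k)) := fun h => (hG.exc_edges _ h hl.1).1 hl.2
    refine colFun_nex h ?_
    rw [hl.2]
    exact fun e => h e.1)
  conn w hw := by
    have hw1 : G.r w.1 = w.1 := congrArg Subtype.val hw
    have hw2 : ¬ G.IsExc w.1 := by have := w.2; rwa [hw1] at this
    have mem : ∀ x, (x ∈ (fun x => (⟨colFun t x, colFun_mem hG ht x⟩ : (G.st hG).X)) ⁻¹' {w}) ↔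
        x = w.1 ∨ (∃ y, (G.IsExc (G.r y) ∧ y = t (G.r y) ∧ G.r (G.i y) = w.1) ∧
          (x = G.i y ∨ x = y ∨ x = G.r y)) := by
      intro x
      exact Iff.trans Subtype.ext_iff (col_fiber ht w.1 hw1 hw2 x)
    refine ⟨⟨w.1, (mem _).2 (Or.inl rfl), hw1⟩, fun a ha b hb ha' hb' => ?_⟩
    have vert : ∀ a, (∃ y, (G.IsExc (G.r y) ∧ y = t (G.r y) ∧ G.r (G.i y) = w.1) ∧
          (a = G.i y ∨ a = y ∨ a = G.r y)) → G.r a = a →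
          ∃ y, (G.IsExc (G.r y) ∧ y = t (G.r y) ∧ G.r (G.i y) = w.1) ∧ a = G.r y := by
      rintro a ⟨y, hy, h⟩ hra
      have hf : G.r y ≠ y := fun e => (exc_t ht hy.1).2 (by rw [← hy.2.1, e])
      rcases h with rfl | rfl | h
      · exact (r_i_flag hf hra).elim
      · exact (hf hra).elim
      · exact ⟨y, hy, h⟩
    refine Relation.ReflTransGen.trans (b := w.1) ?_ ?_
    · rcases (mem a).1 ha with rfl | h
      · exact .refl
      · obtain ⟨y, hy, rfl⟩ := vert a h ha'
        exact .single ⟨y, (mem _).2 (Or.inr ⟨y, hy, Or.inr (Or.inl rfl)⟩), rfl, hy.2.2⟩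
    · rcases (mem b).1 hb with rfl | h
      · exact .refl
      · obtain ⟨y, hy, rfl⟩ := vert b h hb'
        exact .single ⟨G.i y, (mem _).2 (Or.inr ⟨y, hy, Or.inl rfl⟩), hy.2.2, by rw [G.i_i]⟩
  genus w hw := by
    have hw1 : G.r w.1 = w.1 := congrArg Subtype.val hw
    have hw2 : ¬ G.IsExc w.1 := by have := w.2; rwa [hw1] at this
    let T : Set G.X := {y | G.IsExc (G.r y) ∧ y = t (G.r y) ∧ G.r (G.i y) = w.1}
    have hTf : ∀ y ∈ T, G.r y ≠ y := by
      rintro y hy e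
      exact (exc_t ht hy.1).2 (by rw [← hy.2.1, e])
    have e : (fun x => (⟨colFun t x, colFun_mem hG ht x⟩ : (G.st hG).X)) ⁻¹' {w} =
        insert w.1 (G.i '' T ∪ (T ∪ G.r '' T)) := by
      ext x
      refine Iff.trans (Iff.trans Subtype.ext_iff (col_fiber ht w.1 hw1 hw2 x)) ?_
      simp only [Set.mem_insert_iff, Set.mem_union, Set.mem_image]
      constructor
      · rintro (h | ⟨y, hy, rfl | rfl | rfl⟩)
        · exact Or.inl h
        · exact Or.inr (Or.inl ⟨y, hy, rfl⟩)
        · exact Or.inr (Or.inr (Or.inl hy))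
        · exact Or.inr (Or.inr (Or.inr ⟨y, hy, rfl⟩))
      · rintro (h | ⟨y, hy, rfl⟩ | hy | ⟨y, hy, rfl⟩)
        · exact Or.inl h
        · exact Or.inr ⟨y, hy, Or.inl rfl⟩
        · exact Or.inr ⟨_, hy, Or.inr (Or.inl rfl)⟩
        · exact Or.inr ⟨y, hy, Or.inr (Or.inr rfl)⟩
    have d1 : w.1 ∉ G.i '' T ∪ (T ∪ G.r '' T) := by
      rintro (⟨y, hy, h⟩ | hy | ⟨y, hy, h⟩)
      · exact r_i_flag (hTf y hy) (by rw [h, hw1])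
      · exact hTf _ hy hw1
      · exact hw2 (h ▸ hy.1)
    have d2 : Disjoint (G.i '' T) (T ∪ G.r '' T) := by
      refine Set.disjoint_left.2 ?_
      rintro _ ⟨y, hy, rfl⟩ (hy' | ⟨z, hz, h⟩)
      · exact hw2 (hy.2.2 ▸ hy'.1)
      · exact r_i_flag (hTf y hy) (by rw [← h, G.r_r])
    have d3 : Disjoint T (G.r '' T) := by
      refine Set.disjoint_left.2 ?_
      rintro _ hy ⟨z, hz, rfl⟩
      exact hTf _ hy (G.r_r z)
    have hfin : T.Finite := T.toFinite
    have e' := congrArg (fun S : Set G.X => ∑ᶠ x ∈ S, G.weight x) e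
    refine Eq.trans ?_ e'.symm
    change 2 * (G.h w.1 : ℤ) - 2 = ∑ᶠ x ∈ insert w.1 (G.i '' T ∪ (T ∪ G.r '' T)), G.weight x
    rw [finsum_mem_insert _ d1 (Set.toFinite _),
      finsum_mem_union d2 (Set.toFinite _) (Set.toFinite _),
      finsum_mem_union d3 (Set.toFinite _) (Set.toFinite _),
      finsum_mem_image (fun a _ b _ h => by rw [← G.i_i a, h, G.i_i]),
      finsum_mem_image (fun a ha b hb h => by rw [ha.2.1, h, ← hb.2.1]),
      ← finsum_mem_add_distrib hfin, ← finsum_mem_add_distrib hfin,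
      finsum_mem_congr (g := fun _ => (0 : ℤ)) rfl]
    · rw [finsum_mem_zero, add_zero, weight, if_pos hw1]
    · intro y hy
      have hf := hTf y hy
      have hi := (hG.exc_edges y hy.1 hf).1
      rw [weight, weight, weight, if_neg (r_i_flag hf), if_neg hf, if_pos (G.r_r y), if_neg hi,
        if_neg (by rw [G.i_i]; exact hi.symm), hy.1.2.1]
      rfl

end collapse

theorem exists_choice (G : MGraph n) : ∃ t : G.X → G.X, ∀ v, G.IsExc v → G.r (t v) = v ∧ t v ≠ v := by
  classical
  have : ∀ v, ∃ x, G.IsExc v → G.r x = v ∧ x ≠ v := by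
    intro v
    by_cases h : G.IsExc v
    · have : 0 < G.val v := by rw [h.2.2]; norm_num
      rw [val, Set.ncard_pos (Set.toFinite _)] at this
      obtain ⟨x, hx⟩ := this
      exact ⟨x, fun _ => hx⟩
    · exact ⟨v, fun h' => (h h').elim⟩
  exact ⟨fun v => (this v).choose, fun v => (this v).choose_spec⟩

theorem st_stable (hg : 2 < 2 * g + n) (hG : G.IsQuasiStable g) : (G.st hG).IsStable g := by
  obtain ⟨t, ht⟩ := G.exists_choice
  let q := col hG ht
  have hconn : (G.st hG).Connected Set.univ := by
    obtain ⟨⟨a, _, ha⟩, hc⟩ := hG.conn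
    refine ⟨⟨q.map a, trivial, by rw [← q.map_r, ha]⟩, fun b _ c _ hb hc' => ?_⟩
    obtain ⟨b, rfl⟩ := q.surj b
    obtain ⟨c, rfl⟩ := q.surj c
    have := hc (G.r b) trivial (G.r c) trivial (G.r_r _) (G.r_r _)
    have := Relation.ReflTransGen.lift (p := fun a b => ∃ x ∈ Set.univ, (G.st hG).r x = a ∧
      (G.st hG).r ((G.st hG).i x) = b) q.map (by
        rintro s t ⟨x, hx, rfl, rfl⟩
        exact ⟨q.map x, trivial, (q.map_r _).symm, by rw [q.map_r, q.map_i]⟩) _ _ this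
    rw [Function.onFun, q.map_r, q.map_r, hb, hc'] at this
    exact this
  have hgen : (G.st hG).HasGenus Set.univ g := by
    rw [← q.hasGenus_preimage]
    exact hG.genus
  refine ⟨hconn, hgen, fun v hv => ?_⟩
  have hv1 : G.r v.1 = v.1 := congrArg Subtype.val hv
  have hv2 : ¬ G.IsExc v.1 := by have := v.2; rwa [hv1] at this
  have hval : (G.st hG).val v = G.val v.1 := by
    have := Set.ncard_image_of_injective (f := fun x : (G.st hG).X => x.1)
      {x | (G.st hG).r x = v ∧ x ≠ v} (fun a b h => Subtype.ext h)
    rw [val, val, ← this]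
    congr 1
    ext x
    constructor
    · rintro ⟨y, ⟨h1, h2⟩, rfl⟩
      exact ⟨congrArg Subtype.val h1, fun e => h2 (Subtype.ext e)⟩
    · rintro ⟨h1, h2⟩
      exact ⟨⟨x, by rw [h1]; exact hv2⟩, ⟨Subtype.ext h1, fun e => h2 (congrArg Subtype.val e)⟩, rfl⟩
  have hh : (G.st hG).h v = G.h v.1 := rfl
  rw [hval, hh]
  rcases Nat.lt_trichotomy (G.h v.1) 1 with h | h | h
  · have h0 : G.h v.1 = 0 := by omega
    have h2 := hG.two_le _ hv1 h0
    have h3 : G.val v.1 ≠ 2 := fun e => hv2 ⟨hv1, h0, e⟩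
    omega
  · suffices 0 < G.val v.1 by omega
    by_contra hval0
    have hno : ∀ x, G.r x = v.1 → x = v.1 := by
      intro x hx
      by_contra hne
      have := val_pos_of_flag (G := G) (x := x) (by rw [hx]; exact fun e => hne e.symm)
      rw [hx] at this
      exact hval0 this
    have hall : ∀ b, G.r b = b → b = v.1 := by
      intro b hb
      have := hG.conn.2 v.1 trivial b trivial hv1 hb
      clear hb
      induction this with
      | refl => rfl
      | tail _ hs ih =>
        obtain ⟨x, hx, h1, h2⟩ := hs
        have := hno x (h1.trans ih)
        subst this
        rw [← h2, ← hv1, G.i_r, G.r_r]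
    have hu : (Set.univ : Set G.X) = {v.1} := by
      ext x
      simp only [Set.mem_univ, Set.mem_singleton_iff, true_iff]
      exact hno x (hall _ (G.r_r x))
    have hgen := hG.genus
    rw [HasGenus, hu, finsum_mem_singleton, weight, if_pos hv1, h] at hgen
    have hn : n = 0 := by
      by_contra hn
      have hl := (G.m_range (G.m ⟨0, Nat.pos_of_ne_zero hn⟩)).1 ⟨_, rfl⟩
      have hm := hno _ (hall _ (G.r_r (G.m ⟨0, Nat.pos_of_ne_zero hn⟩)))
      rw [hm] at hl
      exact hl.1 hv1
    omega
  · omega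

open Classical in
/-- The map underlying the stabilization of a morphism: it is `f`, unless `x` is one end of an
exceptional edge of the stabilization and is contracted by `f`; in this case it is the image of the
half-edge at the exceptional vertex on the other part of that edge. -/
noncomputable def stFun (f : Hom G G') (x : G.X) : G'.X :=
  if G.IsExc (G.r (G.i x)) ∧ G'.r (f.map x) = f.map x then f.map (G.sw (G.i x)) else f.map x

theorem Hom.not_exc (hG : G.IsQuasiStable g) (f : Hom G G')
    {x : G.X} (hx : ¬ G.IsExc (G.r x)) : ¬ G'.IsExc (G'.r (f.map x)) :=
  fun h => hx (f.exc_of_exc_r hG h)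

theorem stFun_mem (hG : G.IsQuasiStable g) (f : Hom G G')
    {x : G.X} (hx : ¬ G.IsExc (G.r x)) : ¬ G'.IsExc (G'.r (stFun f x)) := by
  unfold stFun
  split_ifs with h
  · have e : G'.r (f.map (G.sw (G.i x))) = G'.r (f.map x) := by
      rw [← f.map_r, r_sw h.1 (i_flag_of_exc hx h.1), f.map_r, f.map_i, ← h.2, G'.i_r]
    rw [e]
    exact f.not_exc hG hx
  · exact f.not_exc hG hx

theorem exists_adapted (hG : G.IsQuasiStable g) (f : Hom G G')
    {t' : G'.X → G'.X} (ht' : ∀ v, G'.IsExc v → G'.r (t' v) = v ∧ t' v ≠ v) :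
    ∃ t : G.X → G.X, ∀ v, G.IsExc v → (G.r (t v) = v ∧ t v ≠ v) ∧
      (G'.IsExc (f.map v) → f.map (t v) = t' (f.map v)) ∧
      (¬ G'.IsExc (f.map v) → G'.r (f.map (t v)) = f.map (t v)) := by
  classical
  have : ∀ v, ∃ x, G.IsExc v → (G.r x = v ∧ x ≠ v) ∧
      (G'.IsExc (f.map v) → f.map x = t' (f.map v)) ∧
      (¬ G'.IsExc (f.map v) → G'.r (f.map x) = f.map x) := by
    intro v
    by_cases hv : G.IsExc v
    · by_cases hw : G'.IsExc (f.map v)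
      · have hT := exc_t ht' hw
        obtain ⟨x, hx⟩ := f.surj (t' (f.map v))
        have hrx : f.map (G.r x) = f.map v := by rw [f.map_r, hx, (ht' _ hw).1]
        obtain ⟨u, hu, e⟩ := f.exc_fiber hG hw
        have h1 : v ∈ f.map ⁻¹' {f.map v} := rfl
        have h2 : G.r x ∈ f.map ⁻¹' {f.map v} := hrx
        rw [e] at h1 h2
        refine ⟨x, fun _ => ⟨⟨h2.trans h1.symm, ?_⟩, fun _ => hx, fun h => (h hw).elim⟩⟩
        rintro rfl
        exact (ht' _ hw).2 hx.symm
      · obtain ⟨t₀, ht₀⟩ := G.exists_choice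
        obtain ⟨h1, h2⟩ := ht₀ v hv
        have hT := exc_t ht₀ hv
        by_cases hc : G'.r (f.map (t₀ v)) = f.map (t₀ v)
        · exact ⟨t₀ v, fun _ => ⟨⟨h1, h2⟩, fun h => (hw h).elim, fun _ => hc⟩⟩
        · refine ⟨G.sw (t₀ v), fun _ => ⟨⟨(r_sw hT.1 hT.2).trans h1, ?_⟩,
            fun h => (hw h).elim, fun _ => ?_⟩⟩
          · intro e
            apply sw_flag hT.1 hT.2
            rw [r_sw hT.1 hT.2, h1, e]
          · exact f.contract_or hT.1 hT.2 (by rwa [← f.map_r, h1]) hc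
    · exact ⟨v, fun h => (hv h).elim⟩
  exact ⟨fun v => (this v).choose, fun v => (this v).choose_spec⟩

theorem stFun_col (hG : G.IsQuasiStable g) (f : Hom G G')
    {t' : G'.X → G'.X} (hG' : G'.IsQuasiStable g)
    (ht' : ∀ v, G'.IsExc v → G'.r (t' v) = v ∧ t' v ≠ v) {t : G.X → G.X}
    (ht : ∀ v, G.IsExc v → (G.r (t v) = v ∧ t v ≠ v) ∧
      (G'.IsExc (f.map v) → f.map (t v) = t' (f.map v)) ∧
      (¬ G'.IsExc (f.map v) → G'.r (f.map (t v)) = f.map (t v))) (x : G.X) :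
    stFun f (colFun t x) = colFun t' (f.map x) := by
  have ht0 : ∀ v, G.IsExc v → G.r (t v) = v ∧ t v ≠ v := fun v hv => (ht v hv).1
  have stv : ∀ z, ¬ G.IsExc (G.r z) → stFun f (G.r z) = f.map (G.r z) := by
    intro z hz
    rw [stFun, if_neg]
    rw [G.i_r, G.r_r]
    exact fun h => hz h.1
  by_cases h : G.IsExc (G.r x)
  · have hT := exc_t ht0 h
    have hTr := (ht0 _ h).1
    have hTn := hG.not_exc_i hT.1 hT.2
    obtain ⟨_, hexc, hnex⟩ := ht _ h
    by_cases hw : G'.IsExc (f.map (G.r x))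
    · have hw' : G'.IsExc (G'.r (f.map x)) := by rwa [← f.map_r]
      have hft := hexc hw
      by_cases h' : x = G.r x ∨ x = t (G.r x)
      · rw [colFun_exc h h', stv _ hTn, f.map_r, f.map_i, hft, colFun_exc hw', f.map_r]
        rw [← f.map_r, ← hft]
        exact h'.imp (congrArg f.map) (congrArg f.map)
      · have hxf : G.r x ≠ x := fun e => h' (Or.inl e.symm)
        have hff := f.flag_of_exc hG hw' hxf
        rw [colFun_exc' h h', stFun, if_neg, f.map_i, hft, colFun_exc' hw', f.map_r]
        · rintro (e | e)
          · exact hff e.symm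
          · rw [← f.map_r, ← hft] at e
            exact h' (Or.inr ((f.map_flag _ hff).unique rfl e.symm))
        · rintro ⟨-, e⟩
          rw [f.map_i] at e
          refine r_i_flag (G := G') (x := f.map (t (G.r x))) ?_ e
          rw [hft, (ht' _ hw).1]
          exact (ht' _ hw).2.symm
    · have hw' : ¬ G'.IsExc (G'.r (f.map x)) := by rwa [← f.map_r]
      have hvert := hnex hw
      have hft : f.map (t (G.r x)) = f.map (G.r x) := by
        rw [← hvert, ← f.map_r, hTr]
      have hfv : G'.r (f.map (G.r x)) = f.map (G.r x) := by rw [← f.map_r, G.r_r]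
      by_cases h' : x = G.r x ∨ x = t (G.r x)
      · have hfx : f.map x = f.map (G.r x) := by
          rcases h' with h' | h'
          · exact congrArg f.map h'
          · rw [← hft, ← h']
        rw [colFun_exc h h', stv _ hTn, f.map_r, f.map_i, hft, vertex_nex hw', hfx]
        · conv_lhs => rw [← hfv, G'.i_r, G'.r_r, hfv]
        · rw [hfx, hfv]
      · have hxf : G.r x ≠ x := fun e => h' (Or.inl e.symm)
        have hx : G.sw (t (G.r x)) = x :=
          (eq_sw hT.1 hT.2 hTr.symm hxf fun e => h' (Or.inr e)).symm
        rw [colFun_exc' h h', stFun, if_pos, G.i_i, hx, colFun_nex hw']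
        · rw [← f.map_i]
          exact fun e => f.not_exc hG (hG.not_exc_i h hxf) e.1
        · rw [G.i_i]
          refine ⟨hT.1, ?_⟩
          rw [f.map_i, hft, ← hfv, G'.i_r, G'.r_r]
  · have hw := f.not_exc hG h
    by_cases h1 : G.IsExc (G.r (G.i x))
    · have hf := i_flag_of_exc h h1
      obtain ⟨_, hexc, hnex⟩ := ht _ h1
      have hT := exc_t ht0 h1
      have hfi : f.map (G.r (G.i x)) = G'.r (G'.i (f.map x)) := by rw [f.map_r, f.map_i]
      have vv : G'.r (f.map (G.i x)) = f.map (G.i x) → G'.r (f.map x) = f.map x := by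
        intro e
        have : f.map x = f.map (G.i x) := by
          conv_lhs => rw [← G.i_i x, f.map_i, ← e, G'.i_r, e]
        rw [this]; exact e
      by_cases h2 : G.i x = t (G.r (G.i x))
      · rw [colFun_nex' h ⟨h1, h2⟩, stv _ h, f.map_r]
        by_cases hv : G'.IsExc (f.map (G.r (G.i x)))
        · rw [colFun_nex' hw]
          rw [← hfi]
          refine ⟨hv, ?_⟩
          rw [← hexc hv, ← f.map_i, ← h2]
        · have e := hnex hv
          rw [← h2] at e
          rw [vertex_nex hw (vv e)]
          exact vv e
      · rw [colFun_nex h fun e => h2 e.2]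
        by_cases hv : G'.IsExc (f.map (G.r (G.i x)))
        · have hfl := f.flag_of_exc hG (x := G.i x) (by rwa [← f.map_r]) hf
          rw [stFun, if_neg, colFun_nex hw]
          · rw [← hfi]
            rintro ⟨-, e⟩
            rw [← hexc hv, ← f.map_i] at e
            exact h2 ((f.map_flag _ hfl).unique rfl e.symm)
          · rintro ⟨-, e⟩
            refine r_i_flag hfl ?_
            rw [← f.map_i, G.i_i, e]
        · rw [colFun_nex hw fun e => hv (by rw [hfi]; exact e.1)]
          by_cases hfx : G'.r (f.map x) = f.map x
          · rw [stFun, if_pos ⟨h1, hfx⟩]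
            have e1 : G.sw (G.i x) = t (G.r (G.i x)) :=
              (eq_sw h1 hf (ht0 _ h1).1 hT.2 (Ne.symm h2)).symm
            rw [e1, ← hnex hv, ← f.map_r, (ht0 _ h1).1, hfi, ← hfx, G'.i_r, G'.r_r]
          · rw [stFun, if_neg fun e => hfx e.2]
    · rw [colFun_nex h fun e => h1 e.1, stFun, if_neg fun e => h1 e.1, colFun_nex hw]
      rw [← f.map_i]
      exact fun e => f.not_exc hG h1 e.1

/-- The stabilization of a morphism of quasi-stable graphs. -/
noncomputable def stMap (hG : G.IsQuasiStable g) (hG' : G'.IsQuasiStable g) (f : Hom G G') :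
    Hom (G.st hG) (G'.st hG') :=
  Hom.desc (col hG fun v hv =>
      ((exists_adapted hG f G'.exists_choice.choose_spec).choose_spec v hv).1)
    (f.comp (col hG' G'.exists_choice.choose_spec))
    (fun x => ⟨stFun f x.1, stFun_mem hG f x.2⟩)
    (fun x => Subtype.ext (stFun_col hG f hG' G'.exists_choice.choose_spec
      (exists_adapted hG f G'.exists_choice.choose_spec).choose_spec x))

theorem stMap_val (hG : G.IsQuasiStable g) (hG' : G'.IsQuasiStable g) (f : Hom G G')
    (x : (G.st hG).X) : ((stMap hG hG' f).map x).1 = stFun f x.1 := rfl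

theorem stMap_id (hG : G.IsQuasiStable g) : stMap hG hG (𝟙 G) = 𝟙 (G.st hG) := by
  ext x
  refine Subtype.ext ?_
  change stFun (Hom.id G) x.1 = x.1
  unfold stFun
  split_ifs with h
  · exfalso
    have hx : G.r x.1 = x.1 := h.2
    have := h.1
    rw [← hx, G.i_r, G.r_r] at this
    exact x.2 this
  · rfl

theorem stMap_comp (hG : G.IsQuasiStable g) (hG' : G'.IsQuasiStable g) (hG'' : G''.IsQuasiStable g)
    (f : Hom G G') (f' : Hom G' G'') :
    stMap hG hG'' (f.comp f') = (stMap hG hG' f).comp (stMap hG' hG'' f') := by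
  obtain ⟨t'', ht''⟩ := G''.exists_choice
  obtain ⟨t', ht'⟩ := exists_adapted hG' f' ht''
  obtain ⟨t, ht⟩ := exists_adapted hG f (fun v hv => (ht' v hv).1)
  have htc : ∀ v, G.IsExc v → (G.r (t v) = v ∧ t v ≠ v) ∧
      (G''.IsExc ((f.comp f').map v) → (f.comp f').map (t v) = t'' ((f.comp f').map v)) ∧
      (¬ G''.IsExc ((f.comp f').map v) →
        G''.r ((f.comp f').map (t v)) = (f.comp f').map (t v)) := by
    intro v hv
    obtain ⟨h1, h2, h3⟩ := ht v hv
    refine ⟨h1, fun h => ?_, fun h => ?_⟩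
    · have hm : G'.IsExc (f.map v) := f'.exc_of_exc hG' h
      change f'.map (f.map (t v)) = _
      rw [h2 hm, (ht' _ hm).2.1 h]
      rfl
    · by_cases hm : G'.IsExc (f.map v)
      · change G''.r (f'.map (f.map (t v))) = f'.map (f.map (t v))
        rw [h2 hm]
        exact (ht' _ hm).2.2 h
      · change G''.r (f'.map (f.map (t v))) = f'.map (f.map (t v))
        rw [← f'.map_r, h3 hm]
  refine Hom.ext (funext fun x => ?_)
  obtain ⟨x, rfl⟩ := (col hG fun v hv => (ht v hv).1).surj x
  refine Subtype.ext ?_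
  change stFun (f.comp f') (colFun t x) = stFun f' (stFun f (colFun t x))
  rw [stFun_col hG _ hG'' ht'' htc, stFun_col hG f hG' (fun v hv => (ht' v hv).1) ht,
    stFun_col hG' f' hG'' ht'' ht']
  rfl

end MGraph

/-- The pair `(g, n)` is hyperbolic: `2 g - 2 + n > 0`. -/
class HyperbolicPair (g n : ℕ) : Prop where
  pos : 0 < 2 * (g : ℤ) - 2 + n

/-- The category of stable graphs of type `(g, n)`. -/
abbrev SG (g n : ℕ) := ObjectProperty.FullSubcategory (MGraph.IsStable (n := n) g)

/-- The category of quasi-stable graphs of type `(g, n)`. -/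
abbrev QSG (g n : ℕ) := ObjectProperty.FullSubcategory (MGraph.IsQuasiStable (n := n) g)

/-- The stabilization functor. -/
noncomputable def stabilization (g n : ℕ) [hyp : HyperbolicPair g n] : QSG g n ⥤ SG g n where
  obj G := ⟨G.obj.st G.property, MGraph.st_stable (by have := hyp.pos; omega) G.property⟩
  map {G G'} π := ObjectProperty.homMk (MGraph.stMap G.property G'.property π.hom)
  map_id G := ObjectProperty.hom_ext _ (MGraph.stMap_id G.property)
  map_comp {G G' G''} π π' :=
    ObjectProperty.hom_ext _ (MGraph.stMap_comp G.property G'.property G''.property π.hom π'.hom)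

/-- A quasi-stable graph with an admissible divisor `D`, that is, `D` is `1` at every exceptional
vertex. A divisor is a function on the vertices, put to zero on the flags. -/
structure QD (g n : ℕ) : Type 1 where
  graph : QSG g n
  D : graph.obj.X → ℤ
  D_flag : ∀ x, graph.obj.r x ≠ x → D x = 0
  adm : ∀ v, graph.obj.IsExc v → D v = 1

namespace QD

variable {g n : ℕ}

/-- Morphisms are the morphisms of graphs that push the divisor of the source forward to the
divisor of the target. -/
@[ext]
structure Hom (A B : QD g n) where
  graph : A.graph ⟶ B.graph
  push : ∀ v, B.graph.obj.r v = v →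
    ∑ᶠ w ∈ graph.hom.map ⁻¹' {v}, A.D w = B.D v

theorem Hom.push_all {A B : QD g n} (f : Hom A B) (v : B.graph.obj.X) :
    ∑ᶠ w ∈ f.graph.hom.map ⁻¹' {v}, A.D w = B.D v := by
  by_cases hv : B.graph.obj.r v = v
  · exact f.push v hv
  · obtain ⟨x, rfl⟩ := f.graph.hom.surj v
    rw [f.graph.hom.fiber_flag hv, finsum_mem_singleton, B.D_flag _ hv,
      A.D_flag _ (f.graph.hom.r_of_map_flag hv)]

instance : Category (QD g n) where
  Hom := Hom
  id A := ⟨𝟙 A.graph, fun v _ => by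
    change ∑ᶠ w ∈ ({v} : Set A.graph.obj.X), A.D w = A.D v
    rw [finsum_mem_singleton]⟩
  comp {A B C} f f' := ⟨f.graph ≫ f'.graph, fun v hv => by
    have h := MGraph.finsum_fiber f.graph.hom.map A.D (f'.graph.hom.map ⁻¹' {v})
    rw [finsum_mem_congr rfl fun y _ => f.push_all y, f'.push v hv] at h
    exact h⟩
  id_comp _ := Hom.ext (Category.id_comp _)
  comp_id _ := Hom.ext (Category.comp_id _)
  assoc _ _ _ := Hom.ext (Category.assoc _ _ _)

@[ext]
theorem hom_ext {A B : QD g n} {f f' : A ⟶ B} (h : Hom.graph f = Hom.graph f') : f = f' :=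
  Hom.ext h

/-- Forget the divisor. -/
def forget (g n : ℕ) : QD g n ⥤ QSG g n where
  obj A := A.graph
  map f := Hom.graph f
  map_id _ := rfl
  map_comp _ _ := rfl

/-- The degree of the divisor. -/
noncomputable def deg (A : QD g n) : ℤ := ∑ᶠ v, A.D v

end QD

/-- A quasi-stable graph is simple if it stays connected after removing its exceptional vertices
(together with the edges at them). -/
def MGraph.IsSimple {n : ℕ} (G : MGraph n) : Prop :=
  G.Connected {x | ¬ G.IsExc (G.r x) ∧ ¬ G.IsExc (G.r (G.i x))}

/-- Universal stability conditions of type `(g, n)`: functions on the vertices of all stable graphs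
(put to zero on the flags), of integral degree and compatible with all morphisms. -/
structure StabilityCondition (g n : ℕ) : Type 1 where
  φ : ∀ G : SG g n, G.obj.X → ℝ
  φ_flag : ∀ G x, G.obj.r x ≠ x → φ G x = 0
  int : ∀ G, ∃ d : ℤ, ∑ᶠ v, φ G v = d
  push : ∀ {G G' : SG g n} (π : G ⟶ G') (v : G'.obj.X), G'.obj.r v = v →
    φ G' v = ∑ᶠ w ∈ π.hom.map ⁻¹' {v}, φ G w

section stability

variable {g n : ℕ} [HyperbolicPair g n]

open Classical in
/-- The stability condition on a quasi-stable graph: zero at the exceptional vertices. -/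
noncomputable def StabilityCondition.onQuasiStable (φ : StabilityCondition g n) (G : QSG g n)
    (x : G.obj.X) : ℝ :=
  if h : G.obj.IsExc (G.obj.r x) then 0 else φ.φ ((stabilization g n).obj G) ⟨x, h⟩

/-- The number of edges that join `S` with its complement. -/
noncomputable def MGraph.cut (G : MGraph n) (S : Set G.X) : ℕ :=
  {x | G.i x ≠ x ∧ G.r x ∈ S ∧ G.r (G.i x) ∉ S}.ncard

/-- The divisor is semistable with respect to `φ`: its degree is the degree of `φ`, and on every set
`S` of vertices it differs from `φ` by at most half the number of edges leaving `S`. -/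
def QD.IsSemistable (φ : StabilityCondition g n) (A : QD g n) : Prop :=
  (A.deg : ℝ) = ∑ᶠ v, φ.φ ((stabilization g n).obj A.graph) v ∧
  ∀ S : Set A.graph.obj.X, (∀ v ∈ S, A.graph.obj.r v = v) →
    ∑ᶠ v ∈ S, φ.onQuasiStable A.graph v - (A.graph.obj.cut S : ℝ) / 2 ≤ ∑ᶠ v ∈ S, (A.D v : ℝ) ∧
    ∑ᶠ v ∈ S, (A.D v : ℝ) ≤ ∑ᶠ v ∈ S, φ.onQuasiStable A.graph v + (A.graph.obj.cut S : ℝ) / 2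

/-- The versions of the universal tropical Jacobian: all divisors, those of degree `d`, those on simple
graphs, those of degree `d` on simple graphs, and the `φ`-semistable ones. -/
inductive Variant (g n : ℕ) : Type 1
  | all
  | degree (d : ℤ)
  | simple
  | simpleDegree (d : ℤ)
  | semistable (φ : StabilityCondition g n)

/-- The full subcategory of quasi-stable graphs with admissible divisors that belongs to a version. -/
def Variant.prop : Variant g n → ObjectProperty (QD g n)
  | .all => fun _ => True
  | .degree d => fun A => A.deg = d
  | .simple => fun A => A.graph.obj.IsSimple
  | .simpleDegree d => fun A => A.graph.obj.IsSimple ∧ A.deg = d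
  | .semistable φ => fun A => A.IsSemistable φ

end stability

/-! ### cones -/

/-- Rational polyhedral cones: a lattice `N` with a strictly convex, full-dimensional rational
polyhedral cone `σ` in `N_ℝ`. The cone is encoded by its monoid `pts` of lattice points, from which
it is recovered as the real cone spanned by them: `pts` is cut out by finitely many integral
linear inequalities, contains no line, and generates `N`. -/
structure RPC : Type 1 where
  N : Type
  [grp : AddCommGroup N]
  [free : Module.Free ℤ N]
  [fin : Module.Finite ℤ N]
  pts : AddSubmonoid N
  polyhedral : ∃ s : Set (N →+ ℤ), s.Finite ∧ ∀ x, x ∈ pts ↔ ∀ ℓ ∈ s, 0 ≤ ℓ x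
  pointed : ∀ x ∈ pts, -x ∈ pts → x = 0
  full : ∀ x, ∃ p ∈ pts, ∃ q ∈ pts, x = p - q

attribute [instance] RPC.grp RPC.free RPC.fin

namespace RPC

/-- Morphisms are the homomorphisms of lattices that map the cone into the cone. -/
@[ext]
structure Hom (σ τ : RPC) where
  map : σ.N →+ τ.N
  map_pts : ∀ x ∈ σ.pts, map x ∈ τ.pts

instance : Category RPC where
  Hom := Hom
  id σ := ⟨AddMonoidHom.id _, fun _ h => h⟩
  comp f f' := ⟨f'.map.comp f.map, fun x h => f'.map_pts _ (f.map_pts x h)⟩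
  id_comp _ := rfl
  comp_id _ := rfl
  assoc _ _ _ := rfl

@[ext]
theorem hom_ext {σ τ : RPC} {f f' : σ ⟶ τ} (h : ∀ x, Hom.map f x = Hom.map f' x) : f = f' :=
  Hom.ext (AddMonoidHom.ext h)

@[simp] theorem id_map (σ : RPC) (x : σ.N) : Hom.map (𝟙 σ) x = x := rfl

@[simp] theorem comp_map {σ τ κ : RPC} (f : σ ⟶ τ) (f' : τ ⟶ κ) (x : σ.N) :
    Hom.map (f ≫ f') x = Hom.map f' (Hom.map f x) := rfl

/-- The dual monoid `S_σ` of integral functionals that are nonnegative on the cone; since `σ ∩ N`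
generates `N`, it is the monoid of homomorphisms `σ ∩ N → ℕ`. -/
def dual (σ : RPC) : AddSubmonoid (σ.N →+ ℤ) where
  carrier := {ℓ | ∀ x ∈ σ.pts, 0 ≤ ℓ x}
  zero_mem' _ _ := le_rfl
  add_mem' ha hb x hx := add_nonneg (ha x hx) (hb x hx)

/-- The image of the cone is not contained in a proper face of the target; the faces are the zero loci
of the elements of the dual monoid. -/
def Dominant {σ τ : RPC} (f : σ ⟶ τ) : Prop :=
  ∀ ℓ ∈ τ.dual, (∀ x ∈ σ.pts, ℓ (Hom.map f x) = 0) → ℓ = 0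

/-- The inclusion of a face. -/
def IsFace {τ σ : RPC} (j : τ ⟶ σ) : Prop :=
  Function.Injective (Hom.map j) ∧
    ∃ ℓ ∈ σ.dual, ∀ y ∈ σ.pts, ℓ y = 0 ↔ ∃ x ∈ τ.pts, Hom.map j x = y

theorem isFace_id (σ : RPC) : IsFace (𝟙 σ) :=
  ⟨fun _ _ h => h, 0, σ.dual.zero_mem, fun y hy => ⟨fun _ => ⟨y, hy, rfl⟩, fun _ => rfl⟩⟩

variable {σ τ : RPC}

theorem eq_zero_of_pts {ℓ : σ.N →+ ℤ} (h : ∀ x ∈ σ.pts, ℓ x = 0) : ℓ = 0 := by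
  ext x
  obtain ⟨p, hp, q, hq, rfl⟩ := σ.full x
  simp [h p hp, h q hq]

theorem dual_comp (f : σ ⟶ τ) {ℓ : τ.N →+ ℤ} (h : ℓ ∈ τ.dual) : ℓ.comp (Hom.map f) ∈ σ.dual :=
  fun x hx => h _ (f.map_pts x hx)

theorem dual_add_eq_zero {ℓ ℓ' : σ.N →+ ℤ} (h : ℓ ∈ σ.dual) (h' : ℓ' ∈ σ.dual)
    (e : ℓ + ℓ' = 0) : ℓ = 0 := by
  refine eq_zero_of_pts fun x hx => ?_
  have h1 := h x hx
  have h2 := h' x hx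
  have h3 : ℓ x + ℓ' x = 0 := by rw [← AddMonoidHom.add_apply, e]; rfl
  omega

theorem exists_interior (s : Set (σ.N →+ ℤ)) (hs : s.Finite) (hd : ∀ ℓ ∈ s, ℓ ∈ σ.dual) :
    ∃ p ∈ σ.pts, ∀ ℓ ∈ s, ℓ ≠ 0 → 0 < ℓ p := by
  induction s, hs using Set.Finite.induction_on with
  | empty => exact ⟨0, σ.pts.zero_mem, by simp⟩
  | insert ha hs ih =>
    rename_i a s
    obtain ⟨p, hp, h⟩ := ih fun ℓ hℓ => hd ℓ (Set.mem_insert_of_mem _ hℓ)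
    by_cases h0 : a = 0
    · refine ⟨p, hp, ?_⟩
      rintro ℓ (rfl | hℓ) hne
      · exact (hne h0).elim
      · exact h ℓ hℓ hne
    · have : ∃ q ∈ σ.pts, a q ≠ 0 := by
        by_contra hc
        push Not at hc
        exact h0 (eq_zero_of_pts hc)
      obtain ⟨q, hq, hqa⟩ := this
      refine ⟨p + q, σ.pts.add_mem hp hq, ?_⟩
      rintro ℓ hℓ hne
      have hdl := hd ℓ hℓ
      rw [map_add]
      rcases hℓ with rfl | hℓ
      · have := hdl p hp
        have := hdl q hq
        omega
      · have := h ℓ hℓ hne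
        have := hdl q hq
        omega

end RPC

/-! ### metrics -/

/-- A generalized metric on a graph with values in the dual monoid of a cone: a function that assigns
to every edge a nonzero element of the dual monoid. It is given as a function `len` on vertices and
flags that is invariant under the involution, and zero exactly off the half-edges. -/
structure Metric {n : ℕ} (G : MGraph n) (σ : RPC) where
  len : G.X → (σ.N →+ ℤ)
  mem : ∀ x, len x ∈ σ.dual
  symm : ∀ x, len (G.i x) = len x
  zero_iff : ∀ x, len x = 0 ↔ G.i x = x

namespace Metric

variable {n g : ℕ} {G G' : MGraph n} {σ τ : RPC}

theorem vertex (d : Metric G σ) {x : G.X} (h : G.r x = x) : d.len x = 0 :=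
  (d.zero_iff x).2 (by rw [← h, G.i_r])

/-- Pullback of a metric along a morphism of cones that kills no length. -/
def comap (d : Metric G σ) (f : τ ⟶ σ) (hf : RPC.Dominant f) : Metric G τ where
  len x := (d.len x).comp (RPC.Hom.map f)
  mem x := RPC.dual_comp f (d.mem x)
  symm x := by rw [d.symm]
  zero_iff x := by
    rw [← d.zero_iff]
    constructor
    · intro h
      exact hf _ (d.mem x) fun y _ => DFunLike.congr_fun h y
    · intro h
      rw [h]; rfl

/-- Transport of a metric along an isomorphism of graphs. -/
def transport (d : Metric G σ) (e : G' ≅ G) : Metric G' σ where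
  len x := d.len (MGraph.Hom.map e.hom x)
  mem x := d.mem _
  symm x := by rw [MGraph.Hom.map_i, d.symm]
  zero_iff x := by
    rw [d.zero_iff, ← MGraph.Hom.map_i]
    have inj : Function.Injective (MGraph.Hom.map e.hom) := by
      intro a b hab
      have := congrArg (MGraph.Hom.map e.inv) hab
      rwa [← MGraph.comp_map, ← MGraph.comp_map, e.hom_inv_id] at this
    exact inj.eq_iff

open Classical in
/-- The length on the stabilization: on an exceptional edge, the sum of the two lengths. -/
noncomputable def stLen (d : Metric G σ) (x : G.X) : σ.N →+ ℤ :=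
  if G.IsExc (G.r (G.i x)) then d.len x + d.len (G.sw (G.i x)) else d.len x

theorem stLen_exc (d : Metric G σ) {x : G.X} (h : G.IsExc (G.r (G.i x))) :
    d.stLen x = d.len x + d.len (G.sw (G.i x)) := if_pos h

theorem stLen_nex (d : Metric G σ) {x : G.X} (h : ¬ G.IsExc (G.r (G.i x))) :
    d.stLen x = d.len x := if_neg h

/-- The metric of the stabilization. -/
noncomputable def st (d : Metric G σ) (hG : G.IsQuasiStable g) : Metric (G.st hG) σ where
  len x := d.stLen x.1
  mem x := by
    unfold stLen
    split_ifs
    · exact σ.dual.add_mem (d.mem _) (d.mem _)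
    · exact d.mem _
  symm x := by
    change d.stLen (G.stI x.1) = d.stLen x.1
    by_cases h : G.IsExc (G.r (G.i x.1))
    · have hf := MGraph.i_flag_of_exc x.2 h
      rw [MGraph.stI, if_pos h, d.stLen_exc h, d.stLen_exc, G.i_i, MGraph.sw_sw h hf, d.symm,
        d.symm, add_comm]
      rwa [G.i_i, MGraph.r_sw h hf]
    · rw [MGraph.stI, if_neg h, d.stLen_nex h, d.stLen_nex, d.symm]
      rw [G.i_i]
      exact x.2
  zero_iff x := by
    refine Iff.trans ?_ (show (G.stI x.1 = x.1 ↔ (G.st hG).i x = x) from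
      ⟨fun h => Subtype.ext h, congrArg Subtype.val⟩)
    by_cases h : G.IsExc (G.r (G.i x.1))
    · have hf := MGraph.i_flag_of_exc x.2 h
      rw [d.stLen_exc h, MGraph.stI, if_pos h]
      constructor
      · intro e
        have := (d.zero_iff _).1 (RPC.dual_add_eq_zero (d.mem _) (d.mem _) e)
        rw [this] at h
        exact (x.2 h).elim
      · intro e
        refine (MGraph.sw_ne h hf ?_).elim
        rw [← G.i_i (G.sw _), e]
    · rw [d.stLen_nex h, MGraph.stI, if_neg h, d.zero_iff]

end Metric

/-! ### tropical curves -/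

/-- A stable tropical curve of type `(g, n)` over a rational polyhedral cone. -/
structure TropM (g n : ℕ) : Type 1 where
  base : RPC
  graph : SG g n
  metric : Metric graph.obj base

namespace TropM

variable {g n : ℕ}

/-- A morphism `Γ/σ → Γ'/σ'` consists of a morphism of cones `f : σ → σ'` and a morphism of graphs
`π : 𝔾(Γ') → 𝔾(Γ)` such that `f^* d'(e') = d(π(e'))` if `π(e')` is an edge, and `π` contracts `e'`
if and only if `f^* d'(e') = 0`; as `d` is zero exactly off the half-edges, this is the single
condition `len`. -/
@[ext]
structure Hom (Γ Γ' : TropM g n) where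
  base : Γ.base ⟶ Γ'.base
  graph : Γ'.graph ⟶ Γ.graph
  len : ∀ x, (Γ'.metric.len x).comp (RPC.Hom.map base) = Γ.metric.len (graph.hom.map x)

instance : Category (TropM g n) where
  Hom := Hom
  id Γ := ⟨𝟙 _, 𝟙 _, fun _ => rfl⟩
  comp f f' := ⟨f.base ≫ f'.base, f'.graph ≫ f.graph, fun x => by
    refine Eq.trans ?_ (f.len _)
    rw [← f'.len]; rfl⟩
  id_comp _ := Hom.ext (Category.id_comp _) (Category.comp_id _)
  comp_id _ := Hom.ext (Category.comp_id _) (Category.id_comp _)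
  assoc _ _ _ := Hom.ext (Category.assoc _ _ _) (Category.assoc _ _ _).symm

@[ext]
theorem hom_ext {Γ Γ' : TropM g n} {f f' : Γ ⟶ Γ'} (h : Hom.base f = Hom.base f')
    (h' : Hom.graph f = Hom.graph f') : f = f' := Hom.ext h h'

/-- The base cone. -/
def toRPC (g n : ℕ) : TropM g n ⥤ RPC where
  obj Γ := Γ.base
  map f := Hom.base f
  map_id _ := rfl
  map_comp _ _ := rfl

end TropM

/-- The universal tropical Jacobian as a category over the category of cones: quasi-stable tropical
curves with an admissible divisor over rational polyhedral cones. The parameter `P` selects a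
version. -/
structure TropJ {g n : ℕ} (P : ObjectProperty (QD g n)) : Type 1 where
  base : RPC
  div : P.FullSubcategory
  metric : Metric div.obj.graph.obj base

namespace TropJ

variable {g n : ℕ} {P : ObjectProperty (QD g n)}

/-- Morphisms, as for stable tropical curves, with a morphism of graphs compatible with the
divisors. -/
@[ext]
structure Hom (Γ Γ' : TropJ P) where
  base : Γ.base ⟶ Γ'.base
  div : Γ'.div ⟶ Γ.div
  len : ∀ x, (Γ'.metric.len x).comp (RPC.Hom.map base) =
    Γ.metric.len ((QD.Hom.graph div.hom).hom.map x)

instance : Category (TropJ P) where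
  Hom := Hom
  id Γ := ⟨𝟙 _, 𝟙 _, fun _ => rfl⟩
  comp f f' := ⟨f.base ≫ f'.base, f'.div ≫ f.div, fun x => by
    refine Eq.trans ?_ (f.len _)
    rw [← f'.len]; rfl⟩
  id_comp _ := Hom.ext (Category.id_comp _) (Category.comp_id _)
  comp_id _ := Hom.ext (Category.comp_id _) (Category.id_comp _)
  assoc _ _ _ := Hom.ext (Category.assoc _ _ _) (Category.assoc _ _ _).symm

@[ext]
theorem hom_ext {Γ Γ' : TropJ P} {f f' : Γ ⟶ Γ'} (h : Hom.base f = Hom.base f')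
    (h' : Hom.div f = Hom.div f') : f = f' := Hom.ext h h'

/-- The base cone. -/
def toRPC (P : ObjectProperty (QD g n)) : TropJ P ⥤ RPC where
  obj Γ := Γ.base
  map f := Hom.base f
  map_id _ := rfl
  map_comp _ _ := rfl

end TropJ

theorem stLen_comp {n g : ℕ} {G G' : MGraph n} (hG : G.IsQuasiStable g)
    {σ σ' : RPC} (d : Metric G σ) (d' : Metric G' σ') (f : σ' ⟶ σ) (π : MGraph.Hom G G')
    (h : ∀ x, (d.len x).comp (RPC.Hom.map f) = d'.len (π.map x)) {x : G.X}
    (hx' : ¬ G.IsExc (G.r x)) :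
    (d.stLen x).comp (RPC.Hom.map f) = d'.stLen (MGraph.stFun π x) := by
  by_cases hx : G.IsExc (G.r (G.i x))
  · have hf := MGraph.i_flag_of_exc hx' hx
    rw [d.stLen_exc hx, AddMonoidHom.add_comp, h, h]
    by_cases hv : G'.r (π.map x) = π.map x
    · rw [MGraph.stFun, if_pos ⟨hx, hv⟩, d'.stLen_nex, d'.vertex hv, zero_add]
      rw [← π.map_i]
      exact π.not_exc hG (hG.not_exc_i_sw hx hf)
    · rw [MGraph.stFun, if_neg fun e => hv e.2]
      by_cases hw : G'.IsExc (G'.r (G'.i (π.map x)))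
      · rw [d'.stLen_exc hw, ← π.map_i, π.map_sw hG (by rwa [π.map_i]) hf]
      · rw [d'.stLen_nex hw, d'.vertex (x := π.map (G.sw _)), add_zero]
        refine π.contract_or hx hf (by rwa [π.map_i]) ?_
        rw [π.map_i]
        exact MGraph.r_i_flag hv
  · rw [d.stLen_nex hx, MGraph.stFun, if_neg fun e => hx e.1, d'.stLen_nex, h]
    rw [← π.map_i]
    exact π.not_exc hG hx

section Phi

variable {g n : ℕ} [HyperbolicPair g n] (P : ObjectProperty (QD g n))

/-- The functor that forgets the divisor and stabilizes the graph. -/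
noncomputable def forgetStab : P.FullSubcategory ⥤ SG g n :=
  P.ι ⋙ QD.forget g n ⋙ stabilization g n

/-- The forgetful-stabilization morphism. -/
noncomputable def Phi : TropJ P ⥤ TropM g n where
  obj Γ := ⟨Γ.base, (forgetStab P).obj Γ.div, Γ.metric.st Γ.div.obj.graph.property⟩
  map f := ⟨TropJ.Hom.base f, (forgetStab P).map (TropJ.Hom.div f), fun x =>
    stLen_comp (TropJ.div _).obj.graph.property _ _ _ _ (TropJ.Hom.len f) x.2⟩
  map_id _ := TropM.hom_ext rfl ((forgetStab P).map_id _)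
  map_comp _ _ := TropM.hom_ext rfl ((forgetStab P).map_comp _ _)

/-- The category of triples `(G, D, ρ)`, with `ρ` an isomorphism from a given stable graph to the
stabilization of `G`. -/
abbrev QDOver (G : SG g n) :=
  ObjectProperty.FullSubcategory fun c : StructuredArrow G (forgetStab P) => IsIso c.hom

end Phi

namespace Metric

variable {n g : ℕ} {G G' : MGraph n} {hG : G.IsQuasiStable g} {hG' : G'.IsQuasiStable g}
  {σ σ' : RPC}

open Classical in
/-- The metric `ℓ` of the stabilization, as a function on the vertices and flags of `G`. -/
noncomputable def ext (ℓ : Metric (G.st hG) σ) (x : G.X) : σ.N →+ ℤ :=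
  if h : G.IsExc (G.r x) then 0 else ℓ.len ⟨x, h⟩

theorem ext_nex (ℓ : Metric (G.st hG) σ) {x : G.X} (h : ¬ G.IsExc (G.r x)) :
    ℓ.ext x = ℓ.len ⟨x, h⟩ := dif_neg h

theorem ext_mem (ℓ : Metric (G.st hG) σ) (x : G.X) : ℓ.ext x ∈ σ.dual := by
  unfold ext
  split_ifs
  · exact σ.dual.zero_mem
  · exact ℓ.mem _

theorem ext_zero_iff (ℓ : Metric (G.st hG) σ) {x : G.X} (h : ¬ G.IsExc (G.r x)) :
    ℓ.ext x = 0 ↔ G.stI x = x := by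
  rw [ext_nex ℓ h]
  refine (ℓ.zero_iff _).trans ?_
  exact ⟨congrArg Subtype.val, fun h => Subtype.ext h⟩

theorem ext_stI (ℓ : Metric (G.st hG) σ) {x : G.X} (h : ¬ G.IsExc (G.r x)) :
    ℓ.ext (G.stI x) = ℓ.ext x := by
  rw [ext_nex ℓ h]
  refine Eq.trans ?_ (ℓ.symm _)
  exact ext_nex ℓ _

theorem ext_vertex (ℓ : Metric (G.st hG) σ) {x : G.X} (h : G.r x = x) : ℓ.ext x = 0 := by
  by_cases hx : G.IsExc (G.r x)
  · exact dif_pos hx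
  · rw [ext_nex ℓ hx]
    exact ℓ.vertex (Subtype.ext h)

/-- The lattice of the fibre product over `N_σ` of the lattices of `σ ×_{ℝ≥0} ℝ≥0²`, one for every
exceptional edge `e` of the stabilization, that is, for every exceptional vertex `v` of `G`. The two
coordinates `(a, b)` with `a + b = ℓ(e)` are indexed by the two half-edges at `v`, so that no order
of them has to be chosen. -/
def fiberLattice (ℓ : Metric (G.st hG) σ) : Submodule ℤ (σ.N × (G.X → ℤ)) where
  carrier := {z | (∀ x, ¬ (G.IsExc (G.r x) ∧ G.r x ≠ x) → z.2 x = 0) ∧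
    ∀ x, G.IsExc (G.r x) → G.r x ≠ x → z.2 x + z.2 (G.sw x) = ℓ.ext (G.i x) z.1}
  zero_mem' := ⟨fun _ _ => rfl, fun _ _ _ => by simp⟩
  add_mem' := by
    rintro z z' ⟨h1, h2⟩ ⟨h1', h2'⟩
    refine ⟨fun x hx => ?_, fun x h hx => ?_⟩
    · simp [h1 x hx, h1' x hx]
    · have := h2 x h hx
      have := h2' x h hx
      simp only [Prod.snd_add, Prod.fst_add, Pi.add_apply, map_add]
      omega
  smul_mem' := by
    rintro c z ⟨h1, h2⟩
    refine ⟨fun x hx => ?_, fun x h hx => ?_⟩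
    · simp [h1 x hx]
    · have := h2 x h hx
      simp only [Prod.smul_snd, Prod.smul_fst, Pi.smul_apply, smul_eq_mul, map_zsmul, ← this]
      ring

open Classical in
theorem exists_fiber_interior (ℓ : Metric (G.st hG) σ) (p : σ.N) :
    ((2 : ℤ) • p, fun x => if G.IsExc (G.r x) ∧ G.r x ≠ x then ℓ.ext (G.i x) p else 0) ∈
      ℓ.fiberLattice := by
  refine ⟨fun x hx => if_neg hx, fun x h hx => ?_⟩
  have h1 : G.IsExc (G.r (G.sw x)) ∧ G.r (G.sw x) ≠ G.sw x :=
    ⟨by rwa [MGraph.r_sw h hx], MGraph.sw_flag h hx⟩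
  have h2 : ℓ.ext (G.i (G.sw x)) = ℓ.ext (G.i x) := by
    rw [← ext_stI ℓ (hG.not_exc_i h hx), MGraph.stI, G.i_i, if_pos h]
  change (if _ then _ else _) + (if _ then _ else _) = _
  rw [if_pos ⟨h, hx⟩, if_pos h1, h2, map_zsmul, smul_eq_mul]
  ring

theorem ext_pos (ℓ : Metric (G.st hG) σ) {x : G.X} (h : G.IsExc (G.r x)) (hx : G.r x ≠ x) :
    ℓ.ext (G.i x) ≠ 0 := by
  have hn := hG.not_exc_i h hx
  rw [Ne, ext_zero_iff ℓ hn, MGraph.stI, G.i_i, if_pos h]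
  intro e
  exact MGraph.sw_ne h hx (by rw [← G.i_i (G.sw x), e, G.i_i])

/-- The fibre product over `σ` of the cones `σ ×_{ℝ≥0} ℝ≥0²`, one for every exceptional edge of the
stabilization. -/
noncomputable def fiberCone (ℓ : Metric (G.st hG) σ) : RPC where
  N := ℓ.fiberLattice
  pts :=
    { carrier := {z | z.1.1 ∈ σ.pts ∧ ∀ x, 0 ≤ z.1.2 x}
      zero_mem' := ⟨σ.pts.zero_mem, fun _ => le_rfl⟩
      add_mem' := fun h h' =>
        ⟨σ.pts.add_mem h.1 h'.1, fun x => add_nonneg (h.2 x) (h'.2 x)⟩ }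
  polyhedral := by
    obtain ⟨s, hs, h⟩ := σ.polyhedral
    let A : ℓ.fiberLattice →+ σ.N :=
      (AddMonoidHom.fst σ.N (G.X → ℤ)).comp ℓ.fiberLattice.subtype.toAddMonoidHom
    let B : G.X → (ℓ.fiberLattice →+ ℤ) := fun x =>
      ((Pi.evalAddMonoidHom (fun _ : G.X => ℤ) x).comp (AddMonoidHom.snd σ.N (G.X → ℤ))).comp
        ℓ.fiberLattice.subtype.toAddMonoidHom
    refine ⟨(fun k => k.comp A) '' s ∪ Set.range B,
      (hs.image _).union (Set.finite_range B), fun z => ?_⟩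
    constructor
    · rintro ⟨h1, h2⟩ k (⟨k, hk, rfl⟩ | ⟨x, rfl⟩)
      · exact (h _).1 h1 k hk
      · exact h2 x
    · intro hz
      exact ⟨(h _).2 fun k hk => hz _ (Or.inl ⟨k, hk, rfl⟩), fun x => hz _ (Or.inr ⟨x, rfl⟩)⟩
  pointed := by
    rintro z ⟨h1, h2⟩ ⟨h1', h2'⟩
    refine Subtype.ext (Prod.ext (σ.pointed _ h1 h1') (funext fun x => ?_))
    have a := h2 x
    have b : 0 ≤ -z.1.2 x := h2' x
    exact le_antisymm (by linarith : z.1.2 x ≤ 0) a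
  full z := by
    classical
    obtain ⟨s, hs, h⟩ := σ.polyhedral
    have hsd : ∀ k ∈ s, k ∈ σ.dual := fun k hk x hx => (h x).1 hx k hk
    obtain ⟨p, hp, hpos⟩ := RPC.exists_interior (s ∪ Set.range fun x => ℓ.ext (G.i x))
      (hs.union (Set.finite_range _)) (by
        rintro k (hk | ⟨x, rfl⟩)
        · exact hsd k hk
        · exact ℓ.ext_mem _)
    let u : ℓ.fiberLattice := ⟨_, ℓ.exists_fiber_interior p⟩
    have hu : u.1.1 ∈ σ.pts ∧ ∀ x, 0 ≤ u.1.2 x := by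
      refine ⟨?_, fun x => ?_⟩
      · change (2 : ℤ) • p ∈ σ.pts
        rw [two_zsmul]
        exact σ.pts.add_mem hp hp
      · change (0 : ℤ) ≤ if _ then _ else _
        split_ifs
        · exact ℓ.ext_mem _ p hp
        · exact le_rfl
    -- a bound for all coordinates of `z`
    obtain ⟨K, hK⟩ : ∃ K : ℕ, (∀ k ∈ s, -(K : ℤ) ≤ k z.1.1) ∧ ∀ x, -(K : ℤ) ≤ z.1.2 x := by
      obtain ⟨a, ha⟩ := (hs.image fun k => k z.1.1).bddBelow
      obtain ⟨b, hb⟩ := (Set.finite_range z.1.2).bddBelow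
      refine ⟨a.natAbs + b.natAbs, fun k hk => ?_, fun x => ?_⟩
      · have := ha ⟨k, hk, rfl⟩
        push_cast
        simp only at this
        have := neg_abs_le a
        have := abs_nonneg b
        omega
      · have := hb ⟨x, rfl⟩
        push_cast
        have := neg_abs_le b
        have := abs_nonneg a
        omega
    have hKu : K • u ∈ {z : ℓ.fiberLattice | z.1.1 ∈ σ.pts ∧ ∀ x, 0 ≤ z.1.2 x} := by
      refine ⟨?_, fun x => ?_⟩
      · exact σ.pts.nsmul_mem hu.1 K
      · change 0 ≤ K • u.1.2 x
        exact nsmul_nonneg (hu.2 x) K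
    refine ⟨K • u + z, ⟨?_, fun x => ?_⟩, K • u, hKu, by abel⟩
    · rw [h]
      intro k hk
      change 0 ≤ k (K • ((2 : ℤ) • p) + z.1.1)
      by_cases hk0 : k = 0
      · simp [hk0]
      · have h1 := hpos k (Or.inl hk) hk0
        have h2 := hK.1 k hk
        rw [map_add, map_nsmul, map_zsmul, nsmul_eq_mul, smul_eq_mul]
        nlinarith
    · change 0 ≤ K • u.1.2 x + z.1.2 x
      by_cases hx : G.IsExc (G.r x) ∧ G.r x ≠ x
      · have e : u.1.2 x = ℓ.ext (G.i x) p := if_pos hx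
        have h1 := hpos (ℓ.ext (G.i x)) (Or.inr ⟨x, rfl⟩) (ℓ.ext_pos hx.1 hx.2)
        have h2 := hK.2 x
        rw [e, nsmul_eq_mul]
        nlinarith
      · rw [z.2.1 x hx, add_zero]
        exact nsmul_nonneg (hu.2 x) K

/-- The projection to `σ`. -/
noncomputable def fiberProj (ℓ : Metric (G.st hG) σ) : ℓ.fiberCone ⟶ σ where
  map := (AddMonoidHom.fst σ.N (G.X → ℤ)).comp ℓ.fiberLattice.subtype.toAddMonoidHom
  map_pts _ h := h.1

open Classical in
/-- The coordinates of the image of a point `z` under the map of cones induced by `π : G → G'`. At a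
half-edge `x` at an exceptional vertex of `G`, they are: zero if `π` contracts `x`; the coordinate of
`z` at `π x` if `π x` is a half-edge at an exceptional vertex; and otherwise the full length of the
edge (then the other half-edge at that exceptional vertex is contracted, and this is one of the two
faces `σ → σ ×_{ℝ≥0} ℝ≥0²`). -/
noncomputable def fiberCoord (π : MGraph.Hom G G') (b : σ' ⟶ σ)
    (ℓ : Metric (G.st hG) σ) (z : σ'.N × (G'.X → ℤ)) (x : G.X) : ℤ :=
  if G.IsExc (G.r x) ∧ G.r x ≠ x ∧ G'.r (π.map x) ≠ π.map x then
    if G'.IsExc (G'.r (π.map x)) then z.2 (π.map x) else ℓ.ext (G.i x) (RPC.Hom.map b z.1)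
  else 0

section fiberMap

variable (π : MGraph.Hom G G') (b : σ' ⟶ σ) (ℓ : Metric (G.st hG) σ)
  (z : σ'.N × (G'.X → ℤ)) {x : G.X}

theorem fiberCoord_of_not (h : ¬ (G.IsExc (G.r x) ∧ G.r x ≠ x ∧ G'.r (π.map x) ≠ π.map x)) :
    fiberCoord π b ℓ z x = 0 := if_neg h

theorem fiberCoord_exc (h : G.IsExc (G.r x) ∧ G.r x ≠ x ∧ G'.r (π.map x) ≠ π.map x)
    (h' : G'.IsExc (G'.r (π.map x))) :
    fiberCoord π b ℓ z x = z.2 (π.map x) := by rw [fiberCoord, if_pos h, if_pos h']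

theorem fiberCoord_nex (h : G.IsExc (G.r x) ∧ G.r x ≠ x ∧ G'.r (π.map x) ≠ π.map x)
    (h' : ¬ G'.IsExc (G'.r (π.map x))) :
    fiberCoord π b ℓ z x = ℓ.ext (G.i x) (RPC.Hom.map b z.1) := by
  rw [fiberCoord, if_pos h, if_neg h']

theorem ext_comp {ℓ' : Metric (G'.st hG') σ'} {π : MGraph.Hom G G'} {b : σ' ⟶ σ}
    {ℓ : Metric (G.st hG) σ}
    (H : ∀ x, (ℓ.len x).comp (RPC.Hom.map b) = ℓ'.len ((MGraph.stMap hG hG' π).map x))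
    (hx : ¬ G.IsExc (G.r x)) (y : σ'.N) :
    ℓ.ext x (RPC.Hom.map b y) = ℓ'.ext (MGraph.stFun π x) y := by
  rw [ext_nex ℓ hx, ext_nex ℓ' (MGraph.stFun_mem hG π hx)]
  exact DFunLike.congr_fun (H ⟨x, hx⟩) y

variable {π b ℓ z} {ℓ' : Metric (G'.st hG') σ'}

theorem stFun_flag (h : G'.r (π.map x) ≠ π.map x) : MGraph.stFun π x = π.map x :=
  if_neg fun e => h e.2

theorem fiberCoord_mem
    (H : ∀ x, (ℓ.len x).comp (RPC.Hom.map b) = ℓ'.len ((MGraph.stMap hG hG' π).map x))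
    (hz : z ∈ ℓ'.fiberLattice) :
    (RPC.Hom.map b z.1, fiberCoord π b ℓ z) ∈ ℓ.fiberLattice := by
  refine ⟨fun x hx => fiberCoord_of_not _ _ _ _ fun h => hx ⟨h.1, h.2.1⟩, fun x h hx => ?_⟩
  change fiberCoord π b ℓ z x + fiberCoord π b ℓ z (G.sw x) = _
  -- it suffices to treat the case that `x` is not contracted, or both are
  have h' : G.IsExc (G.r (G.sw x)) := by rwa [MGraph.r_sw h hx]
  have hx' := MGraph.sw_flag h hx
  have hn := hG.not_exc_i h hx
  have hn' := hG.not_exc_i h' hx'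
  have hsymm : ℓ.ext (G.i (G.sw x)) = ℓ.ext (G.i x) := by
    rw [← ext_stI ℓ hn, MGraph.stI, G.i_i, if_pos h]
  have hrr : G'.r (π.map (G.sw x)) = G'.r (π.map x) := by
    rw [← π.map_r, ← π.map_r, MGraph.r_sw h hx]
  by_cases hw : G'.IsExc (G'.r (π.map x))
  · have hf := π.flag_of_exc hG hw hx
    have hf' := π.flag_of_exc hG (x := G.sw x) (by rwa [hrr]) hx'
    rw [fiberCoord_exc _ _ _ _ ⟨h, hx, hf⟩ hw, fiberCoord_exc _ _ _ _ ⟨h', hx', hf'⟩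
      (by rwa [hrr]), π.map_sw hG hw hx, hz.2 _ hw hf, ext_comp H hn, stFun_flag, π.map_i]
    rw [π.map_i]
    exact MGraph.r_i_flag hf
  · by_cases hf : G'.r (π.map x) = π.map x
    · rw [fiberCoord_of_not (x := x) _ _ _ _ fun e => e.2.2 hf, zero_add]
      by_cases hf' : G'.r (π.map (G.sw x)) = π.map (G.sw x)
      · rw [fiberCoord_of_not (x := G.sw x) _ _ _ _ fun e => e.2.2 hf', ext_comp H hn,
          MGraph.stFun, G.i_i, if_pos, ext_vertex _ hf']
        · rfl
        · refine ⟨h, ?_⟩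
          rw [π.map_i, ← hf, G'.i_r, G'.r_r]
      · rw [fiberCoord_nex _ _ _ _ ⟨h', hx', hf'⟩ (by rwa [hrr]), hsymm]
    · have hf' := π.contract_or h hx hw hf
      rw [fiberCoord_nex _ _ _ _ ⟨h, hx, hf⟩ hw,
        fiberCoord_of_not (x := G.sw x) _ _ _ _ fun e => e.2.2 hf', add_zero]

/-- The map of cones induced by a morphism `π : G → G'` of quasi-stable graphs, over a map `b` of base
cones that is compatible with the metrics of the stabilizations. -/
noncomputable def fiberMap (ℓ' : Metric (G'.st hG') σ') (π : MGraph.Hom G G') (b : σ' ⟶ σ)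
    (ℓ : Metric (G.st hG) σ)
    (H : ∀ x, (ℓ.len x).comp (RPC.Hom.map b) = ℓ'.len ((MGraph.stMap hG hG' π).map x)) :
    ℓ'.fiberCone ⟶ ℓ.fiberCone where
  map :=
    { toFun := fun z => ⟨(RPC.Hom.map b z.1.1, fiberCoord π b ℓ z.1), fiberCoord_mem H z.2⟩
      map_zero' := by
        refine Subtype.ext (Prod.ext (map_zero _) (funext fun x => ?_))
        change fiberCoord π b ℓ 0 x = 0
        unfold fiberCoord
        split_ifs <;> simp
      map_add' := by
        intro z z'
        refine Subtype.ext (Prod.ext (map_add _ _ _) (funext fun x => ?_))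
        change fiberCoord π b ℓ (z.1 + z'.1) x =
          fiberCoord π b ℓ z.1 x + fiberCoord π b ℓ z'.1 x
        unfold fiberCoord
        split_ifs <;> simp }
  map_pts := by
    rintro z ⟨h1, h2⟩
    refine ⟨RPC.Hom.map_pts b _ h1, fun x => ?_⟩
    change 0 ≤ fiberCoord π b ℓ z.1 x
    unfold fiberCoord
    split_ifs
    · exact h2 _
    · exact ℓ.ext_mem _ _ (RPC.Hom.map_pts b _ h1)
    · exact le_rfl

end fiberMap

open Classical in
/-- The lengths of the tautological tropical curve over the cone of `G`. -/
noncomputable def tautLen (ℓ : Metric (G.st hG) σ) (x : G.X) : ℓ.fiberCone.N →+ ℤ :=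
  if G.IsExc (G.r x) then
    ((Pi.evalAddMonoidHom (fun _ : G.X => ℤ) x).comp (AddMonoidHom.snd σ.N (G.X → ℤ))).comp
      ℓ.fiberLattice.subtype.toAddMonoidHom
  else if G.IsExc (G.r (G.i x)) then
    ((Pi.evalAddMonoidHom (fun _ : G.X => ℤ) (G.i x)).comp (AddMonoidHom.snd σ.N (G.X → ℤ))).comp
      ℓ.fiberLattice.subtype.toAddMonoidHom
  else (ℓ.ext x).comp (RPC.Hom.map ℓ.fiberProj)

theorem tautLen_exc (ℓ : Metric (G.st hG) σ) {x : G.X} (h : G.IsExc (G.r x))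
    (z : ℓ.fiberCone.N) : ℓ.tautLen x z = z.1.2 x := by rw [tautLen, if_pos h]; rfl

theorem tautLen_exc' (ℓ : Metric (G.st hG) σ) {x : G.X} (h : ¬ G.IsExc (G.r x))
    (h' : G.IsExc (G.r (G.i x))) (z : ℓ.fiberCone.N) : ℓ.tautLen x z = z.1.2 (G.i x) := by
  rw [tautLen, if_neg h, if_pos h']; rfl

theorem tautLen_nex (ℓ : Metric (G.st hG) σ) {x : G.X} (h : ¬ G.IsExc (G.r x))
    (h' : ¬ G.IsExc (G.r (G.i x))) (z : ℓ.fiberCone.N) : ℓ.tautLen x z = ℓ.ext x z.1.1 := by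
  rw [tautLen, if_neg h, if_neg h']; rfl

theorem tautLen_i (ℓ : Metric (G.st hG) σ) (x : G.X) : ℓ.tautLen (G.i x) = ℓ.tautLen x := by
  ext z
  by_cases h : G.IsExc (G.r x)
  · rw [ℓ.tautLen_exc h]
    by_cases hx : G.r x = x
    · rw [← hx, G.i_r, ℓ.tautLen_exc (by rwa [G.r_r])]
    · rw [ℓ.tautLen_exc' (hG.not_exc_i h hx) (by rwa [G.i_i]), G.i_i]
  · by_cases h' : G.IsExc (G.r (G.i x))
    · rw [ℓ.tautLen_exc h', ℓ.tautLen_exc' h h']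
    · rw [ℓ.tautLen_nex h h', ℓ.tautLen_nex h' (by rwa [G.i_i]), ← ext_stI ℓ h, MGraph.stI,
        if_neg h']

theorem tautLen_zero_exc (ℓ : Metric (G.st hG) σ) {x : G.X} (h : G.IsExc (G.r x)) :
    ℓ.tautLen x = 0 ↔ G.i x = x := by
  classical
  by_cases hx : G.r x = x
  · refine iff_of_true ?_ (by rw [← hx, G.i_r])
    ext z
    rw [ℓ.tautLen_exc h, z.2.1 x fun e => e.2 hx]; rfl
  · refine iff_of_false ?_ (hG.exc_edges x h hx).1
    intro e
    apply ℓ.ext_pos h hx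
    ext p
    have := DFunLike.congr_fun e (⟨_, ℓ.exists_fiber_interior p⟩ : ℓ.fiberLattice)
    replace this := (ℓ.tautLen_exc h _).symm.trans this
    change (if _ then _ else _) = (0 : ℤ) at this
    rw [if_pos ⟨h, hx⟩] at this
    exact this

/-- The tautological metric on `G` over the cone of `G`: the coordinates give the lengths of the edges
at exceptional vertices, the other edges have the length prescribed by `ℓ`. -/
noncomputable def taut (ℓ : Metric (G.st hG) σ) : Metric G ℓ.fiberCone where
  len := ℓ.tautLen
  mem x z hz := by
    by_cases h : G.IsExc (G.r x)
    · rw [ℓ.tautLen_exc h]; exact hz.2 x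
    · by_cases h' : G.IsExc (G.r (G.i x))
      · rw [ℓ.tautLen_exc' h h']; exact hz.2 _
      · rw [ℓ.tautLen_nex h h']; exact ℓ.ext_mem _ _ hz.1
  symm := ℓ.tautLen_i
  zero_iff x := by
    classical
    by_cases h : G.IsExc (G.r x)
    · exact ℓ.tautLen_zero_exc h
    · by_cases h' : G.IsExc (G.r (G.i x))
      · rw [← ℓ.tautLen_i, ℓ.tautLen_zero_exc h', G.i_i]
        exact eq_comm
      · have e1 := ext_zero_iff ℓ h
        rw [MGraph.stI, if_neg h'] at e1
        rw [← e1]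
        constructor
        · intro e
          ext p
          have := DFunLike.congr_fun e (⟨_, ℓ.exists_fiber_interior p⟩ : ℓ.fiberLattice)
          replace this := (ℓ.tautLen_nex h h' _).symm.trans this
          change ℓ.ext x ((2 : ℤ) • p) = 0 at this
          rw [map_zsmul, smul_eq_mul] at this
          change ℓ.ext x p = 0
          omega
        · intro e
          ext z
          rw [ℓ.tautLen_nex h h', e]; rfl

theorem taut_stLen (ℓ : Metric (G.st hG) σ) {x : G.X} (hx : ¬ G.IsExc (G.r x)) :
    ℓ.taut.stLen x = (ℓ.ext x).comp (RPC.Hom.map ℓ.fiberProj) := by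
  ext z
  by_cases h : G.IsExc (G.r (G.i x))
  · have hf := MGraph.i_flag_of_exc hx h
    rw [stLen_exc _ h]
    change ℓ.tautLen x z + ℓ.tautLen (G.sw (G.i x)) z = ℓ.ext x z.1.1
    rw [ℓ.tautLen_exc' hx h, ℓ.tautLen_exc (by rwa [MGraph.r_sw h hf]), z.2.2 _ h hf, G.i_i]
  · rw [stLen_nex _ h]
    exact ℓ.tautLen_nex hx h z

theorem taut_fiberMap {ℓ' : Metric (G'.st hG') σ'} {π : MGraph.Hom G G'} {b : σ' ⟶ σ}
    {ℓ : Metric (G.st hG) σ}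
    (H : ∀ x, (ℓ.len x).comp (RPC.Hom.map b) = ℓ'.len ((MGraph.stMap hG hG' π).map x)) (x : G.X) :
    (ℓ.taut.len x).comp (RPC.Hom.map (fiberMap ℓ' π b ℓ H)) = ℓ'.taut.len (π.map x) := by
  have main : ∀ x, G.IsExc (G.r x) →
      (ℓ.taut.len x).comp (RPC.Hom.map (fiberMap ℓ' π b ℓ H)) = ℓ'.taut.len (π.map x) := by
    intro x h
    by_cases hx : G.r x = x
    · rw [ℓ.taut.vertex hx, ℓ'.taut.vertex (by rw [← π.map_r, hx])]; rfl
    · by_cases hf : G'.r (π.map x) = π.map x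
      · rw [ℓ'.taut.vertex hf]
        ext z
        change ℓ.tautLen x _ = 0
        rw [ℓ.tautLen_exc h]
        exact fiberCoord_of_not _ _ _ _ fun e => e.2.2 hf
      · ext z
        change ℓ.tautLen x _ = ℓ'.tautLen (π.map x) z
        rw [ℓ.tautLen_exc h]
        change fiberCoord π b ℓ z.1 x = _
        by_cases hw : G'.IsExc (G'.r (π.map x))
        · rw [ℓ'.tautLen_exc hw, fiberCoord_exc _ _ _ _ ⟨h, hx, hf⟩ hw]
        · have hn := hG.not_exc_i h hx
          have hw' : ¬ G'.IsExc (G'.r (G'.i (π.map x))) := by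
            rw [← π.map_i]; exact π.not_exc hG hn
          rw [ℓ'.tautLen_nex hw hw', fiberCoord_nex _ _ _ _ ⟨h, hx, hf⟩ hw, ext_comp H hn,
            stFun_flag, π.map_i, ← ext_stI ℓ' hw, MGraph.stI, if_neg hw']
          rw [π.map_i]
          exact MGraph.r_i_flag hf
  by_cases h : G.IsExc (G.r x)
  · exact main x h
  · by_cases h' : G.IsExc (G.r (G.i x))
    · have := main (G.i x) h'
      rwa [ℓ.taut.symm, π.map_i, ℓ'.taut.symm] at this
    · have hw := π.not_exc hG h
      have hw' : ¬ G'.IsExc (G'.r (G'.i (π.map x))) := by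
        rw [← π.map_i]; exact π.not_exc hG h'
      ext z
      change ℓ.tautLen x _ = ℓ'.tautLen (π.map x) z
      rw [ℓ.tautLen_nex h h', ℓ'.tautLen_nex hw hw']
      change ℓ.ext x (RPC.Hom.map b z.1.1) = _
      rw [ext_comp H h, MGraph.stFun, if_neg fun e => h' e.1]

end Metric

namespace Metric

variable {n g : ℕ} {G G' G'' : MGraph n} {hG : G.IsQuasiStable g} {hG' : G'.IsQuasiStable g}
  {hG'' : G''.IsQuasiStable g} {σ σ' σ'' : RPC}

theorem fiberCoord_id (ℓ : Metric (G.st hG) σ) {z : σ.N × (G.X → ℤ)} (hz : z ∈ ℓ.fiberLattice) :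
    fiberCoord (𝟙 G : G ⟶ G) (𝟙 σ) ℓ z = z.2 := by
  funext x
  by_cases h : G.IsExc (G.r x) ∧ G.r x ≠ x
  · exact fiberCoord_exc _ _ _ _ ⟨h.1, h.2, h.2⟩ h.1
  · rw [hz.1 x h]
    exact fiberCoord_of_not _ _ _ _ fun e => h ⟨e.1, e.2.1⟩

theorem fiberCoord_comp {π : G ⟶ G'} {π' : G' ⟶ G''} {b : σ' ⟶ σ} {b' : σ'' ⟶ σ'}
    {ℓ : Metric (G.st hG) σ} {ℓ' : Metric (G'.st hG') σ'} {ℓ'' : Metric (G''.st hG'') σ''}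
    (H : ∀ x, (ℓ.len x).comp (RPC.Hom.map b) = ℓ'.len ((MGraph.stMap hG hG' π).map x))
    (H' : ∀ x, (ℓ'.len x).comp (RPC.Hom.map b') = ℓ''.len ((MGraph.stMap hG' hG'' π').map x))
    (z : σ''.N × (G''.X → ℤ)) :
    fiberCoord (π ≫ π') (b' ≫ b) ℓ z =
      fiberCoord π b ℓ (RPC.Hom.map b' z.1, fiberCoord π' b' ℓ' z) := by
  funext x
  have hpp : MGraph.Hom.map (π ≫ π') x = π'.map (π.map x) := rfl
  by_cases h : G.IsExc (G.r x) ∧ G.r x ≠ x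
  swap
  · rw [fiberCoord_of_not _ _ _ _ fun e => h ⟨e.1, e.2.1⟩,
      fiberCoord_of_not _ _ _ _ fun e => h ⟨e.1, e.2.1⟩]
  obtain ⟨h, hx⟩ := h
  by_cases hf : G'.r (π.map x) = π.map x
  · rw [fiberCoord_of_not π b _ _ fun e => e.2.2 hf, fiberCoord_of_not (π ≫ π') _ _ _ fun e => ?_]
    apply e.2.2
    rw [hpp, ← π'.map_r, hf]
  have hn := hG.not_exc_i h hx
  have hi : ℓ.ext (G.i x) (RPC.Hom.map b (RPC.Hom.map b' z.1)) =
      ℓ'.ext (G'.i (π.map x)) (RPC.Hom.map b' z.1) := by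
    rw [ext_comp H hn, stFun_flag, π.map_i]
    rw [π.map_i]
    exact MGraph.r_i_flag hf
  by_cases hw : G'.IsExc (G'.r (π.map x))
  · rw [fiberCoord_exc π _ _ _ ⟨h, hx, hf⟩ hw]
    change _ = fiberCoord π' b' ℓ' z (π.map x)
    by_cases hf' : G''.r (π'.map (π.map x)) = π'.map (π.map x)
    · rw [fiberCoord_of_not π' _ _ _ fun e => e.2.2 hf',
        fiberCoord_of_not (π ≫ π') _ _ _ fun e => e.2.2 hf']
    · by_cases hw' : G''.IsExc (G''.r (π'.map (π.map x)))
      · rw [fiberCoord_exc π' _ _ _ ⟨hw, hf, hf'⟩ hw',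
          fiberCoord_exc (π ≫ π') _ _ _ ⟨h, hx, hf'⟩ hw']
        rfl
      · rw [fiberCoord_nex π' _ _ _ ⟨hw, hf, hf'⟩ hw',
          fiberCoord_nex (π ≫ π') _ _ _ ⟨h, hx, hf'⟩ hw']
        exact hi
  · rw [fiberCoord_nex π _ _ _ ⟨h, hx, hf⟩ hw]
    change _ = ℓ.ext (G.i x) (RPC.Hom.map b (RPC.Hom.map b' z.1))
    have hw' := π'.not_exc hG' hw
    by_cases hf' : G''.r (π'.map (π.map x)) = π'.map (π.map x)
    · have hni : ¬ G'.IsExc (G'.r (G'.i (π.map x))) := by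
        rw [← π.map_i]; exact π.not_exc hG hn
      rw [fiberCoord_of_not (π ≫ π') _ _ _ fun e => e.2.2 hf', hi, ext_comp H' hni,
        MGraph.stFun, if_neg fun e => hw (by rw [← G'.i_i (π.map x)]; exact e.1), ext_vertex]
      · rfl
      · rw [π'.map_i, ← hf', G''.i_r, G''.r_r]
    · rw [fiberCoord_nex (π ≫ π') _ _ _ ⟨h, hx, hf'⟩ hw']
      rfl

theorem stLen_comap (d : Metric G σ) (f : σ' ⟶ σ) (hf : RPC.Dominant f) (x : G.X) :
    (d.comap f hf).stLen x = (d.stLen x).comp (RPC.Hom.map f) := by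
  unfold stLen
  split_ifs <;> rfl

end Metric

/-! ### the Jacobian cone space -/

section Jac

variable {g n : ℕ} [HyperbolicPair g n] {P : ObjectProperty (QD g n)}

/-- The isomorphism `ρ`, as an isomorphism of graphs. -/
noncomputable def QDOver.iso {G : SG g n} (c : QDOver P G) :
    G.obj ≅ ((forgetStab P).obj c.obj.right).obj :=
  (ObjectProperty.ι _).mapIso (@asIso _ _ _ _ c.obj.hom c.property)

/-- The metric on the stabilization of `G` that corresponds to the metric of `Γ` under `ρ`. -/
noncomputable def QDOver.lengths {Γ : TropM g n} (c : QDOver P Γ.graph) :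
    Metric (c.obj.right.obj.graph.obj.st c.obj.right.obj.graph.property) Γ.base :=
  Γ.metric.transport c.iso.symm

/-- The cones of the Jacobian cone space of `Γ/σ`. Over every face `τ ≤ σ`, with `curve` the stable
tropical curve `Γ|_τ` obtained from `Γ` by restriction (and by contracting the edges whose lengths
vanish on `τ`), there is one cone for every triple `(G, D, ρ)` over the graph of `Γ|_τ`. The triples
over the graph of `Γ` itself give the cones over `τ = σ`. -/
structure JacIdx (P : ObjectProperty (QD g n)) (Γ : TropM g n) : Type 1 where
  curve : TropM g n
  incl : curve ⟶ Γ
  face : RPC.IsFace (TropM.Hom.base incl)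
  div : QDOver P curve.graph

namespace JacIdx

variable {Γ : TropM g n}

/-- A morphism, contravariant in the graphs: an inclusion of faces `τ → τ'` (with the contraction of
the curves) and a morphism of quasi-stable graphs with divisors from that over `τ'` to that over `τ`,
compatible with the isomorphisms `ρ`. -/
@[ext]
structure Hom (A B : JacIdx P Γ) where
  curve : A.curve ⟶ B.curve
  over_incl : curve ≫ B.incl = A.incl
  div : B.div.obj.right ⟶ A.div.obj.right
  comm : B.div.obj.hom ≫ (forgetStab P).map div = TropM.Hom.graph curve ≫ A.div.obj.hom

noncomputable instance : Category (JacIdx P Γ) where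
  Hom := Hom
  id A := ⟨𝟙 _, Category.id_comp _, 𝟙 _, by
    refine (congrArg (A.div.obj.hom ≫ ·) ((forgetStab P).map_id _)).trans ?_
    exact (Category.comp_id _).trans (Category.id_comp _).symm⟩
  comp f f' := ⟨f.curve ≫ f'.curve, by rw [Category.assoc, f'.over_incl, f.over_incl], f'.div ≫ f.div, by
    rw [Functor.map_comp, ← Category.assoc, f'.comm, Category.assoc, f.comm]
    exact (Category.assoc _ _ _).symm⟩
  id_comp _ := Hom.ext (Category.id_comp _) (Category.comp_id _)
  comp_id _ := Hom.ext (Category.comp_id _) (Category.id_comp _)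
  assoc _ _ _ := Hom.ext (Category.assoc _ _ _) (Category.assoc _ _ _).symm

@[ext]
theorem hom_ext {A B : JacIdx P Γ} {f f' : A ⟶ B} (h : Hom.curve f = Hom.curve f')
    (h' : Hom.div f = Hom.div f') : f = f' := Hom.ext h h'

theorem Hom.compat {A B : JacIdx P Γ} (f : A ⟶ B) (x) :
    (B.div.lengths.len x).comp (RPC.Hom.map (TropM.Hom.base (Hom.curve f))) =
      A.div.lengths.len ((MGraph.stMap B.div.obj.right.obj.graph.property
        A.div.obj.right.obj.graph.property (QD.Hom.graph (Hom.div f).hom).hom).map x) := by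
  refine (TropM.Hom.len (Hom.curve f) _).trans ?_
  refine congrArg A.curve.metric.len ?_
  have h := congrArg (fun k => MGraph.Hom.map k.hom (MGraph.Hom.map B.div.iso.inv x)) (Hom.comm f)
  have h1 : MGraph.Hom.map B.div.obj.hom.hom (MGraph.Hom.map B.div.iso.inv x) = x := by
    have := B.div.iso.inv_hom_id
    exact congrArg (fun k => MGraph.Hom.map k x) this
  change MGraph.Hom.map ((forgetStab P).map (Hom.div f)).hom
    (MGraph.Hom.map B.div.obj.hom.hom (MGraph.Hom.map B.div.iso.inv x)) =
    MGraph.Hom.map A.div.obj.hom.hom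
      (MGraph.Hom.map (TropM.Hom.graph (Hom.curve f)).hom (MGraph.Hom.map B.div.iso.inv x)) at h
  rw [h1] at h
  have h2 := congrArg (fun k => MGraph.Hom.map k
    (MGraph.Hom.map (TropM.Hom.graph (Hom.curve f)).hom (MGraph.Hom.map B.div.iso.inv x)))
    A.div.iso.hom_inv_id
  exact h2.symm.trans (congrArg (MGraph.Hom.map A.div.iso.inv) h.symm)

end JacIdx

/-- The diagram of cones: the cone of `(G, D, ρ)` over `τ` is the product over `τ` of the cones
`τ ×_{ℝ≥0} ℝ≥0²` for the exceptional edges of the stabilization of `G`. -/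
noncomputable def coneFunctor (P : ObjectProperty (QD g n)) (Γ : TropM g n) :
    JacIdx P Γ ⥤ RPC where
  obj A := A.div.lengths.fiberCone
  map {A B} f := Metric.fiberMap A.div.lengths (QD.Hom.graph (JacIdx.Hom.div f).hom).hom
    (TropM.Hom.base (JacIdx.Hom.curve f)) B.div.lengths (JacIdx.Hom.compat f)
  map_id A := by
    refine RPC.hom_ext fun z => Subtype.ext (Prod.ext rfl ?_)
    exact Metric.fiberCoord_id A.div.lengths z.2
  map_comp {A B C} f f' := by
    refine RPC.hom_ext fun z => Subtype.ext (Prod.ext rfl ?_)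
    exact Metric.fiberCoord_comp (JacIdx.Hom.compat f') (JacIdx.Hom.compat f) z.1

/-- The cone space (or stack) associated to a combinatorial one, as a category over the category of
cones: its objects over `τ` are the pairs of an index `c` and a morphism of cones `τ → K c` whose
image is not contained in a proper face. -/
abbrev Assoc {C : Type*} [Category C] (K : C ⥤ RPC) :=
  ObjectProperty.FullSubcategory fun x : Comma (𝟭 RPC) K => RPC.Dominant x.hom

/-- The Jacobian cone space. -/
abbrev Jac (P : ObjectProperty (QD g n)) (Γ : TropM g n) := Assoc (coneFunctor P Γ)

/-- The part of the diagram over the face `τ = σ`, which is indexed by the triples `(G, D, ρ)` over the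
graph of `Γ`. -/
noncomputable def JacIdx.whole (P : ObjectProperty (QD g n)) (Γ : TropM g n) :
    (QDOver P Γ.graph)ᵒᵖ ⥤ JacIdx P Γ where
  obj c := ⟨Γ, 𝟙 Γ, RPC.isFace_id _, c.unop⟩
  map f := ⟨𝟙 Γ, Category.id_comp _, f.unop.hom.right, by
    refine (StructuredArrow.w f.unop.hom).trans ?_
    exact (Category.id_comp _).symm⟩
  map_id c := rfl
  map_comp f f' := JacIdx.hom_ext (Category.id_comp _).symm rfl

/-- The objects associated to the cones indexed by the triples over the graph of `Γ` only. -/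
abbrev JacOpen (P : ObjectProperty (QD g n)) (Γ : TropM g n) :=
  Assoc (JacIdx.whole P Γ ⋙ coneFunctor P Γ)

/-- The inclusion into the Jacobian cone space. -/
noncomputable def JacOpen.incl (P : ObjectProperty (QD g n)) (Γ : TropM g n) :
    JacOpen P Γ ⥤ Jac P Γ :=
  ObjectProperty.lift _ (ObjectProperty.ι _ ⋙ Comma.preRight (𝟭 RPC) (JacIdx.whole P Γ) _)
    fun x => x.property

/-- The morphism from the Jacobian cone space to the universal tropical Jacobian: it pulls back the
tautological tropical curves with their divisors. -/
noncomputable def jacToJ (P : ObjectProperty (QD g n)) (Γ : TropM g n) : Jac P Γ ⥤ TropJ P where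
  obj x := ⟨x.obj.left, x.obj.right.div.obj.right,
    x.obj.right.div.lengths.taut.comap x.obj.hom x.property⟩
  map {x y} f := ⟨f.hom.left, JacIdx.Hom.div f.hom.right, fun k => by
    have h := Metric.taut_fiberMap (JacIdx.Hom.compat f.hom.right) k
    ext z
    have w := congrArg (fun q => RPC.Hom.map q z) f.hom.w
    have := DFunLike.congr_fun h (RPC.Hom.map x.obj.hom z)
    refine Eq.trans ?_ this
    exact congrArg (y.obj.right.div.lengths.taut.len k) w⟩
  map_id _ := rfl
  map_comp _ _ := rfl

/-- The structure map to `σ` of an object of the Jacobian cone space. -/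
noncomputable def jacBase {P : ObjectProperty (QD g n)} {Γ : TropM g n} (x : Jac P Γ) :
    x.obj.left ⟶ Γ.base :=
  x.obj.hom ≫ x.obj.right.div.lengths.fiberProj ≫ TropM.Hom.base x.obj.right.incl

/-- The morphism from the Jacobian cone space to `σ`; the cone `σ`, as a category over the category of
cones, is the slice category. -/
noncomputable def jacToBase (P : ObjectProperty (QD g n)) (Γ : TropM g n) :
    Jac P Γ ⥤ Over Γ.base where
  obj x := Over.mk (jacBase x)
  map {x y} f := Over.homMk f.hom.left (by
    have w := f.hom.w
    have o := congrArg TropM.Hom.base (JacIdx.Hom.over_incl f.hom.right)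
    refine RPC.hom_ext fun z => ?_
    have w' := congrArg (fun q => RPC.Hom.map (TropM.Hom.base y.obj.right.incl)
      (RPC.Hom.map y.obj.right.div.lengths.fiberProj (RPC.Hom.map q z))) w
    have o' := congrArg (fun q => RPC.Hom.map q (RPC.Hom.map x.obj.right.div.lengths.fiberProj
      (RPC.Hom.map x.obj.hom z))) o
    exact w'.trans o')
  map_id _ := rfl
  map_comp _ _ := rfl

/-- The morphism over the structure map to `σ` from the stabilization of the curve of an object of the
Jacobian cone space to `Γ`, given by `ρ`. -/
noncomputable def tautHom {P : ObjectProperty (QD g n)} {Γ : TropM g n} (x : Jac P Γ) :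
    (Phi P).obj ((jacToJ P Γ).obj x) ⟶ Γ where
  base := jacBase x
  graph := TropM.Hom.graph x.obj.right.incl ≫ x.obj.right.div.obj.hom
  len k := by
    let q := MGraph.Hom.map (TropM.Hom.graph x.obj.right.incl).hom k
    let y := MGraph.Hom.map x.obj.right.div.obj.hom.hom q
    have h := TropM.Hom.len x.obj.right.incl k
    have h1 : MGraph.Hom.map x.obj.right.div.iso.inv y = q :=
      congrArg (fun k => MGraph.Hom.map k q) x.obj.right.div.iso.hom_inv_id
    have h2 := (Metric.taut_stLen x.obj.right.div.lengths (x := y.1) y.2).trans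
      (congrArg (fun l : _ →+ ℤ => l.comp (RPC.Hom.map x.obj.right.div.lengths.fiberProj))
        (Metric.ext_nex _ y.2))
    have h3 : x.obj.right.div.lengths.len y = x.obj.right.curve.metric.len q :=
      congrArg x.obj.right.curve.metric.len h1
    refine Eq.trans ?_ (Metric.stLen_comap _ x.obj.hom x.property y.1).symm
    refine Eq.trans ?_ (congrArg (fun l : _ →+ ℤ => l.comp (RPC.Hom.map x.obj.hom)) h2).symm
    change _ = ((x.obj.right.div.lengths.len y).comp _).comp _
    rw [h3, ← h]
    rfl

/-- The modular morphism from `σ` to the stack of stable tropical curves given by `Γ/σ`: a functor over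
the category of cones that sends the identity of `σ` to `Γ`. On `u : τ → σ` it is the pullback
`u^* Γ`; it is unique up to a unique isomorphism. -/
structure ModularMorphism (Γ : TropM g n) where
  functor : Over Γ.base ⥤ TropM g n
  onBase : functor ⋙ TropM.toRPC g n ≅ Over.forget Γ.base
  atId : functor.obj (Over.mk (𝟙 Γ.base)) ≅ Γ
  atId_over : (TropM.toRPC g n).map atId.hom = onBase.hom.app (Over.mk (𝟙 Γ.base))

end Jac

end TropJac

/-!
The modular morphism of `Γ` is pullback of tropical curves: `u^* Γ` is obtained from `Γ` by
contracting the edges whose lengths pull back to zero. That the contracted graph is again a graph in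
the sense of `MGraph` amounts to the existence of a genus for every connected subgraph
(`MGraph.connected_exists_genus`, by counting the edges of a connected graph).

The fact that carries the rest is that every morphism of stable tropical curves is cartesian over the
category of cones (`TropM.exists_lift`). The reason is that the metric determines which edges a
morphism contracts, and a morphism of graphs that contracts at least the edges contracted by another
one factors through it (`MGraph.Hom.exists_desc`). Hence every map between the bases of two
curves over `Γ` that commutes with the maps to `σ` lifts to exactly one morphism over `Γ`, so that the
isomorphism in the square and all its compatibilities follow by comparing maps to `Γ`. Consequently the `2`-fiber product is the
category of tropical curves with divisor `C` with a map `Φ(C) → Γ`. Compare this category with the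
Jacobian cone space.

* Essential surjectivity: the map of cones `κ → σ` below `Φ(C) → Γ` factors through the smallest face
  `τ` that contains its image (`RPC.exists_dominant_isFace`). Over `τ` no edge is
  contracted any more, which gives `ρ` (`TropM.isIso_graph`), and the lengths of the edges of `C` at
  the exceptional vertices are the coordinates of a map from `κ` to the cone of `(G, D, ρ)` over `τ`
  (`Metric.fiberLift`); its image is in no proper face, as this holds for
  the image in `τ` and no edge of `C` has length zero.
* Fully faithfulness: a morphism of curves with divisors over `Γ` respects the faces below the two
  cones, since their relative interiors are met (`RPC.IsFace.exists_lift_of_dominant`), and it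
  respects the coordinates of the cones, since these are lengths of edges.

Finally, an object of the Jacobian cone space comes from a triple over the graph of `Γ` itself exactly
if its face `τ` is `σ`, and `τ` is the smallest face that contains the image of `κ`.
-/

open CategoryTheory

/-! ### Contraction of edges -/

namespace TropJac

namespace MGraph

variable {n g : ℕ} {G G' : MGraph n}

/-- A connected subgraph has a genus: it has an even number of half-edges, and a connected graph with
`k` vertices has at least `k - 1` edges. -/
theorem connected_exists_genus {Y : Set G.X} (hr : ∀ x ∈ Y, G.r x ∈ Y) (hi : ∀ x ∈ Y, G.i x ∈ Y)
    (hY : G.Connected Y) : ∃ h : ℕ, G.HasGenus Y h := by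
  classical
  have := Fintype.ofFinite G.X
  let V : Finset G.X := {x | x ∈ Y ∧ G.r x = x}
  let H : Finset G.X := {x | x ∈ Y ∧ G.i x ≠ x}
  have sum : ∑ᶠ x ∈ Y, G.weight x = 2 * ∑ x ∈ Y.toFinset, (G.h x : ℤ) - 2 * V.card + H.card := by
    have e : ∀ x, G.weight x =
        2 * (G.h x : ℤ) - 2 * (if G.r x = x then 1 else 0) + (if G.i x ≠ x then 1 else 0) := by
      intro x
      unfold weight
      by_cases h : G.r x = x
      · have : G.i x = x := by rw [← h, G.i_r]
        simp [h, this]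
      · simp [h, G.h_flag x h]
    rw [finsum_mem_eq_toFinset_sum, Finset.sum_congr rfl fun x _ => e x, Finset.sum_add_distrib,
      Finset.sum_sub_distrib, ← Finset.mul_sum, ← Finset.mul_sum, Finset.sum_boole,
      Finset.sum_boole]
    have e1 : Y.toFinset.filter (fun x => G.r x = x) = V := by ext x; simp [V]
    have e2 : Y.toFinset.filter (fun x => G.i x ≠ x) = H := by ext x; simp [H]
    rw [e1, e2]
  -- the involution pairs off the half-edges of `Y`
  have even : 2 ∣ H.card := by
    let s : Equiv.Perm H := Function.Involutive.toPerm
      (fun x => ⟨G.i x.1, by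
        have := (Finset.mem_filter.1 x.2).2
        exact Finset.mem_filter.2 ⟨Finset.mem_univ _, hi _ this.1, by
          rw [G.i_i]; exact this.2.symm⟩⟩)
      (fun x => Subtype.ext (G.i_i _))
    have h := Equiv.Perm.two_dvd_card_support (σ := s) (by
      ext x
      exact congrArg Subtype.val (Subtype.ext (G.i_i x.1) : s (s x) = x))
    have hs : s.support = Finset.univ := by
      ext x
      simp only [Equiv.Perm.mem_support, Finset.mem_univ, iff_true]
      exact fun e => (Finset.mem_filter.1 x.2).2.2 (congrArg Subtype.val e)
    rw [hs] at h
    simpa using h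
  -- the simple graph on the vertices of `Y` has at least `#V - 1` edges
  let S : SimpleGraph V :=
    { Adj := fun a b => a ≠ b ∧ ∃ x ∈ Y, G.r x = a.1 ∧ G.r (G.i x) = b.1
      symm := ⟨by
        rintro a b ⟨hab, x, hx, h1, h2⟩
        exact ⟨hab.symm, G.i x, hi x hx, h2, by rw [G.i_i]; exact h1⟩⟩
      loopless := ⟨fun a h => h.1 rfl⟩ }
  have mem : ∀ a : V, a.1 ∈ Y ∧ G.r a.1 = a.1 := fun a => (Finset.mem_filter.1 a.2).2
  have hS : S.Connected := by
    obtain ⟨⟨a, ha, ha'⟩, hc⟩ := hY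
    have : Nonempty V := ⟨⟨a, Finset.mem_filter.2 ⟨Finset.mem_univ _, ha, ha'⟩⟩⟩
    refine ⟨fun a b => ?_⟩
    have key : ∀ c, Relation.ReflTransGen
        (fun a b => ∃ x ∈ Y, G.r x = a ∧ G.r (G.i x) = b) a.1 c →
        ∀ hc : c ∈ V, S.Reachable a ⟨c, hc⟩ := by
      intro c hc
      induction hc with
      | refl => exact fun _ => .rfl
      | tail _ hs ih =>
        rename_i c d _
        intro hd
        obtain ⟨x, hx, h1, h2⟩ := hs
        have hcV : c ∈ V := Finset.mem_filter.2 ⟨Finset.mem_univ _, h1 ▸ hr x hx, by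
          rw [← h1, G.r_r]⟩
        by_cases hcd : c = d
        · subst hcd; exact ih hd
        · refine (ih hcV).trans (SimpleGraph.Adj.reachable ?_)
          exact ⟨fun e => hcd (congrArg Subtype.val e), x, hx, h1, h2⟩
    exact key _ (hc _ (mem a).1 _ (mem b).1 (mem a).2 (mem b).2) b.2
  have hcard := hS.card_vert_le_card_edgeSet_add_one
  have hdart := S.dart_card_eq_twice_card_edges
  have hle : Fintype.card S.Dart ≤ H.card := by
    have ex : ∀ d : S.Dart, ∃ x ∈ Y, G.r x = d.fst.1 ∧ G.r (G.i x) = d.snd.1 := fun d => d.adj.2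
    choose f hf using ex
    have : Function.Injective fun d : S.Dart => (⟨f d, Finset.mem_filter.2
        ⟨Finset.mem_univ _, (hf d).1, fun e => d.adj.1 (Subtype.ext (by
          rw [← (hf d).2.1, ← (hf d).2.2, e]))⟩⟩ : H) := by
      intro d d' e
      have e' : f d = f d' := congrArg Subtype.val e
      refine SimpleGraph.Dart.ext _ _ (Prod.ext (Subtype.ext ?_) (Subtype.ext ?_))
      · exact (hf d).2.1.symm.trans ((congrArg G.r e').trans (hf d').2.1)
      · exact (hf d).2.2.symm.trans ((congrArg (fun x => G.r (G.i x)) e').trans (hf d').2.2)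
    simpa using Fintype.card_le_of_injective _ this
  have hE : Nat.card S.edgeSet = S.edgeFinset.card := by
    rw [Nat.card_eq_fintype_card, SimpleGraph.edgeFinset_card]
  rw [hE, Nat.card_eq_fintype_card, Fintype.card_coe] at hcard
  obtain ⟨k, hk⟩ := even
  refine ⟨(∑ x ∈ Y.toFinset, G.h x) + (k + 1 - V.card), ?_⟩
  rw [HasGenus, sum]
  push_cast
  rw [Nat.cast_sub (by omega), hk]
  push_cast
  ring

/-- A morphism of graphs preserves stability. -/
theorem Hom.isStable (f : Hom G G') (hG : G.IsStable g) : G'.IsStable g := by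
  refine ⟨?_, ?_, fun v hv => ?_⟩
  · obtain ⟨⟨a, _, ha⟩, hc⟩ := hG.conn
    refine ⟨⟨f.map a, trivial, by rw [← f.map_r, ha]⟩, fun b _ c _ hb hc' => ?_⟩
    obtain ⟨b, rfl⟩ := f.surj b
    obtain ⟨c, rfl⟩ := f.surj c
    have := Relation.ReflTransGen.lift (p := fun a b => ∃ x ∈ Set.univ, G'.r x = a ∧
      G'.r (G'.i x) = b) f.map (by
        rintro s t ⟨x, hx, rfl, rfl⟩
        exact ⟨f.map x, trivial, (f.map_r _).symm, by rw [f.map_r, f.map_i]⟩) _ _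
      (hc (G.r b) trivial (G.r c) trivial (G.r_r _) (G.r_r _))
    rwa [Function.onFun, f.map_r, f.map_r, hb, hc'] at this
  · rw [← f.hasGenus_preimage]
    exact hG.genus
  · have pos : ∀ u, G.r u = u → 0 < G.defect u := fun u hu => by
      rw [defect_vertex hu]; exact hG.pos u hu
    rw [← defect_vertex hv, ← f.push_defect, finsum_mem_eq_finite_toFinset_sum _ (Set.toFinite _)]
    obtain ⟨a, ha, ha'⟩ := (f.conn v hv).1
    refine Finset.sum_pos' (fun u _ => ?_) ⟨a, by simpa using ha, pos a ha'⟩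
    by_cases hu : G.r u = u
    · exact (pos u hu).le
    · rw [defect_flag hu]

/-- A set of half-edges that contains with a half-edge also its conjugate, that is, a set of
edges. -/
structure EdgeSet (G : MGraph n) where
  carrier : Set G.X
  i_mem : ∀ x ∈ carrier, G.i x ∈ carrier
  i_ne : ∀ x ∈ carrier, G.i x ≠ x

namespace EdgeSet

variable (F : EdgeSet G)

/-- The relation that generates the identifications made by contracting the edges in `F`. -/
def Rel (x y : G.X) : Prop := x ∈ F.carrier ∧ (y = G.r x ∨ y = G.i x)

theorem mk_r {x : G.X} (h : x ∈ F.carrier) : Quot.mk F.Rel (G.r x) = Quot.mk F.Rel x :=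
  (Quot.sound ⟨h, Or.inl rfl⟩).symm

theorem mk_i {x : G.X} (h : x ∈ F.carrier) : Quot.mk F.Rel (G.i x) = Quot.mk F.Rel x :=
  (Quot.sound ⟨h, Or.inr rfl⟩).symm

/-- Only vertices and contracted half-edges are identified with other elements. -/
theorem eq_or_of_mk_eq {x y : G.X} (h : Quot.mk F.Rel x = Quot.mk F.Rel y) :
    x = y ∨ ((x ∈ F.carrier ∨ G.r x = x) ∧ (y ∈ F.carrier ∨ G.r y = y)) := by
  have := Quot.eqvGen_exact h
  clear h
  induction this with
  | rel x y h =>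
    refine Or.inr ⟨Or.inl h.1, ?_⟩
    rcases h.2 with rfl | rfl
    · exact Or.inr (G.r_r _)
    · exact Or.inl (F.i_mem _ h.1)
  | refl => exact Or.inl rfl
  | symm x y _ ih => tauto
  | trans x y z _ _ h1 h2 =>
    rcases h1 with rfl | h1
    · exact h2
    · rcases h2 with rfl | h2
      · exact Or.inr h1
      · exact Or.inr ⟨h1.1, h2.2⟩

/-- The root map of the contraction. -/
def rootMap : Quot F.Rel → Quot F.Rel :=
  Quot.lift (fun x => Quot.mk F.Rel (G.r x)) (by
    rintro x y ⟨h, rfl | rfl⟩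
    · rw [G.r_r]
    · rw [F.mk_r h, F.mk_r (F.i_mem x h), F.mk_i h])

/-- The involution of the contraction. -/
def involution : Quot F.Rel → Quot F.Rel :=
  Quot.lift (fun x => Quot.mk F.Rel (G.i x)) (by
    rintro x y ⟨h, rfl | rfl⟩
    · rw [G.i_r, F.mk_r h, F.mk_i h]
    · rw [G.i_i, F.mk_i h])

theorem rootMap_mk (x : G.X) : F.rootMap (Quot.mk _ x) = Quot.mk _ (G.r x) := rfl

theorem involution_mk (x : G.X) : F.involution (Quot.mk _ x) = Quot.mk _ (G.i x) := rfl

/-- The vertices of the contraction are the classes of the vertices and of the contracted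
half-edges. -/
theorem rootMap_eq_iff (x : G.X) :
    F.rootMap (Quot.mk _ x) = Quot.mk _ x ↔ (x ∈ F.carrier ∨ G.r x = x) := by
  rw [rootMap_mk]
  refine ⟨fun h => ?_, fun h => ?_⟩
  · rcases F.eq_or_of_mk_eq h with h | h
    · exact Or.inr h
    · exact h.2
  · rcases h with h | h
    · exact F.mk_r h
    · rw [h]

theorem involution_eq_iff (x : G.X) :
    F.involution (Quot.mk _ x) = Quot.mk _ x ↔ (x ∈ F.carrier ∨ G.i x = x) := by
  rw [involution_mk]
  refine ⟨fun h => ?_, fun h => ?_⟩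
  · rcases F.eq_or_of_mk_eq h with h | h
    · exact Or.inr h
    · exact h.2.imp_right fun h => by rw [← h, G.i_r]
  · rcases h with h | h
    · exact F.mk_i h
    · rw [h]

theorem eq_of_mk_eq {x y : G.X} (h : Quot.mk F.Rel x = Quot.mk F.Rel y)
    (hy : F.rootMap (Quot.mk _ y) ≠ Quot.mk _ y) : x = y :=
  (F.eq_or_of_mk_eq h).resolve_right fun h' => hy ((F.rootMap_eq_iff y).2 h'.2)

/-- The preimage of a vertex of the contraction is connected, by paths of contracted half-edges. -/
theorem connected_class {q : Quot F.Rel} (hq : F.rootMap q = q) :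
    G.Connected (Quot.mk F.Rel ⁻¹' {q}) := by
  have key : ∀ x y, Relation.EqvGen F.Rel x y → Relation.ReflTransGen
      (fun a b => ∃ z, (z ∈ F.carrier ∧ Quot.mk F.Rel z = Quot.mk F.Rel x) ∧
        G.r z = a ∧ G.r (G.i z) = b)
      (G.r x) (G.r y) := by
    intro x y h
    induction h with
    | rel x y h =>
      rcases h.2 with rfl | rfl
      · rw [G.r_r]
      · exact .single ⟨x, ⟨h.1, rfl⟩, rfl, rfl⟩
    | refl => exact .refl
    | symm x y h ih =>
      have e : Quot.mk F.Rel x = Quot.mk F.Rel y := Quot.eqvGen_sound h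
      rw [e] at ih
      have : Std.Symm fun a b => ∃ z, (z ∈ F.carrier ∧ Quot.mk F.Rel z = Quot.mk F.Rel y) ∧
          G.r z = a ∧ G.r (G.i z) = b := ⟨by
        rintro a b ⟨z, hz, h1, h2⟩
        exact ⟨G.i z, ⟨F.i_mem z hz.1, (F.mk_i hz.1).trans hz.2⟩, h2, by rw [G.i_i]; exact h1⟩⟩
      exact Relation.ReflTransGen.stdSymm.symm _ _ ih
    | trans x y z h1 h2 ih1 ih2 =>
      have e : Quot.mk F.Rel x = Quot.mk F.Rel y := Quot.eqvGen_sound h1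
      rw [← e] at ih2
      exact ih1.trans ih2
  obtain ⟨x, rfl⟩ := Quot.exists_rep q
  refine ⟨⟨G.r x, hq, G.r_r x⟩, fun a ha b hb ha' hb' => ?_⟩
  have e : Quot.mk F.Rel a = Quot.mk F.Rel b :=
    (show Quot.mk F.Rel a = Quot.mk F.Rel x from ha).trans
      (show Quot.mk F.Rel b = Quot.mk F.Rel x from hb).symm
  have := key a b (Quot.eqvGen_exact e)
  rw [ha', hb', show Quot.mk F.Rel a = Quot.mk F.Rel x from ha] at this
  exact Relation.ReflTransGen.mono (fun _ _ ⟨z, hz, h⟩ => ⟨z, hz.2, h⟩) _ _ this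

theorem exists_genus {q : Quot F.Rel} (hq : F.rootMap q = q) :
    ∃ h : ℕ, G.HasGenus (Quot.mk F.Rel ⁻¹' {q}) h := by
  refine connected_exists_genus (fun x hx => ?_) (fun x hx => ?_) (F.connected_class hq)
  all_goals
    obtain rfl : Quot.mk F.Rel x = q := hx
  · exact hq
  · rcases (F.rootMap_eq_iff x).1 hq with h | h
    · exact F.mk_i h
    · rw [← h, G.i_r]; rfl

open Classical in
/-- The graph obtained by contracting the edges in `F`. The genus of a vertex is the genus of its
preimage. -/
noncomputable def contract : MGraph n where
  X := Quot F.Rel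
  r := F.rootMap
  i := F.involution
  r_r := by rintro ⟨x⟩; exact congrArg (Quot.mk _) (G.r_r x)
  i_i := by rintro ⟨x⟩; exact congrArg (Quot.mk _) (G.i_i x)
  i_r := by rintro ⟨x⟩; exact congrArg (Quot.mk _) (G.i_r x)
  h q := if F.rootMap q = q then Classical.epsilon fun h : ℕ =>
    G.HasGenus (Quot.mk F.Rel ⁻¹' {q}) h else 0
  h_flag q hq := if_neg hq
  m k := Quot.mk _ (G.m k)
  m_inj k l h := by
    have hl := (G.m_range (G.m l)).1 ⟨l, rfl⟩
    refine G.m_inj (F.eq_of_mk_eq h fun e => ?_)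
    rcases (F.rootMap_eq_iff _).1 e with e | e
    · exact F.i_ne _ e hl.2
    · exact hl.1 e
  m_range := by
    rintro ⟨x⟩
    constructor
    · rintro ⟨k, hk⟩
      have hl := (G.m_range (G.m k)).1 ⟨k, rfl⟩
      rw [← hk, ne_eq, F.rootMap_eq_iff, F.involution_eq_iff]
      exact ⟨fun h => h.elim (fun e => F.i_ne _ e hl.2) hl.1, Or.inr hl.2⟩
    · rintro ⟨h1, h2⟩
      have h1 := fun h => h1 ((F.rootMap_eq_iff x).2 h)
      have h2 := (F.involution_eq_iff x).1 h2
      obtain ⟨k, hk⟩ := (G.m_range x).2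
        ⟨fun e => h1 (Or.inr e), h2.resolve_left fun e => h1 (Or.inl e)⟩
      exact ⟨k, by rw [hk]⟩

/-- The contraction of the edges in `F`, as a morphism of graphs. -/
noncomputable def proj : Hom G F.contract where
  map := Quot.mk F.Rel
  map_r _ := rfl
  map_i _ := rfl
  map_flag := by
    rintro ⟨y⟩ hy
    exact ⟨y, rfl, fun z hz => F.eq_of_mk_eq hz hy⟩
  map_m _ := rfl
  conn _ hq := F.connected_class hq
  genus q hq := by
    have h := Classical.epsilon_spec (F.exists_genus hq)
    exact Eq.mp (congrArg _ (if_pos hq).symm) h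

end EdgeSet
/-- A morphism that contracts all the half-edges contracted by `q` factors through `q`. -/
theorem Hom.exists_desc {G'' : MGraph n} (q : Hom G G') (f : Hom G G'')
    (H : ∀ x, G.i x ≠ x → G'.r (q.map x) = q.map x → G''.r (f.map x) = f.map x) :
    ∃ p : Hom G' G'', q.comp p = f := by
  -- `f` identifies every element that `q` sends to a vertex with its root
  have hr : ∀ z, G'.r (q.map z) = q.map z → f.map (G.r z) = f.map z := by
    intro z hz
    by_cases h : G.r z = z
    · rw [h]
    · have hi : G.i z ≠ z := by
        intro hi
        obtain ⟨k, rfl⟩ := (G.m_range z).2 ⟨h, hi⟩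
        rw [q.map_m] at hz
        exact ((G'.m_range (G'.m k)).1 ⟨k, rfl⟩).1 hz
      rw [f.map_r, H z hi hz]
  have hv : ∀ z, G'.r (q.map z) = q.map z → G''.r (f.map z) = f.map z := fun z hz => by
    rw [← f.map_r, hr z hz]
  have key : ∀ x y, q.map x = q.map y → f.map x = f.map y := by
    intro x y hxy
    by_cases hx : G'.r (q.map x) = q.map x
    · have hy : G'.r (q.map y) = q.map y := hxy ▸ hx
      rw [← hr x hx, ← hr y hy]
      have := (q.conn _ hx).2 (G.r x) ((q.map_r x).trans hx) (G.r y)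
        ((q.map_r y).trans (hy.trans hxy.symm)) (G.r_r x) (G.r_r y)
      generalize G.r y = b at this
      induction this with
      | refl => rfl
      | tail _ hs ih =>
        obtain ⟨z, hz, h1, h2⟩ := hs
        have hzv : G'.r (q.map z) = q.map z := by
          rw [show q.map z = q.map x from hz]; exact hx
        have hiz : q.map (G.i z) = q.map z := by
          rw [q.map_i, ← hzv, G'.i_r]
        rw [ih, ← h1, ← h2, hr z hzv, hr (G.i z) (by rw [hiz, hzv]), f.map_i, ← hv z hzv, G''.i_r]
    · rw [(q.map_flag _ hx).unique rfl hxy.symm]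
  choose s hs using q.surj
  exact ⟨q.desc f (fun y => f.map (s y)) fun x => key _ _ (hs _), Hom.ext (funext fun x =>
    key _ _ (hs _))⟩

end MGraph
end TropJac

/-! ### Stable tropical curves are fibered over cones -/

namespace TropJac

namespace TropM

variable {g n : ℕ} {Γ Γ₁ Γ₂ : TropM g n}

/-- A half-edge is contracted by a morphism of tropical curves if and only if its length pulls back
to zero. -/
theorem Hom.contracts_iff (f : Γ₁ ⟶ Γ) {x : Γ.graph.obj.X} (hx : Γ.graph.obj.i x ≠ x) :
    Γ₁.graph.obj.r ((Hom.graph f).hom.map x) = (Hom.graph f).hom.map x ↔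
      (Γ.metric.len x).comp (RPC.Hom.map (Hom.base f)) = 0 := by
  rw [Hom.len f, Γ₁.metric.zero_iff]
  refine ⟨fun h => by rw [← h, MGraph.i_r], fun h => ?_⟩
  by_contra h'
  exact hx (((Hom.graph f).hom.i_iff h').1 h)

instance graph_epi (f : Γ₁ ⟶ Γ) : Epi (Hom.graph f) where
  left_cancellation p p' h := by
    refine ObjectProperty.hom_ext _ (MGraph.hom_ext fun y => ?_)
    obtain ⟨x, rfl⟩ := (Hom.graph f).hom.surj y
    exact congrArg (fun k => MGraph.Hom.map k.hom x) h

/-- A morphism over `Γ` is determined by its map of cones. -/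
theorem hom_eq_of_comp_eq {f : Γ₂ ⟶ Γ} {h h' : Γ₁ ⟶ Γ₂} (hb : Hom.base h = Hom.base h')
    (e : h ≫ f = h' ≫ f) : h = h' :=
  hom_ext hb ((cancel_epi (Hom.graph f)).1 (congrArg Hom.graph e))

/-- Every morphism of stable tropical curves is cartesian over the category of cones: `f₁` contracts
all the edges contracted by `f₂`, as their lengths already vanish on the base of `f₂`. -/
theorem exists_lift (f₁ : Γ₁ ⟶ Γ) (f₂ : Γ₂ ⟶ Γ) (b : Γ₁.base ⟶ Γ₂.base)
    (hb : b ≫ Hom.base f₂ = Hom.base f₁) : ∃ h : Γ₁ ⟶ Γ₂, Hom.base h = b ∧ h ≫ f₂ = f₁ := by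
  obtain ⟨p, hp⟩ := (Hom.graph f₂).hom.exists_desc (Hom.graph f₁).hom fun x hx h => by
    rw [Hom.contracts_iff f₁ hx, ← hb]
    have := (Hom.contracts_iff f₂ hx).1 h
    ext z
    exact DFunLike.congr_fun this (RPC.Hom.map b z)
  have hp' : ∀ x, p.map ((Hom.graph f₂).hom.map x) = (Hom.graph f₁).hom.map x := fun x =>
    congrArg (fun k => MGraph.Hom.map k x) hp
  refine ⟨⟨b, ObjectProperty.homMk p, fun y => ?_⟩, rfl, hom_ext hb ?_⟩
  · obtain ⟨x, rfl⟩ := (Hom.graph f₂).hom.surj y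
    change _ = Γ₁.metric.len (p.map _)
    rw [hp', ← Hom.len f₁, ← Hom.len f₂, ← hb]
    rfl
  · exact ObjectProperty.hom_ext _ hp

/-- The lift of `b` to a morphism over `Γ`. -/
noncomputable def lift (f₁ : Γ₁ ⟶ Γ) (f₂ : Γ₂ ⟶ Γ) (b : Γ₁.base ⟶ Γ₂.base)
    (hb : b ≫ Hom.base f₂ = Hom.base f₁) : Γ₁ ⟶ Γ₂ :=
  (exists_lift f₁ f₂ b hb).choose

section lift

variable (f₁ : Γ₁ ⟶ Γ) (f₂ : Γ₂ ⟶ Γ) (b : Γ₁.base ⟶ Γ₂.base) (hb : b ≫ Hom.base f₂ = Hom.base f₁)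

@[simp] theorem lift_base : Hom.base (lift f₁ f₂ b hb) = b :=
  (exists_lift f₁ f₂ b hb).choose_spec.1

@[simp] theorem lift_comp : lift f₁ f₂ b hb ≫ f₂ = f₁ :=
  (exists_lift f₁ f₂ b hb).choose_spec.2

end lift

@[simp] theorem id_base (Γ : TropM g n) : Hom.base (𝟙 Γ) = 𝟙 Γ.base := rfl

@[simp] theorem comp_base (f : Γ₁ ⟶ Γ₂) (f' : Γ₂ ⟶ Γ) :
    Hom.base (f ≫ f') = Hom.base f ≫ Hom.base f' := rfl

@[simp] theorem comp_graph (f : Γ₁ ⟶ Γ₂) (f' : Γ₂ ⟶ Γ) :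
    Hom.graph (f ≫ f') = Hom.graph f' ≫ Hom.graph f := rfl

/-- The lift of an isomorphism of cones to an isomorphism over `Γ`. -/
noncomputable def liftIso (f₁ : Γ₁ ⟶ Γ) (f₂ : Γ₂ ⟶ Γ) (b : Γ₁.base ≅ Γ₂.base)
    (hb : b.hom ≫ Hom.base f₂ = Hom.base f₁) : Γ₁ ≅ Γ₂ where
  hom := lift f₁ f₂ b.hom hb
  inv := lift f₂ f₁ b.inv (by rw [← hb, b.inv_hom_id_assoc])
  hom_inv_id := hom_eq_of_comp_eq (f := f₁) (by simp) (by simp)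
  inv_hom_id := hom_eq_of_comp_eq (f := f₂) (by simp) (by simp)

theorem isIso_of_base (f : Γ₁ ⟶ Γ₂) [IsIso (Hom.base f)] : IsIso f := by
  let e := liftIso f (𝟙 Γ₂) (asIso (Hom.base f)) (Category.comp_id _)
  have h : e.hom = f := (Category.comp_id e.hom).symm.trans
    (lift_comp f (𝟙 Γ₂) (Hom.base f) (Category.comp_id _))
  rw [← h]
  infer_instance

/-- A morphism over a map of cones whose image lies in no proper face contracts no edge. -/
theorem isIso_graph (f : Γ₁ ⟶ Γ₂) (hf : RPC.Dominant (Hom.base f)) : IsIso (Hom.graph f) := by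
  -- `Γ₁` is isomorphic to the curve `Γ'` with the graph of `Γ₂` and the pulled back metric
  let Γ' : TropM g n := ⟨Γ₁.base, Γ₂.graph, Γ₂.metric.comap (Hom.base f) hf⟩
  let c : Γ' ⟶ Γ₂ := Hom.mk (Γ := Γ') (Γ' := Γ₂) (Hom.base (Γ := Γ₁) f) (𝟙 Γ₂.graph) fun _ => rfl
  let e := liftIso f c (Iso.refl _) (Category.id_comp _)
  have h : e.hom ≫ c = f := lift_comp f c (𝟙 _) (Category.id_comp _)
  rw [← h]
  have : IsIso (Hom.graph e.hom) := ⟨Hom.graph e.inv, congrArg Hom.graph e.inv_hom_id,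
    congrArg Hom.graph e.hom_inv_id⟩
  have e2 : Hom.graph (e.hom ≫ c) = Hom.graph e.hom := Category.id_comp (Hom.graph e.hom)
  rw [e2]
  exact this

/-- The edges whose lengths pull back to zero. -/
def vanishing (Γ : TropM g n) {τ : RPC} (u : τ ⟶ Γ.base) : MGraph.EdgeSet Γ.graph.obj where
  carrier := {x | Γ.graph.obj.i x ≠ x ∧ (Γ.metric.len x).comp (RPC.Hom.map u) = 0}
  i_mem x hx := ⟨by rw [MGraph.i_i]; exact hx.1.symm, by rw [Γ.metric.symm]; exact hx.2⟩
  i_ne _ hx := hx.1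

/-- The pullback of a stable tropical curve along a map of cones: the edges whose lengths pull back
to zero are contracted. -/
noncomputable def pullback (Γ : TropM g n) {τ : RPC} (u : τ ⟶ Γ.base) : TropM g n where
  base := τ
  graph := ⟨(Γ.vanishing u).contract, (Γ.vanishing u).proj.isStable Γ.graph.property⟩
  metric :=
    { len := Quot.lift (fun x => (Γ.metric.len x).comp (RPC.Hom.map u)) (by
        rintro x y ⟨h, rfl | rfl⟩
        · rw [Γ.metric.vertex (x := Γ.graph.obj.r x) (Γ.graph.obj.r_r x), h.2,
            AddMonoidHom.zero_comp]
        · rw [Γ.metric.symm])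
      mem := by
        rintro ⟨x⟩
        exact RPC.dual_comp u (Γ.metric.mem x)
      symm := by
        rintro ⟨x⟩
        exact congrArg (fun l : _ →+ ℤ => l.comp (RPC.Hom.map u)) (Γ.metric.symm x)
      zero_iff := by
        rintro ⟨x⟩
        refine Iff.trans ?_ ((Γ.vanishing u).involution_eq_iff x).symm
        change (Γ.metric.len x).comp (RPC.Hom.map u) = 0 ↔ (_ ∧ _) ∨ _
        have := Γ.metric.zero_iff x
        by_cases hx : Γ.graph.obj.i x = x
        · simp [hx, this.2 hx]
        · simp [hx] }

/-- The projection from the pullback. -/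
noncomputable def pullbackHom (Γ : TropM g n) {τ : RPC} (u : τ ⟶ Γ.base) : Γ.pullback u ⟶ Γ where
  base := u
  graph := ObjectProperty.homMk (Γ.vanishing u).proj
  len _ := rfl

/-- The map between pullbacks that is induced by a morphism of cones over the base. -/
noncomputable def pullbackMap (Γ : TropM g n) {u v : Over Γ.base} (f : u ⟶ v) :
    Γ.pullback u.hom ⟶ Γ.pullback v.hom :=
  lift (Γ.pullbackHom u.hom) (Γ.pullbackHom v.hom) f.left (Over.w f)

theorem pullbackMap_base (Γ : TropM g n) {u v : Over Γ.base} (f : u ⟶ v) :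
    Hom.base (Γ.pullbackMap f) = f.left := lift_base _ _ _ _

theorem pullbackMap_comp (Γ : TropM g n) {u v : Over Γ.base} (f : u ⟶ v) :
    Γ.pullbackMap f ≫ Γ.pullbackHom v.hom = Γ.pullbackHom u.hom := lift_comp _ _ _ _

end TropM

variable {g n : ℕ}

/-- The modular morphism given by pullbacks. -/
noncomputable def ModularMorphism.ofPullback (Γ : TropM g n) :
    ModularMorphism Γ where
  functor :=
    { obj := fun u => Γ.pullback u.hom
      map := Γ.pullbackMap
      map_id := fun u => TropM.hom_eq_of_comp_eq (f := Γ.pullbackHom u.hom)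
        (Γ.pullbackMap_base _) ((Γ.pullbackMap_comp _).trans (Category.id_comp _).symm)
      map_comp := fun {u v w} f f' => by
        refine TropM.hom_eq_of_comp_eq (f := Γ.pullbackHom w.hom) ?_ ?_
        · exact (Γ.pullbackMap_base _).trans (congrArg₂ (fun a b => a ≫ b)
            (Γ.pullbackMap_base f).symm (Γ.pullbackMap_base f').symm)
        · rw [Category.assoc, Γ.pullbackMap_comp, Γ.pullbackMap_comp, Γ.pullbackMap_comp] }
  onBase := NatIso.ofComponents (fun u => Iso.refl _) (fun f =>
    (Category.comp_id _).trans ((Γ.pullbackMap_base f).trans (Category.id_comp _).symm))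
  atId := TropM.liftIso (Γ.pullbackHom _) (𝟙 Γ) (Iso.refl _) rfl
  atId_over := TropM.lift_base _ _ _ _

end TropJac

/-! ### Faces of cones and maps to the cones of quasi-stable graphs -/

namespace TropJac

namespace RPC

variable {σ τ κ : RPC}

theorem Dominant.comp {f : σ ⟶ τ} {f' : τ ⟶ κ} (hf : Dominant f) (hf' : Dominant f') :
    Dominant (f ≫ f') := fun ℓ hℓ h => by
  have := hf _ (dual_comp f' hℓ) h
  exact hf' ℓ hℓ fun x _ => DFunLike.congr_fun this x

theorem Dominant.of_comp {f : σ ⟶ τ} {f' : τ ⟶ κ} (h : Dominant (f ≫ f')) : Dominant f' :=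
  fun ℓ hℓ h' => h ℓ hℓ fun x hx => h' _ (f.map_pts x hx)

theorem dominant_of_isIso (f : σ ⟶ τ) [IsIso f] : Dominant f := fun ℓ _ h =>
  eq_zero_of_pts fun y hy => by
    have := h _ (Hom.map_pts (inv f) y hy)
    rwa [← comp_map, IsIso.inv_hom_id, id_map] at this

/-- To see that the image of a cone lies in no proper face, it suffices to test the functionals that
cut out the target. -/
theorem dominant_of_generators (f : κ ⟶ σ) {s : Set (σ.N →+ ℤ)} (hs : s.Finite)
    (hσ : ∀ x, x ∈ σ.pts ↔ ∀ k ∈ s, 0 ≤ k x) (H : ∀ k ∈ s, k.comp (Hom.map f) = 0 → k = 0) :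
    Dominant f := by
  obtain ⟨p, hp, hpos⟩ := exists_interior (σ := κ) ((fun k => k.comp (Hom.map f)) '' s)
    (hs.image _) (by
      rintro _ ⟨k, hk, rfl⟩
      exact dual_comp f fun x hx => (hσ x).1 hx k hk)
  intro ℓ hℓ h
  refine eq_zero_of_pts fun y hy => ?_
  -- a large multiple of the interior point `f p` dominates `y`
  obtain ⟨K, hK⟩ : ∃ K : ℕ, ∀ k ∈ s, k y ≤ K := by
    obtain ⟨a, ha⟩ := (hs.image fun k => k y).bddAbove
    exact ⟨a.toNat, fun k hk => (ha ⟨k, hk, rfl⟩).trans (Int.self_le_toNat a)⟩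
  have hm : K • Hom.map f p - y ∈ σ.pts := by
    rw [hσ]
    intro k hk
    by_cases h0 : k = 0
    · simp [h0]
    · have h1 : 0 < k (Hom.map f p) := hpos _ ⟨k, hk, rfl⟩ fun e => h0 (H k hk e)
      have h2 := hK k hk
      rw [map_sub, map_nsmul, nsmul_eq_mul]
      nlinarith
  have h1 := hℓ _ hm
  rw [map_sub, map_nsmul, h p hp, smul_zero] at h1
  have h2 := hℓ y hy
  omega

theorem IsFace.mono {j : τ ⟶ σ} (hj : IsFace j) : Mono j where
  right_cancellation _ _ h := hom_ext fun x => hj.1 (congrArg (fun k => Hom.map k x) h)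

/-- A map of cones that sends the lattice points into a face factors through the face. -/
theorem IsFace.exists_lift {j : τ ⟶ σ} (hj : IsFace j) (k : κ ⟶ σ)
    (h : ∀ x ∈ κ.pts, ∃ y ∈ τ.pts, Hom.map j y = Hom.map k x) : ∃ b : κ ⟶ τ, b ≫ j = k := by
  have hr : ∀ x, Hom.map k x ∈ (Hom.map j).range := by
    intro x
    obtain ⟨p, hp, q, hq, rfl⟩ := κ.full x
    rw [map_sub]
    obtain ⟨p', _, hp'⟩ := h p hp
    obtain ⟨q', _, hq'⟩ := h q hq
    exact ⟨p' - q', by rw [map_sub, hp', hq']⟩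
  let e := AddMonoidHom.ofInjective hj.1
  let m : κ.N →+ τ.N := e.symm.toAddMonoidHom.comp ((Hom.map k).codRestrict _ hr)
  have hm : ∀ x, Hom.map j (m x) = Hom.map k x := fun x =>
    congrArg Subtype.val (e.apply_symm_apply ⟨Hom.map k x, hr x⟩)
  refine ⟨⟨m, fun x hx => ?_⟩, hom_ext hm⟩
  obtain ⟨y, hy, e⟩ := h x hx
  rwa [hj.1 ((hm x).trans e.symm)]

/-- If the image in `σ` of the relative interior of a cone `τ` over `σ` meets a face of `σ`, then `τ`
maps to that face. -/
theorem IsFace.exists_lift_of_dominant {τ' : RPC} {j : τ' ⟶ σ} (hj : IsFace j) {k : τ ⟶ σ}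
    {a : κ ⟶ τ} (ha : Dominant a) {a' : κ ⟶ τ'} (e : a' ≫ j = a ≫ k) :
    ∃ b : τ ⟶ τ', b ≫ j = k := by
  obtain ⟨ℓ, hℓ, hz⟩ := hj.2
  refine hj.exists_lift k fun x hx => (hz _ (k.map_pts x hx)).1 ?_
  have : ℓ.comp (Hom.map k) = 0 := ha _ (dual_comp k hℓ) fun y hy => by
    have h := congrArg (fun q => Hom.map q y) e
    change ℓ (Hom.map (a ≫ k) y) = 0
    rw [← e]
    exact (hz _ (Hom.map_pts _ y hy)).2 ⟨_, a'.map_pts y hy, rfl⟩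
  exact DFunLike.congr_fun this x

theorem IsFace.isIso_of_dominant {j : τ ⟶ σ} (hj : IsFace j) (h : Dominant j) : IsIso j := by
  obtain ⟨b, hb⟩ := hj.exists_lift_of_dominant h (k := 𝟙 σ) (a' := 𝟙 τ) (by simp)
  have := hj.mono
  exact ⟨b, by rw [← cancel_mono j, Category.assoc, hb]; simp, hb⟩

/-- The sublattice spanned by the lattice points on which the functionals `S` vanish. -/
def faceLattice (σ : RPC) (S : Set (σ.N →+ ℤ)) : Submodule ℤ σ.N :=
  Submodule.span ℤ {y | y ∈ σ.pts ∧ ∀ k ∈ S, k y = 0}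

theorem faceLattice_apply {S : Set (σ.N →+ ℤ)} {x : σ.N} (hx : x ∈ σ.faceLattice S)
    {k : σ.N →+ ℤ} (hk : k ∈ S) : k x = 0 := by
  have : σ.faceLattice S ≤ LinearMap.ker k.toIntLinearMap :=
    Submodule.span_le.2 fun y hy => hy.2 k hk
  exact this hx

/-- The cone cut out in `σ` by the vanishing of the functionals `S`. -/
noncomputable def faceCone (σ : RPC) (S : Set (σ.N →+ ℤ)) : RPC where
  N := σ.faceLattice S
  pts := σ.pts.comap (σ.faceLattice S).subtype.toAddMonoidHom
  polyhedral := by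
    obtain ⟨s, hs, h⟩ := σ.polyhedral
    refine ⟨(fun k => k.comp (σ.faceLattice S).subtype.toAddMonoidHom) '' s, hs.image _,
      fun x => ?_⟩
    refine (h _).trans ⟨?_, fun hx k hk => hx _ ⟨k, hk, rfl⟩⟩
    rintro hx _ ⟨k, hk, rfl⟩
    exact hx k hk
  pointed x hx hx' := Subtype.ext (σ.pointed _ hx hx')
  full x := by
    obtain ⟨x, hx⟩ := x
    suffices h : ∃ p q, (p ∈ σ.pts ∧ ∀ k ∈ S, k p = 0) ∧ (q ∈ σ.pts ∧ ∀ k ∈ S, k q = 0) ∧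
        x = p - q by
      obtain ⟨p, q, hp, hq, rfl⟩ := h
      exact ⟨⟨p, Submodule.subset_span hp⟩, hp.1, ⟨q, Submodule.subset_span hq⟩, hq.1, rfl⟩
    induction hx using Submodule.span_induction with
    | mem x hx =>
      exact ⟨x, 0, hx, ⟨σ.pts.zero_mem, by simp⟩, by simp⟩
    | zero => exact ⟨0, 0, ⟨σ.pts.zero_mem, by simp⟩, ⟨σ.pts.zero_mem, by simp⟩, by simp⟩
    | add x y _ _ hx hy =>
      obtain ⟨p, q, hp, hq, rfl⟩ := hx
      obtain ⟨p', q', hp', hq', rfl⟩ := hy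
      exact ⟨p + p', q + q', ⟨σ.pts.add_mem hp.1 hp'.1, fun k hk => by simp [hp.2 k hk, hp'.2 k hk]⟩,
        ⟨σ.pts.add_mem hq.1 hq'.1, fun k hk => by simp [hq.2 k hk, hq'.2 k hk]⟩, by abel⟩
    | smul c x _ hx =>
      obtain ⟨p, q, hp, hq, rfl⟩ := hx
      have hm : ∀ (m : ℕ) (p), (p ∈ σ.pts ∧ ∀ k ∈ S, k p = 0) →
          (m • p ∈ σ.pts ∧ ∀ k ∈ S, k (m • p) = 0) := fun m p hp =>
        ⟨σ.pts.nsmul_mem hp.1 m, fun k hk => by rw [map_nsmul, hp.2 k hk, smul_zero]⟩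
      obtain ⟨m, rfl | rfl⟩ := c.eq_nat_or_neg
      · exact ⟨m • p, m • q, hm m p hp, hm m q hq, by rw [natCast_zsmul, smul_sub]⟩
      · exact ⟨m • q, m • p, hm m q hq, hm m p hp, by
          rw [neg_smul, natCast_zsmul, smul_sub, neg_sub]⟩

/-- Every map of cones factors through the smallest face that contains its image. -/
theorem exists_dominant_isFace (f : κ ⟶ σ) :
    ∃ (τ : RPC) (b : κ ⟶ τ) (j : τ ⟶ σ), Dominant b ∧ IsFace j ∧ b ≫ j = f := by
  obtain ⟨s, hs, h⟩ := σ.polyhedral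
  have hsd : ∀ k ∈ s, k ∈ σ.dual := fun k hk x hx => (h x).1 hx k hk
  -- the defining inequalities of `σ` that are equalities on the image
  let S : Set (σ.N →+ ℤ) := {k | k ∈ s ∧ k.comp (Hom.map f) = 0}
  have hS : S.Finite := hs.subset fun k hk => hk.1
  have hfS : ∀ x, Hom.map f x ∈ σ.faceLattice S := by
    have hp : ∀ p ∈ κ.pts, Hom.map f p ∈ σ.faceLattice S := fun p hp =>
      Submodule.subset_span ⟨f.map_pts p hp, fun k hk => DFunLike.congr_fun hk.2 p⟩
    intro x
    obtain ⟨p, hp', q, hq', rfl⟩ := κ.full x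
    rw [map_sub]
    exact Submodule.sub_mem _ (hp p hp') (hp q hq')
  let j : σ.faceCone S ⟶ σ := ⟨(σ.faceLattice S).subtype.toAddMonoidHom, fun _ hx => hx⟩
  let b : κ ⟶ σ.faceCone S := ⟨(Hom.map f).codRestrict (σ.faceLattice S) hfS, fun x hx =>
    f.map_pts x hx⟩
  refine ⟨σ.faceCone S, b, j, ?_, ⟨Subtype.val_injective, ∑ k ∈ hS.toFinset, k, ?_, fun y hy => ?_⟩,
    rfl⟩
  · refine dominant_of_generators b (hs.image fun k => k.comp (Hom.map j)) (fun x => ?_) ?_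
    · refine (h (Hom.map j x)).trans ⟨?_, fun hx k hk => hx _ ⟨k, hk, rfl⟩⟩
      rintro hx _ ⟨k, hk, rfl⟩
      exact hx k hk
    · rintro _ ⟨k, hk, rfl⟩ e
      ext x
      exact faceLattice_apply (S := S) x.2 ⟨hk, e⟩
  · exact σ.dual.sum_mem fun k hk => hsd k (hS.mem_toFinset.1 hk).1
  · rw [AddMonoidHom.finsetSum_apply, Finset.sum_eq_zero_iff_of_nonneg fun k hk =>
      hsd k (hS.mem_toFinset.1 hk).1 y hy]
    constructor
    · intro hk
      exact ⟨⟨y, Submodule.subset_span ⟨hy, fun k hk' => hk k (hS.mem_toFinset.2 hk')⟩⟩, hy, rfl⟩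
    · rintro ⟨x, _, rfl⟩ k hk
      exact faceLattice_apply x.2 (hS.mem_toFinset.1 hk)

end RPC

namespace Metric

variable {n g : ℕ} {G : MGraph n} {hG : G.IsQuasiStable g} {σ κ : RPC}

theorem dominant_fiberProj (ℓ : Metric (G.st hG) σ) : RPC.Dominant ℓ.fiberProj := by
  classical
  intro k _ h
  have h0 : k.comp (RPC.Hom.map ℓ.fiberProj) = 0 := RPC.eq_zero_of_pts h
  ext p
  have := DFunLike.congr_fun h0 (⟨_, ℓ.exists_fiber_interior p⟩ : ℓ.fiberLattice)
  replace this : k ((2 : ℤ) • p) = 0 := this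
  rw [map_zsmul, smul_eq_mul] at this
  change k p = 0
  omega

/-- A map to the cone of `G` is determined by the map to `σ` and by the lengths it gives to the edges
at the exceptional vertices. -/
theorem fiberCone_hom_ext {ℓ : Metric (G.st hG) σ} {f f' : κ ⟶ ℓ.fiberCone}
    (h : f ≫ ℓ.fiberProj = f' ≫ ℓ.fiberProj)
    (h' : ∀ x, G.IsExc (G.r x) → (ℓ.taut.len x).comp (RPC.Hom.map f) =
      (ℓ.taut.len x).comp (RPC.Hom.map f')) : f = f' := by
  refine RPC.hom_ext fun z => Subtype.ext (Prod.ext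
    (congrArg (fun k => RPC.Hom.map k z) h) (funext fun x => ?_))
  by_cases hx : G.IsExc (G.r x)
  · have := DFunLike.congr_fun (h' x hx) z
    exact (ℓ.tautLen_exc hx _).symm.trans (this.trans (ℓ.tautLen_exc hx _))
  · rw [(RPC.Hom.map f z).2.1 x fun e => hx e.1, (RPC.Hom.map f' z).2.1 x fun e => hx e.1]

/-- A map to the cone of `G` has image in no proper face if this holds for the map to `σ` and if it
gives positive lengths to the edges at the exceptional vertices. -/
theorem dominant_fiberCone {ℓ : Metric (G.st hG) σ} (f : κ ⟶ ℓ.fiberCone)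
    (h : RPC.Dominant (f ≫ ℓ.fiberProj))
    (h' : ∀ x, G.IsExc (G.r x) → G.r x ≠ x → (ℓ.taut.len x).comp (RPC.Hom.map f) ≠ 0) :
    RPC.Dominant f := by
  obtain ⟨s, hs, hσ⟩ := σ.polyhedral
  let B : G.X → (ℓ.fiberCone.N →+ ℤ) := fun x =>
    ((Pi.evalAddMonoidHom (fun _ : G.X => ℤ) x).comp (AddMonoidHom.snd σ.N (G.X → ℤ))).comp
      ℓ.fiberLattice.subtype.toAddMonoidHom
  refine RPC.dominant_of_generators f
    (s := (fun k => k.comp (RPC.Hom.map ℓ.fiberProj)) '' s ∪ Set.range B)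
    ((hs.image _).union (Set.finite_range B)) (fun z => ⟨?_, fun hz => ?_⟩) ?_
  · rintro ⟨h1, h2⟩ k (⟨k, hk, rfl⟩ | ⟨x, rfl⟩)
    · exact (hσ _).1 h1 k hk
    · exact h2 x
  · exact ⟨(hσ _).2 fun k hk => hz _ (Or.inl ⟨k, hk, rfl⟩), fun x => hz _ (Or.inr ⟨x, rfl⟩)⟩
  · rintro _ (⟨k, hk, rfl⟩ | ⟨x, rfl⟩) e
    · have : k = 0 := h k (fun x hx => (hσ x).1 hx k hk) fun x _ => DFunLike.congr_fun e x
      simp [this]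
    · by_cases hx : G.IsExc (G.r x) ∧ G.r x ≠ x
      · refine (h' x hx.1 hx.2 ?_).elim
        rw [← e]
        ext z
        exact ℓ.tautLen_exc hx.1 _
      · ext z
        exact z.2.1 x hx

open Classical in
/-- The map to the cone of `G` given by a metric `d` on `G` whose stabilization is the pullback
of `ℓ`. -/
noncomputable def fiberLift (ℓ : Metric (G.st hG) σ) (d : Metric G κ) (b : κ ⟶ σ)
    (H : ∀ x, ¬ G.IsExc (G.r x) → (ℓ.ext x).comp (RPC.Hom.map b) = d.stLen x) :
    κ ⟶ ℓ.fiberCone where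
  map := AddMonoidHom.codRestrict
    ((RPC.Hom.map b).prod (AddMonoidHom.mk' (fun z x => if G.IsExc (G.r x) then d.len x z else 0)
      (fun y z => by ext x; by_cases h : G.IsExc (G.r x) <;> simp [h])))
    ℓ.fiberLattice (fun z => by
      refine ⟨fun x hx => ?_, fun x h hx => ?_⟩
      · change (if _ then _ else _) = (0 : ℤ)
        split_ifs with h
        · rw [d.vertex (not_not.1 fun e => hx ⟨h, e⟩)]; rfl
        · rfl
      · change (if _ then _ else _) + (if _ then _ else _) = ℓ.ext (G.i x) (RPC.Hom.map b z)
        have := DFunLike.congr_fun (H (G.i x) (hG.not_exc_i h hx)) z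
        rw [if_pos h, if_pos (by rwa [MGraph.r_sw h hx])]
        refine Eq.trans ?_ this.symm
        rw [d.stLen_exc (by rwa [G.i_i]), G.i_i, d.symm]
        rfl)
  map_pts z hz := ⟨b.map_pts z hz, fun x => by
    change (0 : ℤ) ≤ if _ then _ else _
    split_ifs
    · exact d.mem x z hz
    · exact le_rfl⟩

section fiberLift

variable {ℓ : Metric (G.st hG) σ} {d : Metric G κ} {b : κ ⟶ σ}
    (H : ∀ x, ¬ G.IsExc (G.r x) → (ℓ.ext x).comp (RPC.Hom.map b) = d.stLen x)

theorem taut_fiberLift (x : G.X) :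
    (ℓ.taut.len x).comp (RPC.Hom.map (fiberLift ℓ d b H)) = d.len x := by
  have main : ∀ x, G.IsExc (G.r x) →
      (ℓ.taut.len x).comp (RPC.Hom.map (fiberLift ℓ d b H)) = d.len x := by
    intro x hx
    ext z
    exact (ℓ.tautLen_exc hx _).trans (if_pos hx)
  by_cases hx : G.IsExc (G.r x)
  · exact main x hx
  · by_cases hx' : G.IsExc (G.r (G.i x))
    · have := main (G.i x) hx'
      rwa [ℓ.taut.symm, d.symm] at this
    · have := H x hx
      rw [d.stLen_nex hx'] at this
      rw [← this]
      ext z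
      exact ℓ.tautLen_nex hx hx' _

theorem dominant_fiberLift (hb : RPC.Dominant b) : RPC.Dominant (fiberLift ℓ d b H) := by
  refine dominant_fiberCone _ hb fun x hx hx' e => ?_
  rw [taut_fiberLift, d.zero_iff] at e
  exact (hG.exc_edges x hx hx').1 e

end fiberLift

end Metric

end TropJac

/-! ### Morphisms and objects of the Jacobian cone space -/

namespace TropJac

variable {g n : ℕ} {Γ : TropM g n}

namespace ModularMorphism

variable (m : ModularMorphism Γ)

/-- The map from the pullback along `u` to `Γ`. -/
noncomputable def toCurve (u : Over Γ.base) : m.functor.obj u ⟶ Γ :=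
  m.functor.map (Over.mkIdTerminal.from u) ≫ m.atId.hom

theorem map_base {u v : Over Γ.base} (f : u ⟶ v) :
    TropM.Hom.base (m.functor.map f) ≫ m.onBase.hom.app v = m.onBase.hom.app u ≫ f.left :=
  m.onBase.hom.naturality f

theorem toCurve_base (u : Over Γ.base) :
    TropM.Hom.base (m.toCurve u) = m.onBase.hom.app u ≫ u.hom := by
  have h1 := m.map_base (Over.mkIdTerminal.from u)
  rw [← m.atId_over] at h1
  refine h1.trans (congrArg (fun k => m.onBase.hom.app u ≫ k) ?_)
  exact (Category.comp_id _).symm.trans (Over.w (Over.mkIdTerminal.from u))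

theorem map_toCurve {u v : Over Γ.base} (f : u ⟶ v) :
    m.functor.map f ≫ m.toCurve v = m.toCurve u := by
  rw [toCurve, toCurve, ← Category.assoc, ← Functor.map_comp]
  congr 2
  exact Over.mkIdTerminal.hom_ext _ _

end ModularMorphism

variable [HyperbolicPair g n] {P : ObjectProperty (QD g n)}

/-- Morphisms of the Jacobian cone space are determined by the morphisms of curves with divisors; the map
of faces is determined, as the inclusions of faces are injective. -/
theorem jac_hom_ext {x y : Jac P Γ} {f f' : x ⟶ y}
    (h : TropJ.Hom.base ((jacToJ P Γ).map f) = TropJ.Hom.base ((jacToJ P Γ).map f'))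
    (h' : TropJ.Hom.div ((jacToJ P Γ).map f) = TropJ.Hom.div ((jacToJ P Γ).map f')) : f = f' := by
  refine ObjectProperty.hom_ext _ (CommaMorphism.ext h (JacIdx.hom_ext ?_ h'))
  have e : ∀ k : x ⟶ y, JacIdx.Hom.curve k.hom.right ≫ y.obj.right.incl = x.obj.right.incl :=
    fun k => JacIdx.Hom.over_incl k.hom.right
  refine TropM.hom_eq_of_comp_eq (f := y.obj.right.incl) ?_ ((e f).trans (e f').symm)
  have := y.obj.right.face.mono
  rw [← cancel_mono (TropM.Hom.base y.obj.right.incl)]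
  exact congrArg TropM.Hom.base ((e f).trans (e f').symm)

/-- Naturality of `tautHom`. -/
theorem phi_map_comp_tautHom {x y : Jac P Γ} (f : x ⟶ y) :
    (Phi P).map ((jacToJ P Γ).map f) ≫ tautHom y = tautHom x := by
  refine TropM.hom_ext (Over.w ((jacToBase P Γ).map f)) ?_
  have h1 := JacIdx.Hom.comm f.hom.right
  have h2 := congrArg TropM.Hom.graph (JacIdx.Hom.over_incl f.hom.right)
  change (TropM.Hom.graph y.obj.right.incl ≫ y.obj.right.div.obj.hom) ≫
    (forgetStab P).map (JacIdx.Hom.div f.hom.right) =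
      TropM.Hom.graph x.obj.right.incl ≫ x.obj.right.div.obj.hom
  change TropM.Hom.graph y.obj.right.incl ≫ TropM.Hom.graph (JacIdx.Hom.curve f.hom.right) =
    TropM.Hom.graph x.obj.right.incl at h2
  rw [Category.assoc, h1, ← h2, Category.assoc]

/-- A morphism of tropical curves with divisors that is compatible with the maps to `Γ` comes from the
Jacobian cone space. -/
theorem jac_exists_hom {x y : Jac P Γ} (k : (jacToJ P Γ).obj x ⟶ (jacToJ P Γ).obj y)
    (hk : (Phi P).map k ≫ tautHom y = tautHom x) : ∃ f : x ⟶ y, (jacToJ P Γ).map f = k := by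
  have hmono := y.obj.right.face.mono
  have hbase : TropJ.Hom.base k ≫ jacBase y = jacBase x := congrArg TropM.Hom.base hk
  -- the face of `σ` below `x` is contained in the face below `y`
  obtain ⟨b, hb⟩ := y.obj.right.face.exists_lift_of_dominant
    (k := TropM.Hom.base x.obj.right.incl)
    (a := x.obj.hom ≫ x.obj.right.div.lengths.fiberProj)
    (x.property.comp (Metric.dominant_fiberProj _))
    (a' := TropJ.Hom.base k ≫ y.obj.hom ≫ y.obj.right.div.lengths.fiberProj) hbase
  obtain ⟨c, hc, hc'⟩ := TropM.exists_lift x.obj.right.incl y.obj.right.incl b hb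
  have comm : y.obj.right.div.obj.hom ≫ (forgetStab P).map (TropJ.Hom.div k) =
      TropM.Hom.graph c ≫ x.obj.right.div.obj.hom := by
    refine (cancel_epi (TropM.Hom.graph y.obj.right.incl)).1 ?_
    have h1 : (TropM.Hom.graph y.obj.right.incl ≫ y.obj.right.div.obj.hom) ≫
        (forgetStab P).map (TropJ.Hom.div k) =
        TropM.Hom.graph x.obj.right.incl ≫ x.obj.right.div.obj.hom :=
      congrArg TropM.Hom.graph hk
    have h2 : TropM.Hom.graph y.obj.right.incl ≫ TropM.Hom.graph c =
      TropM.Hom.graph x.obj.right.incl := congrArg TropM.Hom.graph hc'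
    refine (Category.assoc _ _ _).symm.trans (h1.trans ?_)
    rw [← h2]
    exact Category.assoc _ _ _
  let r : x.obj.right ⟶ y.obj.right := JacIdx.Hom.mk c hc' (TropJ.Hom.div k) comm
  have w : TropJ.Hom.base k ≫ y.obj.hom = x.obj.hom ≫ (coneFunctor P Γ).map r := by
    refine Metric.fiberCone_hom_ext ?_ fun q _ => ?_
    · refine (cancel_mono (TropM.Hom.base y.obj.right.incl)).1 (hbase.trans ?_)
      exact congrArg (fun l => x.obj.hom ≫ x.obj.right.div.lengths.fiberProj ≫ l)
        (congrArg TropM.Hom.base hc').symm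
    · have h1 := TropJ.Hom.len k q
      have h2 := Metric.taut_fiberMap (JacIdx.Hom.compat r) q
      refine Eq.trans h1 ?_
      exact congrArg (fun l : _ →+ ℤ => l.comp (RPC.Hom.map x.obj.hom)) h2.symm
  exact ⟨ObjectProperty.homMk (CommaMorphism.mk (TropJ.Hom.base k) r w), rfl⟩

/-- A tropical curve with divisor whose stabilization maps to `Γ` comes from the Jacobian cone space. -/
theorem jac_exists_obj (C : TropJ P) (β : (Phi P).obj C ⟶ Γ) :
    ∃ (x : Jac P Γ) (e : (jacToJ P Γ).obj x ≅ C), (Phi P).map e.hom ≫ β = tautHom x := by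
  obtain ⟨τ, b, j, hb, hj, e⟩ := RPC.exists_dominant_isFace (TropM.Hom.base β)
  obtain ⟨h, rfl, h'⟩ := TropM.exists_lift β (Γ.pullbackHom j) b e
  let ρ : QDOver P (Γ.pullback j).graph :=
    ⟨StructuredArrow.mk (Y := C.div) (TropM.Hom.graph h), TropM.isIso_graph h hb⟩
  let A : JacIdx P Γ := ⟨Γ.pullback j, Γ.pullbackHom j, hj, ρ⟩
  have H : ∀ x, ¬ C.div.obj.graph.obj.IsExc (C.div.obj.graph.obj.r x) →
      (ρ.lengths.ext x).comp (RPC.Hom.map (TropM.Hom.base h)) = C.metric.stLen x := by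
    intro x hx
    rw [Metric.ext_nex _ hx]
    refine (TropM.Hom.len h (MGraph.Hom.map ρ.iso.inv ⟨x, hx⟩)).trans ?_
    have : MGraph.Hom.map (TropM.Hom.graph h).hom (MGraph.Hom.map ρ.iso.inv ⟨x, hx⟩) = ⟨x, hx⟩ :=
      congrArg (fun k => MGraph.Hom.map k _) ρ.iso.inv_hom_id
    rw [this]
    rfl
  let x : Jac P Γ := ⟨⟨C.base, A, Metric.fiberLift ρ.lengths C.metric (TropM.Hom.base h) H⟩,
    Metric.dominant_fiberLift H hb⟩
  have hlen : ∀ q, ((jacToJ P Γ).obj x).metric.len q = C.metric.len q :=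
    Metric.taut_fiberLift H
  let e : (jacToJ P Γ).obj x ≅ C :=
    { hom := TropJ.Hom.mk (Γ := (jacToJ P Γ).obj x) (Γ' := C) (𝟙 C.base) (𝟙 C.div)
        fun q => (hlen q).symm
      inv := TropJ.Hom.mk (Γ := C) (Γ' := (jacToJ P Γ).obj x) (𝟙 C.base) (𝟙 C.div) hlen
      hom_inv_id := TropJ.hom_ext rfl rfl
      inv_hom_id := TropJ.hom_ext rfl rfl }
  refine ⟨x, e, TropM.hom_ext (congrArg TropM.Hom.base h').symm ?_⟩
  refine Eq.trans ?_ (congrArg TropM.Hom.graph h').symm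
  change TropM.Hom.graph β ≫ (forgetStab P).map (𝟙 C.div) = _
  rw [(forgetStab P).map_id]
  exact Category.comp_id (TropM.Hom.graph β)

namespace ModularMorphism

variable (m : ModularMorphism Γ)

/-- The component of `squareIso`: over the comparison of the base cones there is exactly one isomorphism
that is compatible with the maps to `Γ`. -/
noncomputable def squareIsoApp (x : Jac P Γ) :
    m.functor.obj ((jacToBase P Γ).obj x) ≅ (Phi P).obj ((jacToJ P Γ).obj x) :=
  TropM.liftIso (m.toCurve ((jacToBase P Γ).obj x)) (tautHom x)
    (m.onBase.app ((jacToBase P Γ).obj x)) (m.toCurve_base _).symm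

theorem squareIsoApp_base (x : Jac P Γ) : TropM.Hom.base (m.squareIsoApp x).hom =
    m.onBase.hom.app ((jacToBase P Γ).obj x) :=
  TropM.lift_base (m.toCurve ((jacToBase P Γ).obj x)) (tautHom x)
    (m.onBase.app ((jacToBase P Γ).obj x)).hom (m.toCurve_base _).symm

theorem squareIsoApp_comp (x : Jac P Γ) : (m.squareIsoApp x).hom ≫ tautHom x =
    m.toCurve ((jacToBase P Γ).obj x) :=
  TropM.lift_comp (m.toCurve ((jacToBase P Γ).obj x)) (tautHom x)
    (m.onBase.app ((jacToBase P Γ).obj x)).hom (m.toCurve_base _).symm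

/-- The isomorphism that makes the square commute; naturality can be checked after composing with the
maps to `Γ`. -/
noncomputable def squareIso (P : ObjectProperty (QD g n)) :
    jacToBase P Γ ⋙ m.functor ≅ jacToJ P Γ ⋙ Phi P :=
  NatIso.ofComponents m.squareIsoApp fun {x y} f => by
    refine TropM.hom_eq_of_comp_eq (f := tautHom y) ?_ ?_
    · refine (congrArg (fun k => TropM.Hom.base (m.functor.map ((jacToBase P Γ).map f)) ≫ k)
        (m.squareIsoApp_base y)).trans ?_
      refine (m.map_base ((jacToBase P Γ).map f)).trans ?_
      exact congrArg (fun k => k ≫ f.hom.left) (m.squareIsoApp_base x).symm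
    · rw [Category.assoc, Category.assoc, m.squareIsoApp_comp]
      refine (m.map_toCurve ((jacToBase P Γ).map f)).trans ?_
      refine (m.squareIsoApp_comp x).symm.trans ?_
      exact congrArg (fun k => (m.squareIsoApp x).hom ≫ k) (phi_map_comp_tautHom f).symm

end ModularMorphism

end TropJac

/-! ### The comparison with the fiber product -/

namespace TropJac

variable {g n : ℕ} {Γ : TropM g n} [HyperbolicPair g n] {P : ObjectProperty (QD g n)}

namespace ModularMorphism

variable (m : ModularMorphism Γ)

/-- The functor from the Jacobian cone space to the 2-fiber product. -/
noncomputable abbrev comparison (P : ObjectProperty (QD g n)) :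
    Jac P Γ ⥤ Limits.CategoricalPullback m.functor (Phi P) :=
  (Limits.CategoricalPullback.CatCommSqOver.toFunctorToCategoricalPullback
    m.functor (Phi P) (Jac P Γ)).obj ⟨jacToBase P Γ, jacToJ P Γ, m.squareIso P⟩

instance : (m.comparison P).Faithful where
  map_injective {x y f f'} h := by
    have h2 : (jacToJ P Γ).map f = (jacToJ P Γ).map f' := congrArg (fun k => k.snd) h
    exact jac_hom_ext (congrArg TropJ.Hom.base h2) (congrArg TropJ.Hom.div h2)

instance : (m.comparison P).Full where
  map_surjective {x y} ψ := by
    let a : (jacToBase P Γ).obj x ⟶ (jacToBase P Γ).obj y := ψ.fst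
    let k : (jacToJ P Γ).obj x ⟶ (jacToJ P Γ).obj y := ψ.snd
    have w : m.functor.map a ≫ (m.squareIsoApp y).hom =
      (m.squareIsoApp x).hom ≫ (Phi P).map k := ψ.w
    obtain ⟨f, hf⟩ := jac_exists_hom k (by
      rw [← cancel_epi (m.squareIsoApp x).hom, m.squareIsoApp_comp, ← Category.assoc, ← w,
        Category.assoc, m.squareIsoApp_comp, m.map_toCurve])
    refine ⟨f, Limits.CategoricalPullback.hom_ext (Over.OverMorphism.ext ?_) hf⟩
    have h1 : TropJ.Hom.base k = f.hom.left := congrArg TropJ.Hom.base hf.symm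
    have h2 : TropM.Hom.base (m.functor.map a) ≫ TropM.Hom.base (m.squareIsoApp y).hom =
      TropM.Hom.base (m.squareIsoApp x).hom ≫ TropJ.Hom.base k := congrArg TropM.Hom.base w
    rw [m.squareIsoApp_base, m.squareIsoApp_base] at h2
    refine (cancel_epi (m.onBase.hom.app ((jacToBase P Γ).obj x))).1 ?_
    refine Eq.trans ?_ (h2.symm.trans (m.map_base a))
    rw [h1]
    rfl

instance : (m.comparison P).EssSurj where
  mem_essImage Z := by
    let u := Z.fst
    let β : (Phi P).obj Z.snd ⟶ Γ := Z.iso.inv ≫ m.toCurve u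
    obtain ⟨x, e, he⟩ := jac_exists_obj Z.snd β
    let ib : Z.snd.base ≅ TropM.base (m.functor.obj u) := (TropM.toRPC g n).mapIso Z.iso.symm
    let eb : x.obj.left ≅ Z.snd.base := (TropJ.toRPC P).mapIso e
    let e₁ : (jacToBase P Γ).obj x ≅ u := Over.isoMk (eb ≪≫ ib ≪≫ m.onBase.app u) (by
      have h : eb.hom ≫ TropM.Hom.base β = jacBase x := congrArg TropM.Hom.base he
      have h' : TropM.Hom.base β = ib.hom ≫ m.onBase.hom.app u ≫ u.hom :=
        congrArg (fun k => ib.hom ≫ k) (m.toCurve_base u)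
      rw [h'] at h
      exact h)
    refine ⟨x, ⟨Limits.CategoricalPullback.mkIso e₁ e ?_⟩⟩
    change m.functor.map e₁.hom ≫ Z.iso.hom = (m.squareIsoApp x).hom ≫ (Phi P).map e.hom
    refine TropM.hom_eq_of_comp_eq (f := β) ?_ ?_
    · have h1 := m.map_base e₁.hom
      have h2 := m.squareIsoApp_base x
      have h3 : TropM.Hom.base (m.functor.map e₁.hom) =
          m.onBase.hom.app ((jacToBase P Γ).obj x) ≫ eb.hom ≫ ib.hom :=
        (cancel_mono (m.onBase.hom.app u)).1 h1
      change TropM.Hom.base (m.functor.map e₁.hom) ≫ ib.inv =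
        TropM.Hom.base (m.squareIsoApp x).hom ≫ eb.hom
      rw [h2]
      refine (congrArg (fun k => k ≫ ib.inv) h3).trans ?_
      exact congrArg (fun k => m.onBase.hom.app ((jacToBase P Γ).obj x) ≫ eb.hom ≫ k) ib.hom_inv_id
    · rw [Category.assoc, Category.assoc, he, m.squareIsoApp_comp]
      refine Eq.trans ?_ (m.map_toCurve e₁.hom)
      exact congrArg (fun k => m.functor.map e₁.hom ≫ k) (Z.iso.hom_inv_id_assoc _)

end ModularMorphism

instance : (JacOpen.incl P Γ).Faithful where
  map_injective {x y f f'} h := by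
    refine ObjectProperty.hom_ext _ (CommaMorphism.ext ?_ ?_)
    · exact congrArg (fun k => k.hom.left) h
    · refine Quiver.Hom.unop_inj (ObjectProperty.hom_ext _ (StructuredArrow.hom_ext _ _ ?_))
      exact congrArg (fun k => JacIdx.Hom.div k.hom.right) h

instance : (JacOpen.incl P Γ).Full where
  map_surjective {x y} f := by
    have hc : JacIdx.Hom.curve f.hom.right = 𝟙 Γ :=
      (Category.comp_id _).symm.trans (JacIdx.Hom.over_incl f.hom.right)
    have hw : y.obj.right.unop.obj.hom ≫ (forgetStab P).map (JacIdx.Hom.div f.hom.right) =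
        x.obj.right.unop.obj.hom := by
      have h := JacIdx.Hom.comm f.hom.right
      rw [hc] at h
      exact h.trans (Category.id_comp _)
    let r : x.obj.right ⟶ y.obj.right :=
      Quiver.Hom.op (ObjectProperty.homMk (StructuredArrow.homMk (JacIdx.Hom.div f.hom.right) hw))
    have hr : (JacIdx.whole P Γ).map r = f.hom.right := JacIdx.hom_ext hc.symm rfl
    refine ⟨ObjectProperty.homMk (CommaMorphism.mk f.hom.left r ?_), ?_⟩
    · refine f.hom.w.trans ?_
      exact congrArg (fun k => x.obj.hom ≫ (coneFunctor P Γ).map k) hr.symm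
    · exact ObjectProperty.hom_ext _ (CommaMorphism.ext rfl hr)

/-- The objects whose image in `σ` is in no proper face are, up to isomorphism, those indexed by a triple
over the graph of `Γ`. -/
theorem jacOpen_essImage_iff (x : Jac P Γ) :
    (JacOpen.incl P Γ).essImage x ↔ RPC.Dominant ((jacToBase P Γ).obj x).hom := by
  constructor
  · rintro ⟨y, ⟨e⟩⟩
    have hy : RPC.Dominant ((jacToBase P Γ).obj ((JacOpen.incl P Γ).obj y)).hom :=
      y.property.comp (Metric.dominant_fiberProj _)
    have h := Over.w ((jacToBase P Γ).map e.hom)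
    rw [← h] at hy
    exact hy.of_comp
  · intro h
    -- the image of `x` lies in the face of its index, which therefore is all of `σ`
    have hd : RPC.Dominant (TropM.Hom.base x.obj.right.incl) :=
      RPC.Dominant.of_comp (f := x.obj.hom ≫ x.obj.right.div.lengths.fiberProj) h
    have := x.obj.right.face.isIso_of_dominant hd
    have := TropM.isIso_of_base x.obj.right.incl
    have := TropM.isIso_graph x.obj.right.incl hd
    have := x.obj.right.div.property
    let c : QDOver P Γ.graph := ⟨StructuredArrow.mk
      (TropM.Hom.graph x.obj.right.incl ≫ x.obj.right.div.obj.hom), IsIso.comp_isIso⟩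
    let v : Γ ⟶ x.obj.right.curve := inv x.obj.right.incl
    have hv : x.obj.right.incl ≫ v = 𝟙 _ := IsIso.hom_inv_id _
    have hv' : v ≫ x.obj.right.incl = 𝟙 _ := IsIso.inv_hom_id _
    let f : x.obj.right ⟶ (JacIdx.whole P Γ).obj (.op c) :=
      JacIdx.Hom.mk x.obj.right.incl (Category.comp_id _) (𝟙 _)
        ((congrArg (fun k => c.obj.hom ≫ k) ((forgetStab P).map_id _)).trans (Category.comp_id _))
    let f' : (JacIdx.whole P Γ).obj (.op c) ⟶ x.obj.right :=
      JacIdx.Hom.mk v hv' (𝟙 _) (by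
        refine ((congrArg (fun k => x.obj.right.div.obj.hom ≫ k)
          ((forgetStab P).map_id _)).trans (Category.comp_id _)).trans ?_
        have h : TropM.Hom.graph v ≫ TropM.Hom.graph x.obj.right.incl = 𝟙 _ :=
          congrArg TropM.Hom.graph hv
        refine Eq.trans ?_ (Category.assoc (TropM.Hom.graph v) (TropM.Hom.graph x.obj.right.incl)
          x.obj.right.div.obj.hom)
        rw [h]
        exact (Category.id_comp _).symm)
    let e : x.obj.right ≅ (JacIdx.whole P Γ).obj (.op c) :=
      ⟨f, f', JacIdx.hom_ext hv (Category.id_comp _),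
        JacIdx.hom_ext hv' (Category.id_comp _)⟩
    let ce := (coneFunctor P Γ).mapIso e
    let y : JacOpen P Γ := ⟨⟨x.obj.left, .op c, x.obj.hom ≫ ce.hom⟩,
      x.property.comp (RPC.dominant_of_isIso ce.hom)⟩
    refine ⟨y, ⟨ObjectProperty.isoMk _ (Comma.isoMk (Iso.refl _) e.symm ?_)⟩⟩
    refine (Category.id_comp _).trans ?_
    change x.obj.hom = (x.obj.hom ≫ ce.hom) ≫ ce.inv
    rw [Category.assoc, ce.hom_inv_id]
    exact (Category.comp_id _).symm

end TropJac

open CategoryTheory TropJac in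
theorem theoremT {g n : ℕ} [HyperbolicPair g n] (V : Variant g n) (Γ : TropM g n) :
    Nonempty (ModularMorphism Γ) ∧
    (∀ m : ModularMorphism Γ,
      ∃ α : jacToBase V.prop Γ ⋙ m.functor ≅ jacToJ V.prop Γ ⋙ Phi V.prop,
        (∀ x, (TropM.toRPC g n).map (α.hom.app x) =
          m.onBase.hom.app ((jacToBase V.prop Γ).obj x)) ∧
        (∀ x, α.hom.app x ≫ tautHom x =
          m.functor.map (Over.mkIdTerminal.from ((jacToBase V.prop Γ).obj x)) ≫ m.atId.hom) ∧
        ((Limits.CategoricalPullback.CatCommSqOver.toFunctorToCategoricalPullback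
          m.functor (Phi V.prop) (Jac V.prop Γ)).obj
            ⟨jacToBase V.prop Γ, jacToJ V.prop Γ, α⟩).IsEquivalence) ∧
    (JacOpen.incl V.prop Γ).Full ∧ (JacOpen.incl V.prop Γ).Faithful ∧
    ∀ x : Jac V.prop Γ, (JacOpen.incl V.prop Γ).essImage x ↔
      RPC.Dominant ((jacToBase V.prop Γ).obj x).hom := by
  refine ⟨⟨.ofPullback Γ⟩, fun m => ⟨m.squareIso V.prop, m.squareIsoApp_base, m.squareIsoApp_comp, ?_⟩,
    inferInstance, inferInstance, jacOpen_essImage_iff⟩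
  change (m.comparison V.prop).IsEquivalence
  exact {}
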